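/- Fix $\sigma_L>0$. Let $J_0,J_1$ be Bessel functions of the first kind, $0<j_1<j_2<\dots$ the positive zeros of $J_0$, and for $n\ge1$ $$a_n=\frac{j_n^2}{4\sigma_L},\qquad b_n=-\frac{2}{j_nJ_1(j_n)},\qquad K(s)=s^2\sum_{n\ge1}\frac{b_n}{a_n+s^2}+1 .$$ Write $\mathcal L f(s)=\int_0^\infty e^{-s\tau}f(\tau)\,d\tau$ and, for $\gamma>0$, $\mathcal L^{-1}_\gamma F(\tau)=\frac1{2\pi}\int_{-\infty}^\infty e^{(\gamma+i\omega)\tau}F(\gamma+i\omega)\,d\omega$. **A. Linearised problem.** Let $\psi_b$ be twice differentiable on $[0,\infty)$ with $\psi_b(0)=\psi_b'(0)=0$, and put $$c_n(\tau)=\frac{b_n}{\sqrt{a_n}}\int_0^\tau\sin(\sqrt{a_n}(\tau-\xi))\,\psi_b''(\xi)\,d\xi .$$ Consider the problem $$\partial_\tau^2\psi=\sigma\partial_\sigma^2\psi+\partial_\sigma\psi,\quad \psi(\sigma,0)=\psi_\tau(\sigma,0)=0,\quad \psi(\sigma_L,\tau)=\psi_b(\tau),\quad |\psi(0,\tau)|<\infty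 \tag{1}$$ on $[0,\sigma_L]\times[0,\infty)$. A solution means a function continuous on $[0,\sigma_L]\times[0,\infty)$, $C^1$ on $(0,\sigma_L)\times[0,\infty)$ and $C^2$ on $(0,\sigma_L)\times(0,\infty)$, where the equation holds. 1. (Finite time window.) Let $T\ge0$ and let $\psi_b''$ be bounded on $[0,T]$. Then $\sum_n c_n$ converges absolutely at every point of $[0,T]$ and uniformly on $[0,T]$, and for every $s\in\mathbb C$, $\int_0^Te^{-s\tau}\sum_nc_n\,d\tau=\sum_n\int_0^Te^{-s\tau}c_n\,d\tau$. Every solution of (1) satisfies, for $\tau\in[0,T]$ and $\sigma\in[0,\sigma_L]$, $\psi(\sigma,\tau)=\psi_b(\tau)+\sum_nc_n(\tau)J_0\big(j_n\sqrt{\sigma/\sigma_L}\big)$, and in particular $\psi(0,\tau)=\psi_b(\tau)+\sum_nc_n(\tau)$. 2. (Inversion.) Let $\psi_b''$ be bounded on $[0,\infty)$. Every solution of (1) has shoreline value $\psi_{sh}=\psi(0,\cdot)$ satisfying the shoreline equation $$\psi_{sh}=\psi_b+\sum_{n\ge1}c_n=\psi_b+\sum_{n\ge1}\frac{b_n}{\sqrt{a_n}}\sin(\sqrt{a_n}\,\tau)*\psi_b''\quad\text{on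 }[0,\infty).\tag{2}$$ Whenever (2) holds, then for every $s$ with $\operatorname{Re}s>0$: the Laplace integrals of $\psi_b$, $\psi_{sh}$ and all $c_n$ at $s$ converge absolutely; $\mathcal Lc_n(s)=\frac{s^2b_n}{a_n+s^2}\mathcal L\psi_b(s)$; the transform of $\sum_nc_n$ is $\sum_n\mathcal Lc_n(s)$; the series in $K(s)$ converges absolutely; $\mathcal L\psi_{sh}(s)=\mathcal L\psi_b(s)\,K(s)$; and $K(s)\ne0$. For every $\gamma>0$ and $\tau\ge0$ the integral defining the right-hand side below converges absolutely, and $$\psi_b(\tau)=\mathcal L^{-1}_\gamma\big[\mathcal L\psi_{sh}\cdot K^{-1}\big](\tau).\tag{3}$$ **B. Recovery of the buoy data from the run-up.** Let $(u,\eta)$ be a non-breaking wave starting from rest, described as follows. The wet region is $W=\{(x,t):t\ge0,\ -R(t)\le x\le X(t)\}$ with $R\in C^1[0,\infty)$, $X$ continuous on $[0,\infty)$, $-R<X$. In its interior $u,\eta$ are differentiable and $$\eta_t+u\,\partial_x(x+\eta)+(x+\eta)u_x=0,\qquad u_t+uu_x+\eta_x=0 .$$ At the shoreline $\eta(-R(t),t)=R(t)$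 and $u(-R(t),t)=-R'(t)$; at the right end $X(t)+\eta(X(t),t)=\sigma_L$; initially $R(0)=0$ and $u(x,0)=\eta(x,0)=0$ for $0\le x\le X(0)$. The wave does not break: the Carrier–Greenspan map $(x,t)\mapsto(\sigma,\tau)=(x+\eta,\,t-u)$ is a bijection of $W$ onto $[0,\sigma_L]\times[0,\infty)$. The functions $\varphi(\sigma,\tau)=u$ and $\psi(\sigma,\tau)=\eta+u^2/2$ are continuous on $[0,\sigma_L]\times[0,\infty)$, $C^1$ on $(0,\sigma_L)\times[0,\infty)$ and $C^2$ on $(0,\sigma_L)\times(0,\infty)$. Then: 1. $\psi_\tau+\sigma\varphi_\sigma+\varphi=0$ and $\varphi_\tau+\psi_\sigma=0$ on $(0,\sigma_L)\times(0,\infty)$; $\psi$ solves (1) with $\psi_b=\psi(\sigma_L,\cdot)$; $t\mapsto t+R'(t)$ is a bijection of $[0,\infty)$; and $\psi(0,t+R'(t))=R(t)+\tfrac12R'(t)^2$. 2. Suppose in addition that $\psi_b=\psi(\sigma_L,\cdot)$ is twice differentiable on $[0,\infty)$ with $\psi_b(0)=\psi_b'(0)=0$ and $\psi_b''$ bounded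 on $[0,\infty)$. Then (3), with the function $\psi_{sh}$ determined on $[0,\infty)$ by $\psi_{sh}(t+R'(t))=R(t)+\tfrac12R'(t)^2$, holds for all $\gamma>0$, $\tau\ge0$, with absolutely convergent integral. With $c_n$ formed from this $\psi_b$ and $d_n(\tau)=\int_0^\tau c_n$, $$\psi(\sigma,\tau)=\psi_b(\tau)+\sum_nc_n(\tau)J_0\big(j_n\sqrt{\sigma/\sigma_L}\big)\ (0\le\sigma\le\sigma_L),\qquad \varphi(\sigma,\tau)=\frac1{2\sigma_L}\Big(\frac{\sigma_L}{\sigma}\Big)^{1/2}\sum_nj_nd_n(\tau)J_1\big(j_n\sqrt{\sigma/\sigma_L}\big)\ (0<\sigma\le\sigma_L)$$ for all $\tau\ge0$, with absolutely convergent series. For all $L$ and $t\ge0$ with $-R(t)<L\le X(t)$, there is exactly one $(\sigma,\tau)\in(0,\sigma_L]\times[0,\infty)$ with $\sigma=L+\psi-\tfrac12\varphi^2$ and $\tau=t-\varphi$ (with $\psi,\varphi$ given by these series at $(\sigma,\tau)$), and at this point $u(L,t)=\varphi$ and $\eta(L,t)=\psi-\tfrac12\varphi^2$. 3. Consequently,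 for the given $\sigma_L$, two such waves (satisfying the hypothesis of B.2) with the same run-up $R$ have the same $u(L,t)$ and $\eta(L,t)$ at every $L$ and $t\ge0$ with $-R(t)<L$ for which $(L,t)$ belongs to both wet regions. -/

import Mathlib

open Set Filter Topology MeasureTheory

noncomputable section

/-- Bessel function of the first kind of integer order `m ≥ 0`. -/
def besselJ (m : ℕ) (x : ℝ) : ℝ :=
  ∑' k : ℕ, (-1 : ℝ) ^ k / ((k.factorial : ℝ) * ((k + m).factorial : ℝ)) * (x / 2) ^ (2 * k + m)

/-- The positive zeros of `J₀` in increasing order; `besselZero n` is the `(n+1)`-st one. -/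
def besselZero : ℕ → ℝ
  | 0 => sInf {x : ℝ | 0 < x ∧ besselJ 0 x = 0}
  | n + 1 => sInf {x : ℝ | besselZero n < x ∧ besselJ 0 x = 0}

/-- `a_n = j_n² / (4 σ_L)`. -/
def coeffA (σL : ℝ) (n : ℕ) : ℝ := besselZero n ^ 2 / (4 * σL)

/-- `b_n = -2 / (j_n J₁(j_n))`. -/
def coeffB (n : ℕ) : ℝ := -2 / (besselZero n * besselJ 1 (besselZero n))

/-- `c_n(τ) = (b_n / √a_n) ∫₀^τ sin(√a_n (τ - ξ)) f(ξ) dξ`, used with `f = ψ_b''`. -/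
def modeCoeff (σL : ℝ) (f : ℝ → ℝ) (n : ℕ) (τ : ℝ) : ℝ :=
  coeffB n / √(coeffA σL n) * ∫ ξ in (0 : ℝ)..τ, Real.sin (√(coeffA σL n) * (τ - ξ)) * f ξ

/-- The `n`-th term of the Fourier–Bessel series for `ψ - ψ_b`. -/
def psiMode (σL : ℝ) (f : ℝ → ℝ) (n : ℕ) (σ τ : ℝ) : ℝ :=
  modeCoeff σL f n τ * besselJ 0 (besselZero n * √(σ / σL))

/-- `ψ(σ,τ) = ∑ c_n(τ) J₀(j_n √(σ/σ_L)) + ψ_b(τ)`. -/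
def psiSeries (σL : ℝ) (ψb f : ℝ → ℝ) (σ τ : ℝ) : ℝ :=
  (∑' n, psiMode σL f n σ τ) + ψb τ

/-- The `n`-th term of the Fourier–Bessel series for `φ`, with `d_n(τ) = ∫₀^τ c_n`. -/
def phiMode (σL : ℝ) (f : ℝ → ℝ) (n : ℕ) (σ τ : ℝ) : ℝ :=
  besselZero n * (∫ ξ in (0 : ℝ)..τ, modeCoeff σL f n ξ) * besselJ 1 (besselZero n * √(σ / σL))

/-- `φ(σ,τ) = (1 / (2 σ_L)) (σ_L/σ)^{1/2} ∑ j_n d_n(τ) J₁(j_n √(σ/σ_L))`, meant for `σ > 0`. -/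
def phiSeries (σL : ℝ) (f : ℝ → ℝ) (σ τ : ℝ) : ℝ :=
  1 / (2 * σL) * √(σL / σ) * ∑' n, phiMode σL f n σ τ

/-- `ψb` is twice differentiable on `[0,∞)` with derivatives `ψb'`, `ψb''`, and
`ψb(0) = ψb'(0) = 0`. -/
structure IsBoundaryDatum (ψb ψb' ψb'' : ℝ → ℝ) : Prop where
  hasDeriv_one : ∀ τ, 0 ≤ τ → HasDerivWithinAt ψb (ψb' τ) (Ici 0) τ
  hasDeriv_two : ∀ τ, 0 ≤ τ → HasDerivWithinAt ψb' (ψb'' τ) (Ici 0) τ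
  zero : ψb 0 = 0
  deriv_zero : ψb' 0 = 0

/-- `f` is bounded on `[0,∞)`. -/
def BoundedOnHalfLine (f : ℝ → ℝ) : Prop := ∃ M : ℝ, ∀ τ, 0 ≤ τ → |f τ| ≤ M

/-- Classical solutions `ψ(σ,τ)` of the hodograph-plane problem on `[0,σ_L] × [0,∞)`.
Finiteness at the singular end `σ = 0` is contained in the continuity on the closed domain. -/
structure IsIBVPSolution (σL : ℝ) (ψb : ℝ → ℝ) (ψ : ℝ → ℝ → ℝ) : Prop where
  continuousOn : ContinuousOn (fun p : ℝ × ℝ => ψ p.1 p.2) (Icc 0 σL ×ˢ Ici 0)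
  contDiffOn_one : ContDiffOn ℝ 1 (fun p : ℝ × ℝ => ψ p.1 p.2) (Ioo 0 σL ×ˢ Ici 0)
  contDiffOn_two : ContDiffOn ℝ 2 (fun p : ℝ × ℝ => ψ p.1 p.2) (Ioo 0 σL ×ˢ Ioi 0)
  pde : ∀ σ ∈ Ioo 0 σL, ∀ τ ∈ Ioi (0 : ℝ),
    iteratedDeriv 2 (fun t => ψ σ t) τ =
      σ * iteratedDeriv 2 (fun y => ψ y τ) σ + deriv (fun y => ψ y τ) σ
  init : ∀ σ ∈ Icc 0 σL, ψ σ 0 = 0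
  init_velocity : ∀ σ ∈ Ioo 0 σL, HasDerivWithinAt (fun t => ψ σ t) 0 (Ici 0) 0
  boundary : ∀ τ, 0 ≤ τ → ψ σL τ = ψb τ

/-- The shoreline equation `ψ_sh = ψ_b + ∑ (b_n/√a_n) sin(√a_n ·) * ψ_b''` on `[0,∞)`. -/
def ShorelineEquation (σL : ℝ) (ψb ψb'' ψsh : ℝ → ℝ) : Prop :=
  ∀ τ, 0 ≤ τ → HasSum (fun n => modeCoeff σL ψb'' n τ) (ψsh τ - ψb τ)

/-- The integrand `e^{-sτ} f(τ)` of the Laplace transform. -/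
def laplaceIntegrand (f : ℝ → ℝ) (s : ℂ) (τ : ℝ) : ℂ := Complex.exp (-s * (τ : ℂ)) * (f τ : ℂ)

/-- Laplace transform `∫₀^∞ e^{-sτ} f(τ) dτ`. -/
def laplace (f : ℝ → ℝ) (s : ℂ) : ℂ := ∫ τ in Ioi (0 : ℝ), laplaceIntegrand f s τ

/-- Convergence of the Laplace integral. -/
def LaplaceConvergent (f : ℝ → ℝ) (s : ℂ) : Prop :=
  IntegrableOn (laplaceIntegrand f s) (Ioi 0)

/-- The integrand `e^{sτ} F(s)`, `s = γ + iω`, of the Bromwich integral. -/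
def bromwichIntegrand (γ : ℝ) (F : ℂ → ℂ) (τ ω : ℝ) : ℂ :=
  Complex.exp (((γ : ℂ) + (ω : ℂ) * Complex.I) * (τ : ℂ)) * F ((γ : ℂ) + (ω : ℂ) * Complex.I)

/-- Inverse Laplace transform along the line `Re s = γ`:
`(1/2πi) ∫ e^{sτ} F(s) ds = (1/2π) ∫ e^{(γ+iω)τ} F(γ+iω) dω`. -/
def inverseLaplace (γ : ℝ) (F : ℂ → ℂ) (τ : ℝ) : ℂ :=
  1 / (2 * (Real.pi : ℂ)) * ∫ ω : ℝ, bromwichIntegrand γ F τ ω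

/-- `s² ∑ b_n / (a_n + s²) + 1`. -/
def transferFactor (σL : ℝ) (s : ℂ) : ℂ :=
  s ^ 2 * (∑' n, (coeffB n : ℂ) / ((coeffA σL n : ℂ) + s ^ 2)) + 1

/-- The wet region `{(x,t) : t ≥ 0, -R(t) ≤ x ≤ X(t)}`, whose left end is the moving shoreline. -/
def wetRegion (R X : ℝ → ℝ) : Set (ℝ × ℝ) :=
  {p | 0 ≤ p.2 ∧ -R p.2 ≤ p.1 ∧ p.1 ≤ X p.2}

/-- The Carrier–Greenspan change of variables `(x,t) ↦ (σ,τ) = (x + η, t - u)`. -/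
def carrierGreenspan (u η : ℝ → ℝ → ℝ) (p : ℝ × ℝ) : ℝ × ℝ :=
  (p.1 + η p.1 p.2, p.2 - u p.1 p.2)

/-- A non-breaking wave over a sloping beach, starting from rest: `(u,η)` solves the nonlinear
shallow water equations in the wet region, `R` is its run-up (with derivative `R'`), the curve
`x = X(t)` corresponds to `σ = σ_L`, the Carrier–Greenspan map is a bijection of the wet region
onto `[0,σ_L] × [0,∞)`, and `(φ,ψ)` are the transformed unknowns. -/
structure IsNonbreakingWave (σL : ℝ) (R R' X : ℝ → ℝ) (u η φ ψ : ℝ → ℝ → ℝ) : Prop where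
  hasDeriv_runup : ∀ t, 0 ≤ t → HasDerivWithinAt R (R' t) (Ici 0) t
  continuousOn_runup_deriv : ContinuousOn R' (Ici 0)
  continuousOn_right : ContinuousOn X (Ici 0)
  shore_lt_right : ∀ t, 0 ≤ t → -R t < X t
  -- at the shoreline the depth vanishes and the water moves with the shoreline
  shore_eta : ∀ t, 0 ≤ t → η (-R t) t = R t
  shore_u : ∀ t, 0 ≤ t → u (-R t) t = -R' t
  right_sigma : ∀ t, 0 ≤ t → X t + η (X t) t = σL
  init_runup : R 0 = 0
  init_u : ∀ x ∈ Icc 0 (X 0), u x 0 = 0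
  init_eta : ∀ x ∈ Icc 0 (X 0), η x 0 = 0
  -- the nonlinear shallow water equations
  differentiableAt_u : ∀ t, 0 < t → ∀ x ∈ Ioo (-R t) (X t),
    DifferentiableAt ℝ (fun p : ℝ × ℝ => u p.1 p.2) (x, t)
  differentiableAt_eta : ∀ t, 0 < t → ∀ x ∈ Ioo (-R t) (X t),
    DifferentiableAt ℝ (fun p : ℝ × ℝ => η p.1 p.2) (x, t)
  mass : ∀ t, 0 < t → ∀ x ∈ Ioo (-R t) (X t),
    deriv (fun s => η x s) t + u x t * deriv (fun y => y + η y t) x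
      + (x + η x t) * deriv (fun y => u y t) x = 0
  momentum : ∀ t, 0 < t → ∀ x ∈ Ioo (-R t) (X t),
    deriv (fun s => u x s) t + u x t * deriv (fun y => u y t) x + deriv (fun y => η y t) x = 0
  -- the Carrier–Greenspan transform
  bijOn : BijOn (carrierGreenspan u η) (wetRegion R X) (Icc 0 σL ×ˢ Ici 0)
  phi_eq : ∀ x t, (x, t) ∈ wetRegion R X → φ (x + η x t) (t - u x t) = u x t
  psi_eq : ∀ x t, (x, t) ∈ wetRegion R X → ψ (x + η x t) (t - u x t) = η x t + u x t ^ 2 / 2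
  -- regularity of the transformed unknowns
  continuousOn_phi : ContinuousOn (fun p : ℝ × ℝ => φ p.1 p.2) (Icc 0 σL ×ˢ Ici 0)
  continuousOn_psi : ContinuousOn (fun p : ℝ × ℝ => ψ p.1 p.2) (Icc 0 σL ×ˢ Ici 0)
  contDiffOn_one_phi : ContDiffOn ℝ 1 (fun p : ℝ × ℝ => φ p.1 p.2) (Ioo 0 σL ×ˢ Ici 0)
  contDiffOn_one_psi : ContDiffOn ℝ 1 (fun p : ℝ × ℝ => ψ p.1 p.2) (Ioo 0 σL ×ˢ Ici 0)
  contDiffOn_two_phi : ContDiffOn ℝ 2 (fun p : ℝ × ℝ => φ p.1 p.2) (Ioo 0 σL ×ˢ Ioi 0)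
  contDiffOn_two_psi : ContDiffOn ℝ 2 (fun p : ℝ × ℝ => ψ p.1 p.2) (Ioo 0 σL ×ˢ Ioi 0)

/-- The boundary trace `ψ(σ_L, ·)` is an admissible datum with bounded second derivative `f`. -/
def HasBoundedTrace (σL : ℝ) (ψ : ℝ → ℝ → ℝ) (f : ℝ → ℝ) : Prop :=
  (∃ g : ℝ → ℝ, IsBoundaryDatum (ψ σL) g f) ∧ BoundedOnHalfLine f

end

noncomputable section

/-! Writing J₀(j_n √(σ/σ_L)) = E₀(a_n σ) with E_m = `besselE m`, the function E₀(lσ) is the solution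
of (σ y')' + l y = 0 that is regular at 0. The modes E₀(a_n σ) are therefore the Dirichlet
eigenfunctions of the spatial operator in (1), and part A is an eigenfunction expansion.

Sizes. The quantity x(J₀² + J₁²) − J₀J₁ is almost constant for large x. Hence x J₁² is bounded below
at the zeros of J₀, the zeros are uniformly separated, j_n ≥ δ(n+1), b_n = O(j_n^{-1/2}) and
b_n/√a_n = O(j_n^{-3/2}). The last sequence is the summable majorant behind almost every exchange of
sum and limit (`summable_abs_coeffB_div_sqrt`).

Completeness. The inverse T of −(x y')' on [0,1] is symmetric and positive, and T² sends the L² unit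
ball into a compact set of continuous functions. Power iteration then finds an eigenfunction in
every nonzero closed T-invariant subspace of C([0,1]) (`exists_greenCLM_eigenvector`). The functions
orthogonal to all modes form such a subspace; since every eigenfunction is a multiple of a mode, it
is 0. So a continuous function with absolutely summable Fourier–Bessel coefficients is the sum of
its series.

Solutions of (1). Testing the equation with E₀(a_n σ) sin(√a_n (T−τ)) and integrating by parts gives
the coefficients of ψ(·,T). Nothing is known about ψ_σ near σ = 0 or σ = σ_L, so on [ε, σ_L−ε] the
mode is corrected by a constant and a multiple of log σ, both annihilated by (σ y')', to vanish at
the two ends; the correction disappears as ε → 0. The constant function 1 has coefficients −b_n, so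
subtracting ψ_b leaves exactly c_n.

Inversion. The expansion of 1 − E₀(−s²σ)/E₀(−s²σ_L), read at σ = 0, gives K(s) = 1/E₀(−s²σ_L)
(`transferFactor_eq`), finite and nonzero because the complex zeros of E₀ are real and positive.
Thus ℒψ_sh/K = ℒψ_b, which is O(|s|⁻²) on Re s = γ, and Fourier inversion applies.

Waves. The chain rule turns the shallow water equations into the linear hodograph system, and
eliminating φ gives (1). The shoreline becomes σ = 0, so R fixes ψ(0,·). Integrating φ_τ = −ψ_σ in
time and differentiating the ψ-series termwise gives the φ-series. The inverse Carrier–Greenspan map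
is explicit in φ and ψ, so R determines ψ_b by (3), then both series, then u and η. -/

/-- The entire function `∑ (-1)^k z^k / (k! (k+m)!)`, so that `J_m(x) = (x/2)^m besselE m (x²/4)`. -/
def besselE {𝕜 : Type*} [RCLike 𝕜] (m : ℕ) (z : 𝕜) : 𝕜 :=
  ∑' k : ℕ, (-1 : 𝕜) ^ k / ((k.factorial : 𝕜) * ((k + m).factorial : 𝕜)) * z ^ k

/-! ### The entire functions E_m: derivatives and recurrences -/

section RCLike

variable {𝕜 : Type*} [RCLike 𝕜]

theorem norm_besselE_coeff_le (m k : ℕ) :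
    ‖(-1 : 𝕜) ^ k / ((k.factorial : 𝕜) * ((k + m).factorial : 𝕜))‖ ≤ 1 / (k.factorial : ℝ) := by
  rw [norm_div, norm_pow, norm_neg, norm_one, one_pow, norm_mul, RCLike.norm_natCast,
    RCLike.norm_natCast]
  have h1 : (0 : ℝ) < k.factorial := by positivity
  have h2 : (1 : ℝ) ≤ (k + m).factorial := by exact_mod_cast Nat.succ_le_of_lt (Nat.factorial_pos _)
  apply one_div_le_one_div_of_le h1
  nlinarith

theorem summable_besselE (m : ℕ) (z : 𝕜) :
    Summable fun k : ℕ => (-1 : 𝕜) ^ k / ((k.factorial : 𝕜) * ((k + m).factorial : 𝕜)) * z ^ k := by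
  refine Summable.of_norm_bounded (Real.summable_pow_div_factorial ‖z‖) fun k => ?_
  rw [norm_mul, norm_pow]
  calc _ ≤ 1 / (k.factorial : ℝ) * ‖z‖ ^ k := by
        gcongr; exact norm_besselE_coeff_le m k
    _ = _ := by ring

theorem besselE_zero_right (m : ℕ) : besselE m (0 : 𝕜) = 1 / (m.factorial : 𝕜) := by
  rw [besselE, tsum_eq_single 0]
  · simp
  · intro k hk; simp [hk]

theorem hasDerivAt_besselE (m : ℕ) (z : 𝕜) : HasDerivAt (besselE m) (-besselE (m + 1) z) z := by
  set c : ℕ → 𝕜 := fun k => (-1 : 𝕜) ^ k / ((k.factorial : 𝕜) * ((k + m).factorial : 𝕜)) with hc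
  set r : ℝ := ‖z‖ + 1
  have hr : 0 < r := by positivity
  have hz : z ∈ Metric.ball (0 : 𝕜) r := by simp [r]
  have hu : Summable fun k : ℕ => 1 / (k.factorial : ℝ) * (k * r ^ (k - 1)) := by
    rw [← summable_nat_add_iff 1]
    refine (Real.summable_pow_div_factorial r).congr fun k => ?_
    rw [Nat.factorial_succ, Nat.add_sub_cancel]; push_cast
    have : (k.factorial : ℝ) ≠ 0 := by positivity
    field_simp
  have key := hasDerivAt_tsum_of_isPreconnected (𝕜 := 𝕜) hu (t := Metric.ball (0 : 𝕜) r)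
    (g := fun k z => c k * z ^ k) (g' := fun k z => c k * (k * z ^ (k - 1)))
    Metric.isOpen_ball (convex_ball _ _).isPreconnected
    (fun k y _ => (hasDerivAt_pow k y).const_mul (c k))
    (fun k y hy => by
      rw [norm_mul, norm_mul, norm_pow, RCLike.norm_natCast]
      have : ‖y‖ ≤ r := by simpa using (Metric.mem_ball.1 hy).le
      gcongr
      exact norm_besselE_coeff_le m k) hz (summable_besselE m z) hz
  have hsum : ∑' k, c k * (k * z ^ (k - 1)) = -besselE (m + 1) z := by
    have hs : Summable fun k => c k * ((k : 𝕜) * z ^ (k - 1)) := by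
      refine Summable.of_norm_bounded hu fun k => ?_
      rw [norm_mul, norm_mul, norm_pow, RCLike.norm_natCast]
      gcongr
      · exact norm_besselE_coeff_le m k
      · simp [r]
    rw [hs.tsum_eq_zero_add, besselE, ← tsum_neg]
    simp only [Nat.cast_zero, zero_mul, mul_zero, zero_add]
    refine tsum_congr fun k => ?_
    simp only [hc, Nat.add_sub_cancel]
    rw [Nat.factorial_succ, show k + 1 + m = k + (m + 1) by ring]
    push_cast
    have h1 : (k.factorial : 𝕜) ≠ 0 := by exact_mod_cast Nat.factorial_ne_zero k
    have h2 : ((k + (m + 1)).factorial : 𝕜) ≠ 0 := by exact_mod_cast Nat.factorial_ne_zero _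
    have h3 : (k : 𝕜) + 1 ≠ 0 := by exact_mod_cast Nat.succ_ne_zero k
    field_simp
    ring
  rw [← hsum]
  exact key

/-- Coefficient comparison. This recurrence is what turns E_m' = −E_{m+1} into (z E₁)' = E₀, that
is, into the differential equation of the modes. -/
theorem besselE_zero_left_eq (z : 𝕜) : besselE 0 z = besselE 1 z - z * besselE 2 z := by
  rw [besselE, besselE, besselE, ← tsum_mul_left]
  have h2 : Summable fun k : ℕ => z *
      ((-1 : 𝕜) ^ k / ((k.factorial : 𝕜) * ((k + 2).factorial : 𝕜)) * z ^ k) :=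
    (summable_besselE 2 z).mul_left z
  rw [(summable_besselE 0 z).tsum_eq_zero_add, (summable_besselE 1 z).tsum_eq_zero_add,
    add_sub_assoc, ← ((summable_nat_add_iff 1).2 (summable_besselE 1 z)).tsum_sub h2]
  simp only [Nat.factorial_zero, zero_add, Nat.factorial_one, pow_zero]
  congr 1
  refine tsum_congr fun k => ?_
  have h1 : (k.factorial : 𝕜) ≠ 0 := by exact_mod_cast Nat.factorial_ne_zero k
  have h3 : (k : 𝕜) + 1 ≠ 0 := by exact_mod_cast Nat.succ_ne_zero k
  have h4 : (k : 𝕜) + 2 ≠ 0 := by exact_mod_cast Nat.succ_ne_zero (k + 1)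
  simp only [add_zero, Nat.factorial_succ]
  push_cast
  rw [show (k : 𝕜) + 1 + 1 = k + 2 by ring]
  field_simp
  ring

theorem hasDerivAt_mul_besselE_one (z : 𝕜) :
    HasDerivAt (fun y => y * besselE 1 y) (besselE 0 z) z := by
  refine ((hasDerivAt_id z).mul (hasDerivAt_besselE 1 z)).congr_deriv ?_
  rw [besselE_zero_left_eq]
  simp [sub_eq_add_neg]

theorem continuous_besselE (m : ℕ) : Continuous (besselE m : 𝕜 → 𝕜) :=
  continuous_iff_continuousAt.2 fun z => (hasDerivAt_besselE m z).continuousAt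

end RCLike

/-! ### Passage to J₀ and J₁, and uniform bounds -/

theorem ofReal_besselE (m : ℕ) (x : ℝ) : ((besselE m x : ℝ) : ℂ) = besselE m (x : ℂ) := by
  rw [besselE, besselE, Complex.ofReal_tsum]
  push_cast
  rfl

theorem besselE_conj (m : ℕ) (z : ℂ) :
    besselE m (starRingEnd ℂ z) = starRingEnd ℂ (besselE m z) := by
  rw [besselE, besselE, Complex.conj_tsum]
  refine tsum_congr fun k => ?_
  simp

theorem besselJ_eq (m : ℕ) (x : ℝ) : besselJ m x = (x / 2) ^ m * besselE m (x ^ 2 / 4) := by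
  rw [besselJ, besselE, ← tsum_mul_left]
  refine tsum_congr fun k => ?_
  rw [pow_add, pow_mul, show (x / 2) ^ 2 = x ^ 2 / 4 by ring]
  ring

theorem besselJ_zero_eq (x : ℝ) : besselJ 0 x = besselE 0 (x ^ 2 / 4) := by
  simp [besselJ_eq]

theorem besselJ_one_eq (x : ℝ) : besselJ 1 x = x / 2 * besselE 1 (x ^ 2 / 4) := by
  simp [besselJ_eq]

theorem hasDerivAt_besselJ_zero (x : ℝ) : HasDerivAt (besselJ 0) (-besselJ 1 x) x := by
  have h : HasDerivAt (fun y : ℝ => y ^ 2 / 4) (x / 2) x := by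
    refine ((hasDerivAt_pow 2 x).div_const 4).congr_deriv ?_
    norm_num; ring
  have := (hasDerivAt_besselE 0 (x ^ 2 / 4)).comp x h
  rw [besselJ_one_eq, show besselJ 0 = besselE 0 ∘ fun y => y ^ 2 / 4 from funext besselJ_zero_eq]
  exact this.congr_deriv (by ring)

theorem hasDerivAt_besselJ_one {x : ℝ} (hx : x ≠ 0) :
    HasDerivAt (besselJ 1) (besselJ 0 x - besselJ 1 x / x) x := by
  have h : HasDerivAt (fun y : ℝ => y ^ 2 / 4) (x / 2) x := by
    refine ((hasDerivAt_pow 2 x).div_const 4).congr_deriv ?_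
    norm_num; ring
  have := ((hasDerivAt_id x).div_const 2).mul ((hasDerivAt_besselE 1 (x ^ 2 / 4)).comp x h)
  rw [besselJ_one_eq, besselJ_zero_eq, besselE_zero_left_eq,
    show besselJ 1 = (fun y => id y / 2) * besselE 1 ∘ fun y => y ^ 2 / 4 from funext besselJ_one_eq]
  refine this.congr_deriv ?_
  simp only [id, Function.comp]
  field_simp
  ring

/-- By the recurrence, the left side has derivative −E₁², and it equals 1 at z = 0. In terms of x
with z = x²/4 it is J₀² + J₁². -/
theorem besselE_energy_le_one {z : ℝ} (hz : 0 ≤ z) :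
    besselE 0 z ^ 2 + z * besselE 1 z ^ 2 ≤ 1 := by
  have hd : ∀ y : ℝ, HasDerivAt (fun y => besselE 0 y ^ 2 + (y * besselE 1 y) * besselE 1 y)
      (-besselE 1 y ^ 2) y := fun y => by
    refine (((hasDerivAt_besselE 0 y).pow 2).add
      ((hasDerivAt_mul_besselE_one y).mul (hasDerivAt_besselE 1 y))).congr_deriv ?_
    have := besselE_zero_left_eq y
    rw [this]; norm_num; ring
  have hanti : Antitone fun y : ℝ => besselE 0 y ^ 2 + (y * besselE 1 y) * besselE 1 y :=
    antitone_of_deriv_nonpos (fun y => (hd y).differentiableAt) fun y => by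
      rw [(hd y).deriv]; nlinarith [sq_nonneg (besselE 1 y)]
  have := hanti hz
  simp [besselE_zero_right] at this
  nlinarith

theorem abs_besselE_zero_le_one {z : ℝ} (hz : 0 ≤ z) : |besselE 0 z| ≤ 1 := by
  rw [abs_le_one_iff_mul_self_le_one]
  nlinarith [besselE_energy_le_one hz, sq_nonneg (besselE 1 z),
    mul_nonneg hz (sq_nonneg (besselE 1 z))]

theorem besselJ_sq_add_sq_le_one (x : ℝ) : besselJ 0 x ^ 2 + besselJ 1 x ^ 2 ≤ 1 := by
  have := besselE_energy_le_one (z := x ^ 2 / 4) (by positivity)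
  rw [besselJ_zero_eq, besselJ_one_eq]
  convert this using 2
  ring

theorem abs_besselJ_zero_le_one (x : ℝ) : |besselJ 0 x| ≤ 1 := by
  rw [abs_le_one_iff_mul_self_le_one]
  nlinarith [besselJ_sq_add_sq_le_one x, sq_nonneg (besselJ 1 x)]

theorem abs_besselJ_one_le_one (x : ℝ) : |besselJ 1 x| ≤ 1 := by
  rw [abs_le_one_iff_mul_self_le_one]
  nlinarith [besselJ_sq_add_sq_le_one x, sq_nonneg (besselJ 0 x)]

theorem abs_mul_besselE_one_le {z : ℝ} (hz : 0 ≤ z) : |z * besselE 1 z| ≤ z := by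
  have h := norm_image_sub_le_of_norm_deriv_le_segment' (f := fun y : ℝ => y * besselE 1 y)
    (f' := fun y => besselE 0 y) (C := 1) (a := 0) (b := z)
    (fun y _ => (hasDerivAt_mul_besselE_one y).hasDerivWithinAt)
    (fun y hy => abs_besselE_zero_le_one hy.1) z ⟨hz, le_rfl⟩
  simpa using h

theorem abs_besselE_one_le_one {z : ℝ} (hz : 0 ≤ z) : |besselE 1 z| ≤ 1 := by
  rcases hz.eq_or_lt with rfl | h
  · simp [besselE_zero_right]
  · have := abs_mul_besselE_one_le hz
    rw [abs_mul, abs_of_pos h] at this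
    exact le_of_mul_le_mul_left (by linarith) h

/-- Mean value inequality with |E₁| ≤ 1. It keeps J₀ positive on [0,2), so all positive zeros exceed
1 and the large-x estimates below apply to them. -/
theorem one_sub_le_besselE_zero {z : ℝ} (hz : 0 ≤ z) : 1 - z ≤ besselE 0 z := by
  have h := norm_image_sub_le_of_norm_deriv_le_segment' (f := (besselE 0 : ℝ → ℝ))
    (f' := fun y => -besselE 1 y) (C := 1) (a := 0) (b := z)
    (fun y _ => (hasDerivAt_besselE 0 y).hasDerivWithinAt)
    (fun y hy => by rw [norm_neg]; exact abs_besselE_one_le_one hy.1) z ⟨hz, le_rfl⟩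
  rw [Real.norm_eq_abs, besselE_zero_right] at h
  have := (abs_le.1 h).1
  simp at this
  linarith

theorem besselJ_zero_pos {x : ℝ} (h0 : 0 ≤ x) (hx : x < 2) : 0 < besselJ 0 x := by
  rw [besselJ_zero_eq]
  have := one_sub_le_besselE_zero (z := x ^ 2 / 4) (by positivity)
  nlinarith

theorem continuous_besselJ_zero : Continuous (besselJ 0) :=
  continuous_iff_continuousAt.2 fun x => (hasDerivAt_besselJ_zero x).continuousAt

/-! ### Size of J₀ and J₁ for large argument -/

/-- A quantity that is almost constant for large `x` and controls `x (J₀² + J₁²)`. -/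
def besselEnergy (x : ℝ) : ℝ := x * (besselJ 0 x ^ 2 + besselJ 1 x ^ 2) - besselJ 0 x * besselJ 1 x

theorem hasDerivAt_besselEnergy {x : ℝ} (hx : x ≠ 0) :
    HasDerivAt besselEnergy (besselJ 0 x * besselJ 1 x / x) x := by
  have h0 := hasDerivAt_besselJ_zero x
  have h1 := hasDerivAt_besselJ_one hx
  refine (((hasDerivAt_id x).mul ((h0.pow 2).add (h1.pow 2))).sub (h0.mul h1)).congr_deriv ?_
  simp
  field_simp
  ring

theorem mul_le_two_besselEnergy {x : ℝ} (hx : 1 ≤ x) :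
    x * (besselJ 0 x ^ 2 + besselJ 1 x ^ 2) ≤ 2 * besselEnergy x := by
  rw [besselEnergy]
  nlinarith [sq_nonneg (besselJ 0 x - besselJ 1 x), sq_nonneg (besselJ 0 x),
    sq_nonneg (besselJ 1 x)]

theorem besselEnergy_nonneg {x : ℝ} (hx : 1 ≤ x) : 0 ≤ besselEnergy x := by
  have := mul_le_two_besselEnergy hx
  have : 0 ≤ x * (besselJ 0 x ^ 2 + besselJ 1 x ^ 2) := by positivity
  linarith

/-- The derivative of `besselEnergy` is thus at most x⁻² times the energy itself, and x⁻² is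
integrable at infinity; hence the energy stays between two positive constants. -/
theorem abs_besselJ_mul_div_le {x : ℝ} (hx : 1 ≤ x) :
    |besselJ 0 x * besselJ 1 x / x| ≤ besselEnergy x / x ^ 2 := by
  have h := mul_le_two_besselEnergy hx
  have h1 : |besselJ 0 x * besselJ 1 x| ≤ (besselJ 0 x ^ 2 + besselJ 1 x ^ 2) / 2 := by
    rw [abs_le]
    constructor <;> nlinarith [sq_nonneg (besselJ 0 x - besselJ 1 x),
      sq_nonneg (besselJ 0 x + besselJ 1 x)]
  rw [abs_div, abs_of_pos (by linarith : 0 < x), div_le_div_iff₀ (by linarith) (by positivity)]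
  nlinarith [mul_le_mul_of_nonneg_left h1 (by positivity : 0 ≤ x ^ 2)]

theorem hasDerivAt_exp_inv {c x : ℝ} (hx : x ≠ 0) :
    HasDerivAt (fun y => Real.exp (c * y⁻¹)) (Real.exp (c * x⁻¹) * (-c / x ^ 2)) x := by
  refine (((hasDerivAt_inv hx).const_mul c).exp).congr_deriv ?_
  ring

theorem besselEnergy_one_pos : 0 < besselEnergy 1 := by
  have := mul_le_two_besselEnergy le_rfl
  have : 0 < besselJ 0 1 := besselJ_zero_pos (by norm_num) (by norm_num)
  have : 0 < besselJ 0 1 ^ 2 := by positivity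
  nlinarith [sq_nonneg (besselJ 1 1)]

/-- The factor e^{c/x} integrates the bound |E'| ≤ E/x²: with c = −1 the product increases on [1,∞),
with c = 1 it decreases. -/
theorem hasDerivAt_besselEnergy_mul_exp (c : ℝ) {x : ℝ} (hx : 0 < x) :
    HasDerivAt (fun y => besselEnergy y * Real.exp (c * y⁻¹))
      ((besselJ 0 x * besselJ 1 x / x - c * (besselEnergy x / x ^ 2)) * Real.exp (c * x⁻¹)) x := by
  refine ((hasDerivAt_besselEnergy hx.ne').mul (hasDerivAt_exp_inv hx.ne')).congr_deriv ?_
  ring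

theorem besselEnergy_lower {x : ℝ} (hx : 1 ≤ x) : besselEnergy 1 * Real.exp (-1) ≤ besselEnergy x := by
  have hmono : MonotoneOn (fun y => besselEnergy y * Real.exp (-1 * y⁻¹)) (Ici 1) := by
    refine monotoneOn_of_deriv_nonneg (convex_Ici 1)
      (fun y hy => (hasDerivAt_besselEnergy_mul_exp (-1)
        (lt_of_lt_of_le one_pos hy)).continuousAt.continuousWithinAt)
      (fun y hy => ?_) (fun y hy => ?_)
    all_goals rw [interior_Ici] at hy
    · exact (hasDerivAt_besselEnergy_mul_exp (-1)
        (one_pos.trans hy)).differentiableAt.differentiableWithinAt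
    · rw [(hasDerivAt_besselEnergy_mul_exp (-1) (one_pos.trans hy)).deriv]
      have := (abs_le.1 (abs_besselJ_mul_div_le (le_of_lt hy))).1
      exact mul_nonneg (by linarith) (Real.exp_pos _).le
  have h := hmono (mem_Ici.2 le_rfl) hx hx
  simp only [inv_one, mul_one] at h
  refine h.trans (mul_le_of_le_one_right (besselEnergy_nonneg hx) ?_)
  rw [Real.exp_le_one_iff]
  have : 0 < x⁻¹ := by positivity
  linarith

theorem besselEnergy_upper {x : ℝ} (hx : 1 ≤ x) : besselEnergy x ≤ besselEnergy 1 * Real.exp 1 := by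
  have hmono : AntitoneOn (fun y => besselEnergy y * Real.exp (1 * y⁻¹)) (Ici 1) := by
    refine antitoneOn_of_deriv_nonpos (convex_Ici 1)
      (fun y hy => (hasDerivAt_besselEnergy_mul_exp 1
        (lt_of_lt_of_le one_pos hy)).continuousAt.continuousWithinAt)
      (fun y hy => ?_) (fun y hy => ?_)
    all_goals rw [interior_Ici] at hy
    · exact (hasDerivAt_besselEnergy_mul_exp 1
        (one_pos.trans hy)).differentiableAt.differentiableWithinAt
    · rw [(hasDerivAt_besselEnergy_mul_exp 1 (one_pos.trans hy)).deriv]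
      have := (abs_le.1 (abs_besselJ_mul_div_le (le_of_lt hy))).2
      exact mul_nonpos_of_nonpos_of_nonneg (by linarith) (Real.exp_pos _).le
  have h := hmono (mem_Ici.2 le_rfl) hx hx
  simp only [inv_one, mul_one] at h
  refine le_trans (le_mul_of_one_le_right (besselEnergy_nonneg hx) ?_) h
  rw [Real.one_le_exp_iff]
  have : 0 < x⁻¹ := by positivity
  linarith

theorem exists_le_mul_besselJ_one_sq :
    ∃ c : ℝ, 0 < c ∧ ∀ x, 1 ≤ x → besselJ 0 x = 0 → c ≤ x * besselJ 1 x ^ 2 := by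
  refine ⟨besselEnergy 1 * Real.exp (-1), mul_pos besselEnergy_one_pos (Real.exp_pos _),
    fun x hx h0 => ?_⟩
  have := besselEnergy_lower hx
  have heq : besselEnergy x = x * besselJ 1 x ^ 2 := by simp [besselEnergy, h0]
  rwa [heq] at this

theorem exists_mul_besselJ_sq_le :
    ∃ C : ℝ, 0 < C ∧ ∀ x, 1 ≤ x → x * (besselJ 0 x ^ 2 + besselJ 1 x ^ 2) ≤ C :=
  ⟨2 * (besselEnergy 1 * Real.exp 1),
    mul_pos two_pos (mul_pos besselEnergy_one_pos (Real.exp_pos _)), fun x hx =>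
      (mul_le_two_besselEnergy hx).trans (by linarith [besselEnergy_upper hx])⟩

theorem one_lt_of_besselJ_zero_eq_zero {x : ℝ} (hx : 0 ≤ x) (h : besselJ 0 x = 0) : 1 < x := by
  by_contra! h1
  exact (besselJ_zero_pos hx (by linarith)).ne' h

theorem besselJ_one_ne_zero {x : ℝ} (hx : 0 ≤ x) (h : besselJ 0 x = 0) : besselJ 1 x ≠ 0 := by
  obtain ⟨c, hc, H⟩ := exists_le_mul_besselJ_one_sq
  intro h1
  have := H x (one_lt_of_besselJ_zero_eq_zero hx h).le h
  rw [h1] at this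
  simp at this
  linarith

/-! ### The zeros of J₀: separation, existence, enumeration, growth -/

/-- Distinct zeros of `J₀` are uniformly separated. -/
theorem exists_besselJ_zero_gap :
    ∃ δ : ℝ, 0 < δ ∧ ∀ x y, 0 ≤ x → x < y → besselJ 0 x = 0 → besselJ 0 y = 0 → x + δ ≤ y := by
  obtain ⟨c, hc, Hc⟩ := exists_le_mul_besselJ_one_sq
  obtain ⟨C, hC, HC⟩ := exists_mul_besselJ_sq_le
  -- Between consecutive values J₀(x) = J₀(y) = 0 Rolle gives z with J₁(z) = 0. The function √t
  -- J₁(t) has modulus at least √c at x and vanishes at z, while its derivative is at most 2√C in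
  -- modulus; so z − x ≥ √c/(2√C).
  refine ⟨√c / (2 * √C), by positivity, fun x y hx hxy h0x h0y => ?_⟩
  have hx1 : 1 < x := one_lt_of_besselJ_zero_eq_zero hx h0x
  obtain ⟨z, hz, hz0⟩ := exists_hasDerivAt_eq_zero hxy continuous_besselJ_zero.continuousOn
    (h0x.trans h0y.symm) (fun t _ => hasDerivAt_besselJ_zero t)
  have hz1 : besselJ 1 z = 0 := by linarith
  have hbound : ∀ t, 1 ≤ t → √t * |besselJ 0 t| ≤ √C ∧ √t * |besselJ 1 t| ≤ √C := fun t ht => by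
    have ht0 : 0 ≤ t := by linarith
    have h := HC t ht
    rw [← Real.sqrt_sq_eq_abs, ← Real.sqrt_sq_eq_abs, ← Real.sqrt_mul ht0, ← Real.sqrt_mul ht0]
    constructor <;> apply Real.sqrt_le_sqrt <;>
      nlinarith [mul_nonneg ht0 (sq_nonneg (besselJ 0 t)), mul_nonneg ht0 (sq_nonneg (besselJ 1 t))]
  have hd : ∀ t ∈ Icc x z, HasDerivWithinAt (fun s => √s * besselJ 1 s)
      (√t * besselJ 0 t - besselJ 1 t / (2 * √t)) (Icc x z) t := fun t ht => by
    have ht0 : 0 < t := by linarith [ht.1]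
    have hs : √t ≠ 0 := (Real.sqrt_pos.2 ht0).ne'
    refine (((Real.hasDerivAt_sqrt ht0.ne').mul
      (hasDerivAt_besselJ_one ht0.ne')).congr_deriv ?_).hasDerivWithinAt
    have : t = √t * √t := (Real.mul_self_sqrt ht0.le).symm
    rw [show besselJ 1 t / t = besselJ 1 t / (√t * √t) by rw [← this]]
    field_simp
    ring
  have hle := norm_image_sub_le_of_norm_deriv_le_segment' hd (C := 2 * √C) (fun t ht => by
    have ht1 : 1 ≤ t := by linarith [ht.1]
    obtain ⟨h1, h2⟩ := hbound t ht1
    have hs : 1 ≤ √t := Real.one_le_sqrt.2 ht1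
    rw [Real.norm_eq_abs]
    refine (abs_sub _ _).trans ?_
    rw [abs_mul, abs_of_nonneg (Real.sqrt_nonneg t), abs_div,
      abs_of_pos (by positivity : 0 < 2 * √t)]
    have : |besselJ 1 t| / (2 * √t) ≤ √t * |besselJ 1 t| := by
      rw [div_le_iff₀ (by positivity)]
      nlinarith [abs_nonneg (besselJ 1 t), mul_nonneg (abs_nonneg (besselJ 1 t))
        (by nlinarith : 0 ≤ √t * √t - 1)]
    linarith) z ⟨hz.1.le, le_rfl⟩
  rw [hz1, mul_zero, zero_sub, norm_neg, Real.norm_eq_abs, abs_mul,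
    abs_of_nonneg (Real.sqrt_nonneg x), ← Real.sqrt_sq_eq_abs, ← Real.sqrt_mul hx] at hle
  have h3 : √c ≤ 2 * √C * (z - x) := (Real.sqrt_le_sqrt (Hc x hx1.le h0x)).trans hle
  have h4 : √c / (2 * √C) ≤ z - x := by
    rw [div_le_iff₀ (by positivity)]; linarith
  linarith [hz.2]

/-- `J₀` has arbitrarily large zeros (comparison with the sine). -/
theorem exists_besselJ_zero_gt (a : ℝ) : ∃ x, a < x ∧ besselJ 0 x = 0 := by
  by_contra! hne
  set b : ℝ := max a 1 + 1
  have hb1 : 1 < b := by have := le_max_right a 1; simp only [b]; linarith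
  have hba : a < b := by have := le_max_left a 1; simp only [b]; linarith
  -- a constant sign on `[b, ∞)`
  obtain ⟨ε, hε, hpos⟩ : ∃ ε : ℝ, ε ≠ 0 ∧ ∀ x, b ≤ x → 0 < ε * besselJ 0 x := by
    refine ⟨besselJ 0 b, hne b hba, fun x hx => ?_⟩
    by_contra! hcon
    have hb0 : 0 < besselJ 0 b * besselJ 0 b := mul_self_pos.2 (hne b hba)
    obtain ⟨y, hy, hy0⟩ := intermediate_value_Icc' hx
      (f := fun y => besselJ 0 b * besselJ 0 y)
      (continuous_const.mul continuous_besselJ_zero).continuousOn ⟨hcon, hb0.le⟩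
    exact mul_ne_zero (hne b hba) (hne y (hba.trans_le hy.1)) hy0
  -- Liouville normal form: u'' = −(1 + 1/(4x²)) u, which oscillates at least as fast as the sine.
  set u : ℝ → ℝ := fun x => √x * besselJ 0 x
  set u' : ℝ → ℝ := fun x => besselJ 0 x / (2 * √x) - √x * besselJ 1 x
  have hu : ∀ x, 0 < x → HasDerivAt u (u' x) x := fun x hx => by
    refine ((Real.hasDerivAt_sqrt hx.ne').mul (hasDerivAt_besselJ_zero x)).congr_deriv ?_
    simp only [u']; ring
  have hu' : ∀ x, 0 < x → HasDerivAt u' (-(1 + 1 / (4 * x ^ 2)) * u x) x := fun x hx => by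
    have hs : √x ≠ 0 := (Real.sqrt_pos.2 hx).ne'
    have hsq : x = √x * √x := (Real.mul_self_sqrt hx.le).symm
    have h2 : HasDerivAt (fun y => 2 * √y) (2 * (1 / (2 * √x))) x :=
      (Real.hasDerivAt_sqrt hx.ne').const_mul 2
    refine (((hasDerivAt_besselJ_zero x).div h2 (by positivity)).sub
      ((Real.hasDerivAt_sqrt hx.ne').mul (hasDerivAt_besselJ_one hx.ne'))).congr_deriv ?_
    simp only [u]
    generalize √x = r at *
    subst hsq
    field_simp
    ring
  -- Signed Wronskian of u with sin(x − b). It decreases over the half period [b, b+π] where the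
  -- sine is nonnegative, yet p(b) = −ε u(b) < 0 and p(b+π) = ε u(b+π) > 0.
  set p : ℝ → ℝ := fun x => ε * (u' x * Real.sin (x - b) - u x * Real.cos (x - b))
  have hp : ∀ x, 0 < x → HasDerivAt p
      (-(1 / (4 * x ^ 2)) * √x * (ε * besselJ 0 x) * Real.sin (x - b)) x := fun x hx => by
    have hsin : HasDerivAt (fun y => Real.sin (y - b)) (Real.cos (x - b)) x := by
      simpa using ((hasDerivAt_id x).sub_const b).sin
    have hcos : HasDerivAt (fun y => Real.cos (y - b)) (-Real.sin (x - b)) x := by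
      simpa using ((hasDerivAt_id x).sub_const b).cos
    refine ((((hu' x hx).mul hsin).sub ((hu x hx).mul hcos)).const_mul ε).congr_deriv ?_
    simp only [u]
    ring
  have hanti : AntitoneOn p (Icc b (b + Real.pi)) := by
    refine antitoneOn_of_deriv_nonpos (convex_Icc _ _)
      (fun y hy => (hp y (by linarith [hy.1])).continuousAt.continuousWithinAt)
      (fun y hy => ?_) (fun y hy => ?_)
    all_goals rw [interior_Icc] at hy
    · exact (hp y (by linarith [hy.1])).differentiableAt.differentiableWithinAt
    · rw [(hp y (by linarith [hy.1])).deriv]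
      have h1 := hpos y hy.1.le
      have h2 : 0 ≤ Real.sin (y - b) :=
        Real.sin_nonneg_of_nonneg_of_le_pi (by linarith [hy.1]) (by linarith [hy.2])
      have : 0 ≤ 1 / (4 * y ^ 2) * √y * (ε * besselJ 0 y) * Real.sin (y - b) := by positivity
      linarith
  have h := hanti ⟨le_rfl, by linarith [Real.pi_pos]⟩ ⟨by linarith [Real.pi_pos], le_rfl⟩
    (by linarith [Real.pi_pos])
  simp only [p, u, add_sub_cancel_left, sub_self, Real.sin_pi, Real.cos_pi, Real.sin_zero,
    Real.cos_zero] at h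
  have h1 := hpos b le_rfl
  have h2 := hpos (b + Real.pi) (by linarith [Real.pi_pos])
  have h3 : 0 < √b := Real.sqrt_pos.2 (by linarith)
  have h4 : 0 ≤ √(b + Real.pi) := Real.sqrt_nonneg _
  nlinarith [mul_pos h3 h1, mul_nonneg h4 h2.le]

/-- The uniform gap forces the infimum to be attained: a zero within δ of the infimum can have no
zero of the set below it. -/
theorem sInf_besselJ_zeros {a : ℝ} (ha : 0 ≤ a) :
    let z := sInf {x : ℝ | a < x ∧ besselJ 0 x = 0}
    a < z ∧ besselJ 0 z = 0 ∧ ∀ x, a < x → besselJ 0 x = 0 → z ≤ x := by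
  intro z
  set s := {x : ℝ | a < x ∧ besselJ 0 x = 0}
  have hne : s.Nonempty := exists_besselJ_zero_gt a
  have hbdd : BddBelow s := ⟨a, fun x hx => hx.1.le⟩
  obtain ⟨δ, hδ, hgap⟩ := exists_besselJ_zero_gap
  have hmem : z ∈ s := by
    obtain ⟨x, hx, hxz⟩ := exists_lt_of_csInf_lt hne (lt_add_of_pos_right z hδ)
    have : z = x := by
      refine le_antisymm (csInf_le hbdd hx) (le_csInf hne fun y hy => ?_)
      by_contra! hyx
      have h1 := hgap y x (ha.trans hy.1.le) hyx hy.2 hx.2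
      have h2 : z ≤ y := csInf_le hbdd hy
      linarith
    rw [this]; exact hx
  exact ⟨hmem.1, hmem.2, fun x h1 h2 => csInf_le hbdd ⟨h1, h2⟩⟩

theorem besselZero_pos_and_zero (n : ℕ) : 0 < besselZero n ∧ besselJ 0 (besselZero n) = 0 := by
  induction n with
  | zero => exact ⟨(sInf_besselJ_zeros le_rfl).1, (sInf_besselJ_zeros le_rfl).2.1⟩
  | succ n ih =>
    have := sInf_besselJ_zeros ih.1.le
    exact ⟨ih.1.trans this.1, this.2.1⟩

theorem besselZero_pos (n : ℕ) : 0 < besselZero n := (besselZero_pos_and_zero n).1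

theorem besselJ_besselZero (n : ℕ) : besselJ 0 (besselZero n) = 0 := (besselZero_pos_and_zero n).2

theorem besselZero_lt_succ (n : ℕ) : besselZero n < besselZero (n + 1) :=
  (sInf_besselJ_zeros (besselZero_pos n).le).1

theorem besselZero_strictMono : StrictMono besselZero := strictMono_nat_of_lt_succ besselZero_lt_succ

theorem one_lt_besselZero (n : ℕ) : 1 < besselZero n :=
  one_lt_of_besselJ_zero_eq_zero (besselZero_pos n).le (besselJ_besselZero n)

theorem exists_mul_succ_le_besselZero : ∃ δ : ℝ, 0 < δ ∧ ∀ n : ℕ, δ * (n + 1) ≤ besselZero n := by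
  obtain ⟨δ, hδ, hgap⟩ := exists_besselJ_zero_gap
  refine ⟨min δ 1, by positivity, fun n => ?_⟩
  induction n with
  | zero => have := one_lt_besselZero 0; have := min_le_right δ 1; push_cast; linarith
  | succ n ih =>
    have := hgap _ _ (besselZero_pos n).le (besselZero_lt_succ n) (besselJ_besselZero n)
      (besselJ_besselZero (n + 1))
    have := min_le_left δ 1
    push_cast
    linarith

/-- Linear growth gives a least n with x ≤ j_n. Then x lies beyond the previous zero, and j_n is the
least zero there, so j_n ≤ x. -/
theorem exists_besselZero_eq {x : ℝ} (hx : 0 < x) (h : besselJ 0 x = 0) : ∃ n, besselZero n = x := by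
  obtain ⟨δ, hδ, hle⟩ := exists_mul_succ_le_besselZero
  have hex : ∃ n, x ≤ besselZero n := by
    obtain ⟨n, hn⟩ := exists_nat_ge (x / δ)
    refine ⟨n, le_trans ?_ (hle n)⟩
    rw [div_le_iff₀ hδ] at hn
    linarith
  classical
  refine ⟨Nat.find hex, le_antisymm ?_ (Nat.find_spec hex)⟩
  rcases hn : Nat.find hex with _ | m
  · exact (sInf_besselJ_zeros le_rfl).2.2 x hx h
  · have hm : besselZero m < x := not_le.1 (Nat.find_min hex (by omega))
    exact (sInf_besselJ_zeros (besselZero_pos m).le).2.2 x hm h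

theorem summable_besselZero_rpow {p : ℝ} (hp : 1 < p) :
    Summable fun n => besselZero n ^ (-p) := by
  obtain ⟨δ, hδ, hle⟩ := exists_mul_succ_le_besselZero
  have hs : Summable fun n : ℕ => δ ^ (-p) * ((n : ℝ) + 1) ^ (-p) := by
    refine Summable.mul_left _ ?_
    have := (summable_nat_add_iff 1).2 (Real.summable_nat_rpow.2 (by linarith : -p < -1))
    simpa using this
  refine Summable.of_nonneg_of_le (fun n => Real.rpow_nonneg (besselZero_pos n).le _)
    (fun n => ?_) hs
  rw [← Real.mul_rpow hδ.le (by positivity)]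
  exact Real.rpow_le_rpow_of_nonpos (by positivity) (hle n) (by linarith)

theorem besselJ_one_besselZero_ne_zero (n : ℕ) : besselJ 1 (besselZero n) ≠ 0 :=
  besselJ_one_ne_zero (besselZero_pos n).le (besselJ_besselZero n)

/-- From c ≤ j_n J₁(j_n)², that is |J₁(j_n)| ≥ √(c/j_n). -/
theorem exists_abs_coeffB_le :
    ∃ C : ℝ, 0 < C ∧ ∀ n, |coeffB n| ≤ C * besselZero n ^ (-(1 / 2) : ℝ) := by
  obtain ⟨c, hc, H⟩ := exists_le_mul_besselJ_one_sq
  refine ⟨2 / √c, by positivity, fun n => ?_⟩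
  have hj := besselZero_pos n
  have h := Real.sqrt_le_sqrt (H _ (one_lt_besselZero n).le (besselJ_besselZero n))
  rw [Real.sqrt_mul hj.le, Real.sqrt_sq_eq_abs] at h
  have hJ : 0 < |besselJ 1 (besselZero n)| := abs_pos.2 (besselJ_one_besselZero_ne_zero n)
  rw [coeffB, abs_div, abs_mul, abs_of_pos hj, abs_neg, abs_two, Real.rpow_neg hj.le,
    ← Real.sqrt_eq_rpow]
  have hs : 0 < √(besselZero n) := Real.sqrt_pos.2 hj
  have hsc : 0 < √c := Real.sqrt_pos.2 hc
  rw [← div_eq_mul_inv, div_div, div_le_div_iff₀ (by positivity) (by positivity)]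
  have : besselZero n = √(besselZero n) * √(besselZero n) := (Real.mul_self_sqrt hj.le).symm
  calc 2 * (√c * √(besselZero n)) ≤
      2 * (√(besselZero n) * |besselJ 1 (besselZero n)| * √(besselZero n)) := by gcongr
    _ = 2 * ((√(besselZero n) * √(besselZero n)) * |besselJ 1 (besselZero n)|) := by ring
    _ = _ := by rw [← this]

/-! ### Lagrange's identity and the complex zeros of E₀ -/

theorem hasDerivAt_besselE_mul (m : ℕ) (l : ℂ) (x : ℝ) :
    HasDerivAt (fun y : ℝ => besselE m (l * y)) (-besselE (m + 1) (l * x) * l) x := by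
  have h1 : HasDerivAt (fun z : ℂ => l * z) l (x : ℂ) := by
    simpa using (hasDerivAt_id (x : ℂ)).const_mul l
  exact (HasDerivAt.comp (x : ℂ) (hasDerivAt_besselE m (l * x)) h1).comp_ofReal

theorem hasDerivAt_mul_besselE_one_mul (l : ℂ) (x : ℝ) :
    HasDerivAt (fun y : ℝ => l * y * besselE 1 (l * y)) (besselE 0 (l * x) * l) x := by
  have h1 : HasDerivAt (fun z : ℂ => l * z) l (x : ℂ) := by
    simpa using (hasDerivAt_id (x : ℂ)).const_mul l
  exact (HasDerivAt.comp (x : ℂ) (hasDerivAt_mul_besselE_one (l * x)) h1).comp_ofReal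

theorem continuous_besselE_mul_ofReal (m : ℕ) (l : ℂ) :
    Continuous fun y : ℝ => besselE m (l * (y : ℂ)) :=
  (continuous_besselE m).comp (by fun_prop)

/-- Lagrange's identity for the singular Sturm-Liouville equation `(x y')' + l y = 0`. -/
theorem besselE_lagrange (l m : ℂ) (X : ℝ) :
    (l - m) * ∫ x in (0 : ℝ)..X, besselE 0 (l * x) * besselE 0 (m * x) =
      l * X * besselE 1 (l * X) * besselE 0 (m * X) -
        besselE 0 (l * X) * (m * X * besselE 1 (m * X)) := by
  have hd : ∀ x : ℝ, HasDerivAt (fun x : ℝ => l * x * besselE 1 (l * x) * besselE 0 (m * x) -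
      besselE 0 (l * x) * (m * x * besselE 1 (m * x)))
      ((l - m) * (besselE 0 (l * x) * besselE 0 (m * x))) x := fun x => by
    refine (((hasDerivAt_mul_besselE_one_mul l x).mul (hasDerivAt_besselE_mul 0 m x)).sub
      ((hasDerivAt_besselE_mul 0 l x).mul (hasDerivAt_mul_besselE_one_mul m x))).congr_deriv ?_
    ring
  have hc : Continuous fun x : ℝ => (l - m) * (besselE 0 (l * x) * besselE 0 (m * x)) :=
    continuous_const.mul
      ((continuous_besselE_mul_ofReal 0 l).mul (continuous_besselE_mul_ofReal 0 m))
  rw [← intervalIntegral.integral_const_mul,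
    intervalIntegral.integral_eq_sub_of_hasDerivAt (fun x _ => hd x) (hc.intervalIntegrable _ _)]
  simp

/-- For x ≤ 0 every term of the series is nonnegative, and the first is 1. -/
theorem one_le_besselE_zero_of_nonpos {x : ℝ} (hx : x ≤ 0) : 1 ≤ besselE 0 x := by
  have h := (summable_besselE 0 x).sum_le_tsum (Finset.range 1) fun k _ => by
    have : (-1 : ℝ) ^ k * x ^ k = (-x) ^ k := by rw [← mul_pow]; simp
    rw [div_mul_eq_mul_div, this]
    have : 0 ≤ -x := by linarith
    positivity
  simpa [besselE] using h

/-- All complex zeros of `besselE 0` are real and positive. -/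
theorem besselE_zero_ne_zero {z : ℂ} (hz : z.im ≠ 0 ∨ z.re ≤ 0) : besselE 0 z ≠ 0 := by
  intro h0
  -- Self-adjointness: Lagrange's identity for z and its conjugate on [0,1] has vanishing boundary
  -- terms at a zero, so (z − z̄) ∫|E₀(zx)|² = 0, while the integrand is 1 at x = 0.
  have him : z.im = 0 := by
    by_contra him
    have h := besselE_lagrange z (starRingEnd ℂ z) 1
    have hconj : ∀ x : ℝ, besselE 0 (starRingEnd ℂ z * (x : ℂ)) =
        starRingEnd ℂ (besselE 0 (z * x)) := fun x => by
      rw [← besselE_conj]; simp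
    rw [show ((1 : ℝ) : ℂ) = 1 by simp] at h
    simp only [hconj, mul_one, besselE_conj, h0, map_zero, mul_zero, zero_mul, sub_zero,
      Complex.mul_conj] at h
    rw [intervalIntegral.integral_ofReal, mul_eq_zero] at h
    rcases h with h | h
    · rw [Complex.sub_conj] at h
      simp [him] at h
    · have hc : Continuous fun x : ℝ => Complex.normSq (besselE 0 (z * x)) :=
        Complex.continuous_normSq.comp (continuous_besselE_mul_ofReal 0 z)
      have hpos : 0 < ∫ x in (0 : ℝ)..1, Complex.normSq (besselE 0 (z * x)) := by
        refine intervalIntegral.integral_pos one_pos hc.continuousOn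
          (fun x _ => Complex.normSq_nonneg _) ⟨0, by simp, ?_⟩
        simp [besselE_zero_right]
      exact hpos.ne' (by exact_mod_cast h)
  have hre : z.re ≤ 0 := hz.resolve_left (by simp [him])
  have hzr : z = (z.re : ℂ) := by apply Complex.ext <;> simp [him]
  rw [hzr, ← ofReal_besselE] at h0
  have := one_le_besselE_zero_of_nonpos hre
  have h1 : besselE 0 z.re = 0 := by exact_mod_cast h0
  linarith

/-! ### The modes E₀(a_n σ) on [0, σ_L]: orthogonality and norms -/

section Modes

variable {σL : ℝ}

theorem coeffA_pos (hσL : 0 < σL) (n : ℕ) : 0 < coeffA σL n := by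
  have := besselZero_pos n
  rw [coeffA]; positivity

theorem coeffA_mul (hσL : 0 < σL) (n : ℕ) : coeffA σL n * σL = besselZero n ^ 2 / 4 := by
  rw [coeffA]; field_simp

theorem sqrt_coeffA (n : ℕ) : √(coeffA σL n) = besselZero n / (2 * √σL) := by
  rw [coeffA, Real.sqrt_div (sq_nonneg _), Real.sqrt_sq (besselZero_pos n).le,
    Real.sqrt_mul (by norm_num), show (4 : ℝ) = 2 ^ 2 by norm_num, Real.sqrt_sq (by norm_num)]

theorem coeffA_injective (hσL : 0 < σL) : Function.Injective (coeffA σL) := fun m n h => by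
  have h2 : besselZero m ^ 2 = besselZero n ^ 2 := by
    have := coeffA_mul hσL m
    rw [h, coeffA_mul hσL n] at this
    linarith
  exact besselZero_strictMono.injective
    ((pow_left_inj₀ (besselZero_pos m).le (besselZero_pos n).le two_ne_zero).1 h2)

theorem mul_sqrt_div_sq {σ : ℝ} (hσL : 0 < σL) (hσ : 0 ≤ σ) (n : ℕ) :
    (besselZero n * √(σ / σL)) ^ 2 / 4 = coeffA σL n * σ := by
  rw [mul_pow, Real.sq_sqrt (by positivity), coeffA]
  field_simp

theorem besselJ_zero_mode {σ : ℝ} (hσL : 0 < σL) (hσ : 0 ≤ σ) (n : ℕ) :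
    besselJ 0 (besselZero n * √(σ / σL)) = besselE 0 (coeffA σL n * σ) := by
  rw [besselJ_zero_eq, mul_sqrt_div_sq hσL hσ]

theorem besselJ_one_mode {σ : ℝ} (hσL : 0 < σL) (hσ : 0 ≤ σ) (n : ℕ) :
    besselJ 1 (besselZero n * √(σ / σL)) =
      besselZero n * √(σ / σL) / 2 * besselE 1 (coeffA σL n * σ) := by
  rw [besselJ_one_eq, mul_sqrt_div_sq hσL hσ]

theorem besselE_coeffA_mul (hσL : 0 < σL) (n : ℕ) : besselE 0 (coeffA σL n * σL) = 0 := by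
  rw [coeffA_mul hσL, ← besselJ_zero_eq, besselJ_besselZero]

theorem besselE_one_coeffA_mul (hσL : 0 < σL) (n : ℕ) :
    besselE 1 (coeffA σL n * σL) = 2 * besselJ 1 (besselZero n) / besselZero n := by
  have := besselZero_pos n
  rw [coeffA_mul hσL, besselJ_one_eq]
  field_simp

theorem hasDerivAt_besselE_mul_real (m : ℕ) (a x : ℝ) :
    HasDerivAt (fun y : ℝ => besselE m (a * y)) (-besselE (m + 1) (a * x) * a) x :=
  HasDerivAt.comp x (hasDerivAt_besselE m (a * x)) (by simpa using (hasDerivAt_id x).const_mul a)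

theorem continuous_besselE_mul_real (m : ℕ) (a : ℝ) : Continuous fun y : ℝ => besselE m (a * y) :=
  (continuous_besselE m).comp (by fun_prop)

/-- `x E₁(a x)` is a primitive of `E₀(a x)`. -/
theorem hasDerivAt_self_mul_besselE_one (a x : ℝ) :
    HasDerivAt (fun y : ℝ => y * besselE 1 (a * y)) (besselE 0 (a * x)) x := by
  refine ((hasDerivAt_id x).mul (hasDerivAt_besselE_mul_real 1 a x)).congr_deriv ?_
  rw [besselE_zero_left_eq]
  simp
  ring

theorem integral_besselE_zero_mul (a X : ℝ) :
    ∫ x in (0 : ℝ)..X, besselE 0 (a * x) = X * besselE 1 (a * X) := by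
  rw [intervalIntegral.integral_eq_sub_of_hasDerivAt
    (fun x _ => hasDerivAt_self_mul_besselE_one a x)
    ((continuous_besselE_mul_real 0 a).intervalIntegrable _ _)]
  simp

/-- The right side is an explicit primitive: the cross terms ∓2a x E₀E₁ of its two summands cancel
in the derivative. -/
theorem integral_besselE_zero_mul_sq (a X : ℝ) :
    ∫ x in (0 : ℝ)..X, besselE 0 (a * x) ^ 2 =
      X * besselE 0 (a * X) ^ 2 + a * (X * besselE 1 (a * X)) ^ 2 := by
  have hd : ∀ x : ℝ, HasDerivAt
      (fun x => x * besselE 0 (a * x) ^ 2 + a * (x * besselE 1 (a * x)) ^ 2)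
      (besselE 0 (a * x) ^ 2) x := fun x => by
    refine (((hasDerivAt_id x).mul ((hasDerivAt_besselE_mul_real 0 a x).pow 2)).add
      (((hasDerivAt_self_mul_besselE_one a x).pow 2).const_mul a)).congr_deriv ?_
    simp
    ring
  rw [intervalIntegral.integral_eq_sub_of_hasDerivAt (fun x _ => hd x)
    (((continuous_besselE_mul_real 0 a).pow 2).intervalIntegrable _ _)]
  simp

/-- The squared `L²(0, σ_L)` norm of the `n`-th mode. -/
theorem integral_mode_sq (hσL : 0 < σL) (n : ℕ) :
    ∫ x in (0 : ℝ)..σL, besselE 0 (coeffA σL n * x) ^ 2 = σL * besselJ 1 (besselZero n) ^ 2 := by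
  have := besselZero_pos n
  rw [integral_besselE_zero_mul_sq, besselE_coeffA_mul hσL, besselE_one_coeffA_mul hσL, coeffA]
  field_simp
  ring

/-- The last factor is the squared norm of the mode, so the constant function 1 has Fourier–Bessel
coefficients −b_n. This is the origin of the b_n. -/
theorem integral_mode (hσL : 0 < σL) (n : ℕ) :
    ∫ x in (0 : ℝ)..σL, besselE 0 (coeffA σL n * x) =
      -coeffB n * (σL * besselJ 1 (besselZero n) ^ 2) := by
  have := besselZero_pos n
  have := besselJ_one_besselZero_ne_zero n
  rw [integral_besselE_zero_mul, besselE_one_coeffA_mul hσL, coeffB]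
  field_simp

theorem integral_mode_mul_mode (hσL : 0 < σL) {m n : ℕ} (hmn : m ≠ n) :
    ∫ x in (0 : ℝ)..σL, besselE 0 (coeffA σL m * x) * besselE 0 (coeffA σL n * x) = 0 := by
  have h := besselE_lagrange (coeffA σL m : ℂ) (coeffA σL n : ℂ) σL
  simp only [← Complex.ofReal_mul, ← ofReal_besselE, besselE_coeffA_mul hσL] at h
  rw [intervalIntegral.integral_ofReal, ← Complex.ofReal_sub] at h
  have h' : (coeffA σL m - coeffA σL n) *
      ∫ x in (0 : ℝ)..σL, besselE 0 (coeffA σL m * x) * besselE 0 (coeffA σL n * x) = 0 := by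
    have h2 := congrArg Complex.re h
    rw [← Complex.ofReal_mul, Complex.ofReal_re] at h2
    simpa using h2
  exact (mul_eq_zero.1 h').resolve_left (sub_ne_zero.2 ((coeffA_injective hσL).ne hmn))

end Modes

/-! ### The Green operator of −(x y')' on [0,1] -/

theorem sq_integral_mul_le {f g : ℝ → ℝ} (hf : Continuous f) (hg : Continuous g) {a b : ℝ}
    (hab : a ≤ b) :
    (∫ x in a..b, f x * g x) ^ 2 ≤ (∫ x in a..b, f x ^ 2) * ∫ x in a..b, g x ^ 2 := by
  have h : ∀ t : ℝ, 0 ≤ (∫ x in a..b, g x ^ 2) * (t * t) + (2 * ∫ x in a..b, f x * g x) * t +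
      ∫ x in a..b, f x ^ 2 := fun t => by
    have h0 : 0 ≤ ∫ x in a..b, (f x + t * g x) ^ 2 :=
      intervalIntegral.integral_nonneg hab fun x _ => sq_nonneg _
    have h1 : ∫ x in a..b, (f x + t * g x) ^ 2 =
        (∫ x in a..b, f x ^ 2) + 2 * t * (∫ x in a..b, f x * g x) +
          t ^ 2 * ∫ x in a..b, g x ^ 2 := by
      rw [← intervalIntegral.integral_const_mul, ← intervalIntegral.integral_const_mul,
        ← intervalIntegral.integral_add, ← intervalIntegral.integral_add]
      · congr 1; ext x; ring
      all_goals exact Continuous.intervalIntegrable (by fun_prop) _ _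
    linarith
  have := discrim_le_zero h
  rw [discrim] at this
  nlinarith

theorem eqOn_zero_of_integral_sq_eq_zero {f : ℝ → ℝ} (hf : Continuous f)
    (h : ∫ x in (0 : ℝ)..1, f x ^ 2 = 0) : ∀ x ∈ Icc (0 : ℝ) 1, f x = 0 := by
  intro x hx
  by_contra hne
  exact (intervalIntegral.integral_pos one_pos (hf.pow 2).continuousOn (fun x _ => sq_nonneg _)
    ⟨x, hx, lt_of_le_of_ne (sq_nonneg _) (pow_ne_zero 2 hne).symm⟩).ne' h

/-- `s ↦ (1/s) ∫₀^s f`, extended continuously to `s = 0`. -/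
def meanValue (f : ℝ → ℝ) (s : ℝ) : ℝ := ∫ t in (0 : ℝ)..1, f (s * t)

theorem continuous_meanValue {f : ℝ → ℝ} (hf : Continuous f) : Continuous (meanValue f) := by
  unfold meanValue; fun_prop

theorem mul_meanValue (f : ℝ → ℝ) (s : ℝ) : s * meanValue f s = ∫ t in (0 : ℝ)..s, f t := by
  simp [meanValue]

theorem abs_meanValue_le {f : ℝ → ℝ} {C s : ℝ} (hs : s ∈ Icc (0 : ℝ) 1)
    (h : ∀ x ∈ Icc (0 : ℝ) 1, |f x| ≤ C) : |meanValue f s| ≤ C := by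
  have := intervalIntegral.norm_integral_le_of_norm_le_const (a := 0) (b := 1)
    (f := fun t => f (s * t)) (C := C) fun t ht => by
      rw [uIoc_of_le zero_le_one] at ht
      exact h _ ⟨mul_nonneg hs.1 ht.1.le, mul_le_one₀ hs.2 ht.1.le ht.2⟩
  simpa [meanValue] using this

/-- The inverse of `-(x y')'` on `(0,1)` with `y(1) = 0` and `y` bounded at `0`. -/
def greenOp (f : ℝ → ℝ) (x : ℝ) : ℝ := ∫ s in x..1, meanValue f s

theorem hasDerivAt_greenOp {f : ℝ → ℝ} (hf : Continuous f) (x : ℝ) :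
    HasDerivAt (greenOp f) (-meanValue f x) x :=
  intervalIntegral.integral_hasDerivAt_left ((continuous_meanValue hf).intervalIntegrable _ _)
    (continuous_meanValue hf).aestronglyMeasurable.stronglyMeasurableAtFilter
    (continuous_meanValue hf).continuousAt

theorem continuous_greenOp {f : ℝ → ℝ} (hf : Continuous f) : Continuous (greenOp f) :=
  continuous_iff_continuousAt.2 fun x => (hasDerivAt_greenOp hf x).continuousAt

theorem greenOp_one (f : ℝ → ℝ) : greenOp f 1 = 0 := by simp [greenOp]

theorem hasDerivAt_integral_zero {f : ℝ → ℝ} (hf : Continuous f) (x : ℝ) :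
    HasDerivAt (fun x => ∫ t in (0 : ℝ)..x, f t) (f x) x :=
  intervalIntegral.integral_hasDerivAt_right (hf.intervalIntegrable _ _)
    hf.aestronglyMeasurable.stronglyMeasurableAtFilter hf.continuousAt

/-- Integration by parts, with x · `meanValue g x` as the primitive of g. The right side is
symmetric in f and g and nonnegative for f = g, which makes the operator symmetric and positive. -/
theorem integral_greenOp_mul {f g : ℝ → ℝ} (hf : Continuous f) (hg : Continuous g) :
    ∫ x in (0 : ℝ)..1, greenOp f x * g x =
      ∫ x in (0 : ℝ)..1, x * (meanValue f x * meanValue g x) := by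
  have hP : Continuous fun x => ∫ t in (0 : ℝ)..x, g t :=
    continuous_iff_continuousAt.2 fun x => (hasDerivAt_integral_zero hg x).continuousAt
  have hm := continuous_meanValue hf
  have hm' := continuous_meanValue hg
  have hG := continuous_greenOp hf
  have h := intervalIntegral.integral_eq_sub_of_hasDerivAt (a := 0) (b := 1)
    (fun x _ => (hasDerivAt_greenOp hf x).mul (hasDerivAt_integral_zero hg x))
    (Continuous.intervalIntegrable (by fun_prop) _ _)
  rw [intervalIntegral.integral_add (Continuous.intervalIntegrable (by fun_prop) _ _)
    (Continuous.intervalIntegrable (by fun_prop) _ _)] at h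
  simp only [Pi.mul_apply, greenOp_one, intervalIntegral.integral_same, zero_mul, mul_zero,
    sub_self] at h
  have h2 : ∫ x in (0 : ℝ)..1, -meanValue f x * ∫ t in (0 : ℝ)..x, g t =
      -∫ x in (0 : ℝ)..1, x * (meanValue f x * meanValue g x) := by
    rw [← intervalIntegral.integral_neg]
    congr 1; ext x
    rw [← mul_meanValue]; ring
  linarith

theorem integral_greenOp_mul_comm {f g : ℝ → ℝ} (hf : Continuous f) (hg : Continuous g) :
    ∫ x in (0 : ℝ)..1, greenOp f x * g x = ∫ x in (0 : ℝ)..1, f x * greenOp g x := by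
  rw [integral_greenOp_mul hf hg]
  simp_rw [mul_comm (f _)]
  rw [integral_greenOp_mul hg hf]
  simp_rw [mul_comm (meanValue f _)]

theorem integral_greenOp_mul_self_nonneg {f : ℝ → ℝ} (hf : Continuous f) :
    0 ≤ ∫ x in (0 : ℝ)..1, greenOp f x * f x := by
  rw [integral_greenOp_mul hf hf]
  exact intervalIntegral.integral_nonneg zero_le_one fun x hx =>
    mul_nonneg hx.1 (mul_self_nonneg _)

/-- Smoothing from L² to sup. Cauchy–Schwarz on [0,s] gives |`meanValue f s`| ≤ N/√s with N the L²
norm of f; this is integrable at 0 and has primitive 2N√s, so adding 2N√y to the Green potential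
makes it monotone. -/
theorem greenOp_le {f : ℝ → ℝ} (hf : Continuous f) {x : ℝ} (hx : x ∈ Icc (0 : ℝ) 1) :
    greenOp f x ≤ 2 * √(∫ t in (0 : ℝ)..1, f t ^ 2) := by
  set N := √(∫ t in (0 : ℝ)..1, f t ^ 2)
  have hG := continuous_greenOp hf
  have hN : ∀ s ∈ Ioo (0 : ℝ) 1, -N / √s ≤ -meanValue f s := fun s hs => by
    have h1 := sq_integral_mul_le hf continuous_const (a := 0) (b := s) (g := fun _ => 1) hs.1.le
    have h2 : ∫ t in (0 : ℝ)..s, f t ^ 2 ≤ ∫ t in (0 : ℝ)..1, f t ^ 2 :=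
      intervalIntegral.integral_mono_interval le_rfl hs.1.le hs.2.le
        (Eventually.of_forall fun t => sq_nonneg _)
        (Continuous.intervalIntegrable (by fun_prop) _ _)
    simp only [mul_one, one_pow, intervalIntegral.integral_const, smul_eq_mul, sub_zero,
      ← mul_meanValue f] at h1
    have h3 : (√s * meanValue f s) ^ 2 ≤ ∫ t in (0 : ℝ)..1, f t ^ 2 := by
      rw [mul_pow, Real.sq_sqrt hs.1.le]
      refine le_trans (le_of_mul_le_mul_left ?_ hs.1) h2
      nlinarith
    have h4 : √s * meanValue f s ≤ N := Real.le_sqrt_of_sq_le h3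
    have hs' : 0 < √s := Real.sqrt_pos.2 hs.1
    rw [neg_div, neg_le_neg_iff, le_div_iff₀ hs']
    linarith
  have hd : ∀ s ∈ Ioo (0 : ℝ) 1, HasDerivAt (fun y => greenOp f y + 2 * N * √y)
      (-meanValue f s + 2 * N * (1 / (2 * √s))) s := fun s hs =>
    (hasDerivAt_greenOp hf s).add ((Real.hasDerivAt_sqrt hs.1.ne').const_mul _)
  have hmono : MonotoneOn (fun y => greenOp f y + 2 * N * √y) (Icc 0 1) := by
    refine monotoneOn_of_deriv_nonneg (convex_Icc _ _) (by fun_prop) (fun y hy => ?_) fun y hy => ?_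
    all_goals rw [interior_Icc] at hy
    · exact (hd y hy).differentiableAt.differentiableWithinAt
    · rw [(hd y hy).deriv]
      have := hN y hy
      have h5 : 2 * N * (1 / (2 * √y)) = N / √y := by ring
      rw [neg_div] at this
      linarith
  have := hmono hx (right_mem_Icc.2 zero_le_one) hx.2
  simp only [greenOp_one, Real.sqrt_one] at this
  have : 0 ≤ 2 * N * √x := by positivity
  linarith

theorem meanValue_neg (f : ℝ → ℝ) (s : ℝ) : meanValue (fun x => -f x) s = -meanValue f s := by
  simp [meanValue]

theorem greenOp_neg (f : ℝ → ℝ) (x : ℝ) : greenOp (fun x => -f x) x = -greenOp f x := by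
  simp [greenOp, meanValue_neg]

theorem abs_greenOp_le {f : ℝ → ℝ} (hf : Continuous f) {x : ℝ} (hx : x ∈ Icc (0 : ℝ) 1) :
    |greenOp f x| ≤ 2 * √(∫ t in (0 : ℝ)..1, f t ^ 2) := by
  have h := greenOp_le (f := fun x => -f x) hf.neg hx
  simp only [neg_sq, greenOp_neg] at h
  exact abs_le'.2 ⟨greenOp_le hf hx, h⟩

/-- Smoothing from sup to Lipschitz: the derivative is minus a mean of f. With the L²-to-sup bound
it yields compactness of the squared operator. -/
theorem abs_greenOp_sub_le {f : ℝ → ℝ} (hf : Continuous f) {C x y : ℝ}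
    (h : ∀ x ∈ Icc (0 : ℝ) 1, |f x| ≤ C) (hx : x ∈ Icc (0 : ℝ) 1) (hy : y ∈ Icc (0 : ℝ) 1) :
    |greenOp f x - greenOp f y| ≤ C * |x - y| := by
  have := (convex_Icc (0 : ℝ) 1).norm_image_sub_le_of_norm_hasDerivWithin_le
    (fun z _ => (hasDerivAt_greenOp hf z).hasDerivWithinAt)
    (fun z hz => by rw [norm_neg]; exact abs_meanValue_le hz h) hy hx
  simpa using this

theorem abs_greenOp_le_of_le {f : ℝ → ℝ} (hf : Continuous f) {C x : ℝ}
    (h : ∀ x ∈ Icc (0 : ℝ) 1, |f x| ≤ C) (hx : x ∈ Icc (0 : ℝ) 1) : |greenOp f x| ≤ C := by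
  have := abs_greenOp_sub_le hf h hx (right_mem_Icc.2 zero_le_one)
  rw [greenOp_one, sub_zero] at this
  have hC : 0 ≤ C := (abs_nonneg _).trans (h 0 (left_mem_Icc.2 zero_le_one))
  refine this.trans (mul_le_of_le_one_right hC ?_)
  rw [abs_le]; constructor <;> linarith [hx.1, hx.2]

theorem meanValue_besselE (l x : ℝ) : meanValue (fun y => besselE 0 (l * y)) x = besselE 1 (l * x) := by
  have h := integral_besselE_zero_mul (l * x) 1
  simpa [meanValue, mul_assoc] using h

/-- A bounded solution of `-(x y')' = l y` with `l > 0` is a multiple of `E₀(l x)`. -/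
theorem eq_besselE_of_greenOp_eq {f : ℝ → ℝ} (hf : Continuous f) {l : ℝ} (hl : 0 < l)
    (h : ∀ x ∈ Icc (0 : ℝ) 1, f x = l * greenOp f x) :
    ∀ x ∈ Icc (0 : ℝ) 1, f x = f 0 * besselE 0 (l * x) := by
  -- On [0,1] this is f − f(0)E₀(l x); writing l · `greenOp f` for f makes it differentiable. Its
  -- derivative is −l p.
  set d : ℝ → ℝ := fun x => l * greenOp f x - f 0 * besselE 0 (l * x)
  set p : ℝ → ℝ := fun x => meanValue f x - f 0 * besselE 1 (l * x)
  have hd : ∀ x, HasDerivAt d (-l * p x) x := fun x => by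
    refine (((hasDerivAt_greenOp hf x).const_mul l).sub
      ((hasDerivAt_besselE_mul_real 0 l x).const_mul (f 0))).congr_deriv ?_
    simp only [p]; ring
  have hp : ∀ x, HasDerivAt (fun x => x * p x) (f x - f 0 * besselE 0 (l * x)) x := fun x => by
    have h1 := (hasDerivAt_integral_zero hf x).sub
      ((hasDerivAt_self_mul_besselE_one l x).const_mul (f 0))
    refine h1.congr_of_eventuallyEq (Eventually.of_forall fun y => ?_)
    simp only [p, Pi.sub_apply, mul_sub, mul_meanValue]
    ring
  have hpc : Continuous p :=
    (continuous_meanValue hf).sub (continuous_const.mul (continuous_besselE_mul_real 1 l))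
  have hdc : Continuous d := continuous_iff_continuousAt.2 fun x => (hd x).continuousAt
  -- the energy `x d'² + l d²` decreases
  have hQ : ∀ x ∈ Ioo (0 : ℝ) 1, HasDerivAt (fun x => l * (x * p x) ^ 2 / x + d x ^ 2)
      (-l * p x ^ 2) x := fun x hx => by
    have hx0 : x ≠ 0 := hx.1.ne'
    have hfx : f x - f 0 * besselE 0 (l * x) = d x := by
      simp only [d]; rw [h x (Ioo_subset_Icc_self hx)]
    refine (((((hp x).pow 2).const_mul l).div (hasDerivAt_id x) hx0).add
      ((hd x).pow 2)).congr_deriv ?_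
    rw [hfx]
    simp
    field_simp
    ring
  have heq : ∀ x : ℝ, l * (x * p x) ^ 2 / x + d x ^ 2 = l * x * p x ^ 2 + d x ^ 2 := fun x => by
    rcases eq_or_ne x 0 with rfl | hx
    · simp
    · field_simp
  have hanti : AntitoneOn (fun x => l * x * p x ^ 2 + d x ^ 2) (Icc 0 1) := by
    refine antitoneOn_of_deriv_nonpos (convex_Icc _ _) (by fun_prop) (fun y hy => ?_)
      fun y hy => ?_
    all_goals
      rw [interior_Icc] at hy
      have := hQ y hy
      simp only [heq] at this
    · exact this.differentiableAt.differentiableWithinAt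
    · rw [this.deriv]
      nlinarith [sq_nonneg (p y)]
  intro x hx
  have h0 := hanti (left_mem_Icc.2 zero_le_one) hx hx.1
  have hd0 : d 0 = 0 := by
    simp only [d, ← h 0 (left_mem_Icc.2 zero_le_one), mul_zero, besselE_zero_right]
    simp
  simp only [mul_zero, zero_mul, hd0, zero_add] at h0
  have h1 : 0 ≤ l * x * p x ^ 2 := mul_nonneg (mul_nonneg hl.le hx.1) (sq_nonneg _)
  have h2 : d x = 0 := by nlinarith [sq_nonneg (d x)]
  rw [h x hx]
  simp only [d] at h2
  linarith

/-- The modes are eigenfunctions, with eigenvalue the reciprocal of l; the condition E₀(l) = 0 is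
the Dirichlet condition at 1. -/
theorem greenOp_besselE {l : ℝ} (hl : l ≠ 0) (h0 : besselE 0 l = 0) (x : ℝ) :
    greenOp (fun y => besselE 0 (l * y)) x = besselE 0 (l * x) / l := by
  have hc := continuous_besselE_mul_real 1 l
  have h := intervalIntegral.integral_eq_sub_of_hasDerivAt (a := x) (b := 1)
    (fun y _ => hasDerivAt_besselE_mul_real 0 l y) (Continuous.intervalIntegrable (by fun_prop) _ _)
  simp only [greenOp, meanValue_besselE]
  rw [intervalIntegral.integral_mul_const, intervalIntegral.integral_neg, mul_one, h0] at h
  rw [eq_div_iff hl]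
  linarith

/-! ### Spectral argument on C([0,1]) and completeness of the modes -/

/-- Constant extension of a function on `[0,1]` to the line. -/
def extendIcc (f : C(unitInterval, ℝ)) : ℝ → ℝ := IccExtend zero_le_one f

theorem continuous_extendIcc (f : C(unitInterval, ℝ)) : Continuous (extendIcc f) :=
  f.continuous.Icc_extend'

theorem extendIcc_of_mem (f : C(unitInterval, ℝ)) {x : ℝ} (hx : x ∈ Icc (0 : ℝ) 1) :
    extendIcc f x = f ⟨x, hx⟩ := IccExtend_of_mem _ _ hx

theorem extendIcc_val (f : C(unitInterval, ℝ)) (x : unitInterval) : extendIcc f x = f x :=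
  extendIcc_of_mem f x.2

theorem abs_extendIcc_le (f : C(unitInterval, ℝ)) (x : ℝ) : |extendIcc f x| ≤ ‖f‖ :=
  f.norm_coe_le_norm _

theorem meanValue_add {f g : ℝ → ℝ} (hf : Continuous f) (hg : Continuous g) (s : ℝ) :
    meanValue (fun x => f x + g x) s = meanValue f s + meanValue g s :=
  intervalIntegral.integral_add (Continuous.intervalIntegrable (by fun_prop) _ _)
    (Continuous.intervalIntegrable (by fun_prop) _ _)

theorem greenOp_add {f g : ℝ → ℝ} (hf : Continuous f) (hg : Continuous g) (x : ℝ) :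
    greenOp (fun x => f x + g x) x = greenOp f x + greenOp g x := by
  simp only [greenOp, meanValue_add hf hg]
  exact intervalIntegral.integral_add ((continuous_meanValue hf).intervalIntegrable _ _)
    ((continuous_meanValue hg).intervalIntegrable _ _)

theorem greenOp_const_mul (c : ℝ) (f : ℝ → ℝ) (x : ℝ) :
    greenOp (fun x => c * f x) x = c * greenOp f x := by
  simp [greenOp, meanValue]

/-- Integration over `[0,1]` as a functional on `C([0,1])`. -/
def integralIcc : C(unitInterval, ℝ) →L[ℝ] ℝ :=
  LinearMap.mkContinuous
    { toFun := fun f => ∫ x in (0 : ℝ)..1, extendIcc f x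
      map_add' := fun f g => intervalIntegral.integral_add
        ((continuous_extendIcc f).intervalIntegrable _ _)
        ((continuous_extendIcc g).intervalIntegrable _ _)
      map_smul' := fun c f => intervalIntegral.integral_const_mul c (extendIcc f) } 1
    fun f => by
      have := intervalIntegral.norm_integral_le_of_norm_le_const (a := 0) (b := 1)
        (f := extendIcc f) (C := ‖f‖) fun t _ => abs_extendIcc_le f t
      simp only [sub_zero, abs_one, mul_one] at this
      rw [one_mul]
      exact this

theorem integralIcc_mul (f g : C(unitInterval, ℝ)) :
    integralIcc (f * g) = ∫ x in (0 : ℝ)..1, extendIcc f x * extendIcc g x := rfl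

theorem integralIcc_sq (f : C(unitInterval, ℝ)) :
    integralIcc (f * f) = ∫ x in (0 : ℝ)..1, extendIcc f x ^ 2 := by
  simp_rw [integralIcc_mul, sq]

/-- `greenOp` as an operator on `C([0,1])`. -/
def greenCLM : C(unitInterval, ℝ) →L[ℝ] C(unitInterval, ℝ) :=
  LinearMap.mkContinuous
    { toFun := fun f => ⟨fun x => greenOp (extendIcc f) x,
        (continuous_greenOp (continuous_extendIcc f)).comp continuous_subtype_val⟩
      map_add' := fun f g => by
        ext x; exact greenOp_add (continuous_extendIcc f) (continuous_extendIcc g) x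
      map_smul' := fun c f => by
        ext x; exact greenOp_const_mul c (extendIcc f) x } 1
    fun f => by
      rw [one_mul, ContinuousMap.norm_le _ (norm_nonneg f)]
      exact fun x => abs_greenOp_le_of_le (continuous_extendIcc f)
        (fun y _ => abs_extendIcc_le f y) x.2

theorem greenCLM_apply (f : C(unitInterval, ℝ)) (x : unitInterval) :
    greenCLM f x = greenOp (extendIcc f) x := rfl

theorem extendIcc_greenCLM (f : C(unitInterval, ℝ)) {x : ℝ} (hx : x ∈ Icc (0 : ℝ) 1) :
    extendIcc (greenCLM f) x = greenOp (extendIcc f) x := by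
  rw [extendIcc_of_mem _ hx, greenCLM_apply]

theorem integralIcc_greenCLM_mul (f g : C(unitInterval, ℝ)) :
    integralIcc (greenCLM f * g) = ∫ x in (0 : ℝ)..1, greenOp (extendIcc f) x * extendIcc g x := by
  rw [integralIcc_mul]
  refine intervalIntegral.integral_congr fun x hx => ?_
  rw [uIcc_of_le zero_le_one] at hx
  simp only [extendIcc_greenCLM f hx]

theorem integralIcc_greenCLM_comm (f g : C(unitInterval, ℝ)) :
    integralIcc (greenCLM f * g) = integralIcc (f * greenCLM g) := by
  rw [mul_comm f, integralIcc_greenCLM_mul, integralIcc_greenCLM_mul,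
    integral_greenOp_mul_comm (continuous_extendIcc f) (continuous_extendIcc g)]
  simp_rw [mul_comm (extendIcc f _)]

theorem integralIcc_greenCLM_nonneg (f : C(unitInterval, ℝ)) :
    0 ≤ integralIcc (greenCLM f * f) := by
  rw [integralIcc_greenCLM_mul]
  exact integral_greenOp_mul_self_nonneg (continuous_extendIcc f)

theorem eq_zero_of_integralIcc_eq_zero {f : C(unitInterval, ℝ)} (h : integralIcc (f * f) = 0) :
    f = 0 := by
  ext x
  rw [← extendIcc_val]
  exact eqOn_zero_of_integral_sq_eq_zero (continuous_extendIcc f) (by rwa [← integralIcc_sq]) x x.2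

theorem integralIcc_self_nonneg (f : C(unitInterval, ℝ)) : 0 ≤ integralIcc (f * f) := by
  rw [integralIcc_sq]
  exact intervalIntegral.integral_nonneg zero_le_one fun x _ => sq_nonneg _

theorem integralIcc_self_pos {f : C(unitInterval, ℝ)} (h : f ≠ 0) : 0 < integralIcc (f * f) :=
  (integralIcc_self_nonneg f).lt_of_ne fun h0 => h (eq_zero_of_integralIcc_eq_zero h0.symm)

/-- Differentiating T f = 0 once kills the means of f, hence its primitive; differentiating that
kills f in the interior. -/
theorem greenCLM_injective {f : C(unitInterval, ℝ)} (h : greenCLM f = 0) : f = 0 := by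
  have hc := continuous_extendIcc f
  have h1 : ∀ x ∈ Ioo (0 : ℝ) 1, meanValue (extendIcc f) x = 0 := fun x hx => by
    have hev : greenOp (extendIcc f) =ᶠ[𝓝 x] fun _ => 0 := by
      filter_upwards [Ioo_mem_nhds hx.1 hx.2] with y hy
      rw [← extendIcc_greenCLM f (Ioo_subset_Icc_self hy), h]
      rfl
    have := (hasDerivAt_greenOp hc x).unique ((hasDerivAt_const x (0 : ℝ)).congr_of_eventuallyEq hev)
    linarith
  have h2 : ∀ x ∈ Ioo (0 : ℝ) 1, extendIcc f x = 0 := fun x hx => by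
    have hev : (fun x => ∫ t in (0 : ℝ)..x, extendIcc f t) =ᶠ[𝓝 x] fun _ => 0 := by
      filter_upwards [Ioo_mem_nhds hx.1 hx.2] with y hy
      rw [← mul_meanValue, h1 y hy, mul_zero]
    exact (hasDerivAt_integral_zero hc x).unique
      ((hasDerivAt_const x (0 : ℝ)).congr_of_eventuallyEq hev)
  refine eq_zero_of_integralIcc_eq_zero ?_
  rw [integralIcc_sq, intervalIntegral.integral_of_le zero_le_one, integral_Ioc_eq_integral_Ioo]
  exact setIntegral_eq_zero_of_forall_eq_zero fun x hx => by rw [h2 x hx]; simp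

/-- Arzelà–Ascoli: the pointwise image is a closed subset of a product of compact intervals, and the
common Lipschitz constant gives equicontinuity. The constants 2 are those of the L²-to-sup bound. -/
theorem isCompact_lipschitz_Icc :
    IsCompact {f : C(unitInterval, ℝ) | (∀ x, f x ∈ Icc (-2 : ℝ) 2) ∧ LipschitzWith 2 f} := by
  refine ArzelaAscoli.isCompact_of_equicontinuous _ ?_ ?_
  · have himg : ContinuousMap.toFun '' {f : C(unitInterval, ℝ) |
        (∀ x, f x ∈ Icc (-2 : ℝ) 2) ∧ LipschitzWith 2 f} =
        (Set.pi univ fun _ => Icc (-2 : ℝ) 2) ∩ {f : unitInterval → ℝ | LipschitzWith 2 f} := by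
      ext f
      constructor
      · rintro ⟨g, hg, rfl⟩
        exact ⟨fun x _ => hg.1 x, hg.2⟩
      · rintro ⟨h1, h2⟩
        exact ⟨⟨f, h2.continuous⟩, ⟨fun x => h1 x trivial, h2⟩, rfl⟩
    rw [himg]
    exact (isCompact_univ_pi fun _ => isCompact_Icc).inter_right (isClosed_setOfPred_lipschitzWith 2)
  · refine Metric.equicontinuous_of_continuity_modulus (fun t => 2 * t) ?_ _ fun x y f => ?_
    · have : Continuous fun t : ℝ => 2 * t := by fun_prop
      simpa using this.tendsto 0
    · exact f.2.2.dist_le_mul x y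

/-- The first application takes the L² unit ball to functions bounded by 2, the second makes these
2-Lipschitz. So the squared operator is compact from the L² norm to the sup norm. -/
theorem greenCLM_greenCLM_mem {f : C(unitInterval, ℝ)} (hf : integralIcc (f * f) ≤ 1) :
    greenCLM (greenCLM f) ∈
      {f : C(unitInterval, ℝ) | (∀ x, f x ∈ Icc (-2 : ℝ) 2) ∧ LipschitzWith 2 f} := by
  have hc := continuous_extendIcc (greenCLM f)
  have h1 : ∀ x ∈ Icc (0 : ℝ) 1, |extendIcc (greenCLM f) x| ≤ 2 := fun x hx => by
    rw [extendIcc_greenCLM f hx]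
    refine (abs_greenOp_le (continuous_extendIcc f) hx).trans ?_
    rw [← integralIcc_sq]
    have := Real.sqrt_le_one.2 hf
    linarith
  refine ⟨fun x => abs_le.1 (abs_greenOp_le_of_le hc h1 x.2),
    LipschitzWith.of_dist_le_mul fun x y => ?_⟩
  exact abs_greenOp_sub_le hc h1 x.2 y.2

theorem integralIcc_greenCLM_le (f : C(unitInterval, ℝ)) :
    integralIcc (greenCLM f * greenCLM f) ≤ 4 * integralIcc (f * f) := by
  have h : ∀ x ∈ Icc (0 : ℝ) 1, extendIcc (greenCLM f) x ^ 2 ≤ 4 * integralIcc (f * f) :=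
    fun x hx => by
      have h1 := abs_greenOp_le (continuous_extendIcc f) hx
      rw [extendIcc_greenCLM f hx, ← sq_abs]
      refine (pow_le_pow_left₀ (abs_nonneg _) h1 2).trans ?_
      rw [mul_pow, ← integralIcc_sq, Real.sq_sqrt (integralIcc_self_nonneg f)]
      norm_num
  have := intervalIntegral.integral_mono_on zero_le_one
    (((continuous_extendIcc (greenCLM f)).pow 2).intervalIntegrable 0 1)
    ((continuous_const (y := 4 * integralIcc (f * f))).intervalIntegrable (μ := volume) 0 1) h
  rw [integralIcc_sq (greenCLM f)]
  simpa using this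

theorem integralIcc_mul_sq_le (f g : C(unitInterval, ℝ)) :
    integralIcc (f * g) ^ 2 ≤ integralIcc (f * f) * integralIcc (g * g) := by
  rw [integralIcc_sq, integralIcc_sq]
  exact sq_integral_mul_le (continuous_extendIcc f) (continuous_extendIcc g) zero_le_one

/-- A closed invariant subspace of `greenCLM` other than `0` contains an eigenfunction. -/
theorem exists_greenCLM_eigenvector {V : Submodule ℝ C(unitInterval, ℝ)}
    (hVc : IsClosed (V : Set C(unitInterval, ℝ))) (hVT : ∀ f ∈ V, greenCLM f ∈ V)
    {g : C(unitInterval, ℝ)} (hgV : g ∈ V) (hg : g ≠ 0) :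
    ∃ r : ℝ, 0 < r ∧ ∃ f ∈ V, f ≠ 0 ∧ greenCLM f = r • f := by
  -- Power iteration started at g. Below, p k is the squared L² norm of T^k g, positive by
  -- injectivity.
  set G : ℕ → C(unitInterval, ℝ) := fun k => greenCLM^[k] g
  have hGs : ∀ k, G (k + 1) = greenCLM (G k) := fun k => Function.iterate_succ_apply' _ _ _
  have hGV : ∀ k, G k ∈ V := fun k => by
    induction k with
    | zero => exact hgV
    | succ k ih => rw [hGs]; exact hVT _ ih
  have hG0 : ∀ k, G k ≠ 0 := fun k => by
    induction k with
    | zero => exact hg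
    | succ k ih => rw [hGs]; exact fun h => ih (greenCLM_injective h)
  set p : ℕ → ℝ := fun k => integralIcc (G k * G k)
  have hp : ∀ k, 0 < p k := fun k => integralIcc_self_pos (hG0 k)
  have hpmul : ∀ k, integralIcc (G k * G (k + 2)) = p (k + 1) := fun k => by
    rw [hGs (k + 1), ← integralIcc_greenCLM_comm, ← hGs]
  -- Symmetry gives p(k+1) = ⟨T^k g, T^{k+2} g⟩, so Cauchy–Schwarz makes p log-convex. The ratios
  -- p(k+1)/p(k) increase, are at most 4, and converge to some q > 0.
  have hlog : ∀ k, p (k + 1) ^ 2 ≤ p k * p (k + 2) := fun k => by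
    rw [← hpmul]; exact integralIcc_mul_sq_le _ _
  have hmono : Monotone fun k => p (k + 1) / p k := monotone_nat_of_le_succ fun k => by
    rw [div_le_div_iff₀ (hp _) (hp _)]
    nlinarith [hlog k]
  have hbdd : BddAbove (range fun k => p (k + 1) / p k) := by
    refine ⟨4, ?_⟩
    rintro _ ⟨k, rfl⟩
    rw [div_le_iff₀ (hp k)]
    simp only [p, hGs]
    exact integralIcc_greenCLM_le _
  obtain ⟨q, hq⟩ : ∃ q, Tendsto (fun k => p (k + 1) / p k) atTop (𝓝 q) :=
    ⟨_, tendsto_atTop_ciSup hmono hbdd⟩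
  have hq0 : 0 < q := (div_pos (hp 1) (hp 0)).trans_le (hmono.ge_of_tendsto hq 0)
  have hqj : ∀ j, Tendsto (fun k => p (k + j) / p k) atTop (𝓝 (q ^ j)) := fun j => by
    induction j with
    | zero =>
      refine tendsto_const_nhds.congr fun k => ?_
      simp [(hp k).ne']
    | succ j ih =>
      rw [pow_succ]
      refine (ih.mul (hq.comp (tendsto_add_atTop_nat j))).congr fun k => ?_
      have := (hp (k + j)).ne'
      have := (hp k).ne'
      simp only [Function.comp, ← add_assoc]
      field_simp
  set c : ℕ → ℝ := fun k => (√(p k))⁻¹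
  have hc2 : ∀ k, c k * c k = (p k)⁻¹ := fun k => by
    rw [← mul_inv, Real.mul_self_sqrt (hp k).le]
  -- T² applied to the L²-normalised iterate; it stays in the compact set, so a subsequence
  -- converges uniformly to some u.
  set U : ℕ → C(unitInterval, ℝ) := fun k => c k • G (k + 2)
  have hUmem : ∀ k, U k ∈
      {f : C(unitInterval, ℝ) | (∀ x, f x ∈ Icc (-2 : ℝ) 2) ∧ LipschitzWith 2 f} := fun k => by
    have : U k = greenCLM (greenCLM (c k • G k)) := by
      simp only [U, map_smul, hGs]
    rw [this]
    refine greenCLM_greenCLM_mem (le_of_eq ?_)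
    rw [smul_mul_smul_comm, map_smul, hc2, smul_eq_mul]
    exact inv_mul_cancel₀ (hp k).ne'
  obtain ⟨u, -, φ, hφ, hu⟩ := isCompact_lipschitz_Icc.tendsto_subseq hUmem
  have huV : u ∈ V := hVc.mem_of_tendsto hu
    (Eventually.of_forall fun k => V.smul_mem _ (hGV _))
  have hlim : ∀ {F : C(unitInterval, ℝ) → ℝ}, Continuous F → ∀ {l : ℝ},
      Tendsto (fun k => F (U k)) atTop (𝓝 l) → F u = l := fun hF l hl =>
    tendsto_nhds_unique ((hF.tendsto u).comp hu) (hl.comp hφ.tendsto_atTop)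
  have hu0 : u ≠ 0 := by
    have h1 : integralIcc (u * u) = q ^ 2 :=
      hlim (F := fun f => integralIcc (f * f)) (by fun_prop) ((hqj 2).congr fun k => by
        rw [smul_mul_smul_comm, map_smul, hc2, smul_eq_mul, div_eq_inv_mul])
    rintro rfl
    simp only [mul_zero, map_zero] at h1
    have : 0 < q ^ 2 := by positivity
    linarith
  -- The squared L² norm of T²U_k − qU_k is a combination of ratios of p, with limit q⁴ − 2q·q³ +
  -- q²·q² = 0.
  have hTT : greenCLM (greenCLM u) = q • u := by
    rw [← sub_eq_zero]
    refine eq_zero_of_integralIcc_eq_zero ?_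
    refine hlim (F := fun f => integralIcc ((greenCLM (greenCLM f) - q • f) *
      (greenCLM (greenCLM f) - q • f))) (by fun_prop) ?_
    have h1 := ((hqj 4).sub ((hqj 3).const_mul (2 * q))).add ((hqj 2).const_mul (q ^ 2))
    rw [show q ^ 4 - 2 * q * q ^ 3 + q ^ 2 * q ^ 2 = 0 by ring] at h1
    refine h1.congr fun k => ?_
    have h2 : greenCLM (greenCLM (U k)) - q • U k = c k • (G (k + 4) - q • G (k + 2)) := by
      simp only [U, map_smul, hGs, smul_sub, smul_comm q]
    have h3 := hpmul (k + 2)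
    rw [h2, smul_mul_smul_comm, map_smul, hc2, smul_eq_mul]
    have h4 : (G (k + 4) - q • G (k + 2)) * (G (k + 4) - q • G (k + 2)) =
        G (k + 4) * G (k + 4) - (2 * q) • (G (k + 2) * G (k + 2 + 2)) +
          q ^ 2 • (G (k + 2) * G (k + 2)) := by
      ext x; simp; ring
    rw [h4, map_add, map_sub, map_smul, map_smul, h3]
    simp only [smul_eq_mul, p]
    ring
  -- Factor T² − q = (T − √q)(T + √q). The vector Tu + √q u is nonzero because Tu = −√q u would
  -- contradict positivity of T.
  refine ⟨√q, Real.sqrt_pos.2 hq0, greenCLM u + √q • u,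
    V.add_mem (hVT u huV) (V.smul_mem _ huV), fun h => ?_, ?_⟩
  · have h1 : greenCLM u = -(√q • u) := eq_neg_of_add_eq_zero_left h
    have h2 := integralIcc_greenCLM_nonneg u
    rw [h1, neg_mul, map_neg, smul_mul_assoc, map_smul, smul_eq_mul] at h2
    have := mul_pos (Real.sqrt_pos.2 hq0) (integralIcc_self_pos hu0)
    linarith
  · rw [map_add, hTT, map_smul, smul_add, smul_smul, Real.mul_self_sqrt hq0.le, add_comm]

/-- Completeness of the functions `J₀(j_n √x)` on `[0,1]`. -/
theorem eqOn_zero_of_forall_integral_besselE_eq_zero {g : ℝ → ℝ} (hg : ContinuousOn g (Icc 0 1))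
    (h : ∀ n, ∫ x in (0 : ℝ)..1, g x * besselE 0 (coeffA 1 n * x) = 0) :
    ∀ x ∈ Icc (0 : ℝ) 1, g x = 0 := by
  set w : ℕ → C(unitInterval, ℝ) := fun n =>
    ⟨fun x => besselE 0 (coeffA 1 n * x),
      (continuous_besselE_mul_real 0 _).comp continuous_subtype_val⟩
  have hw : ∀ n (f : C(unitInterval, ℝ)), integralIcc (f * w n) =
      ∫ x in (0 : ℝ)..1, extendIcc f x * besselE 0 (coeffA 1 n * x) := fun n f => by
    rw [integralIcc_mul]
    refine intervalIntegral.integral_congr fun x hx => ?_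
    rw [uIcc_of_le zero_le_one] at hx
    simp only [extendIcc_of_mem (w n) hx]
    rfl
  have hTw : ∀ n, greenCLM (w n) = (coeffA 1 n)⁻¹ • w n := fun n => by
    ext x
    have h0 : besselE 0 (coeffA 1 n) = 0 := by simpa using besselE_coeffA_mul one_pos n
    have h1 : ∀ y ∈ Icc (0 : ℝ) 1, extendIcc (w n) y = besselE 0 (coeffA 1 n * y) :=
      fun y hy => extendIcc_of_mem (w n) hy
    have h2 : ∀ s ∈ Icc (0 : ℝ) 1, meanValue (extendIcc (w n)) s =
        meanValue (fun y => besselE 0 (coeffA 1 n * y)) s := fun s hs => by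
      refine intervalIntegral.integral_congr fun t ht => ?_
      rw [uIcc_of_le zero_le_one] at ht
      exact h1 _ ⟨mul_nonneg hs.1 ht.1, mul_le_one₀ hs.2 ht.1 ht.2⟩
    have h3 : greenOp (extendIcc (w n)) x = greenOp (fun y => besselE 0 (coeffA 1 n * y)) x := by
      refine intervalIntegral.integral_congr fun s hs => ?_
      rw [uIcc_of_le x.2.2] at hs
      exact h2 s ⟨x.2.1.trans hs.1, hs.2⟩
    rw [greenCLM_apply, h3, greenOp_besselE (coeffA_pos one_pos n).ne' h0]
    simp [w, div_eq_inv_mul]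
  -- The functions orthogonal to every mode: closed, and T-invariant because T is symmetric with the
  -- modes as eigenfunctions.
  set V : Submodule ℝ C(unitInterval, ℝ) :=
    ⨅ n, LinearMap.ker
      (integralIcc.comp ((ContinuousLinearMap.mul ℝ C(unitInterval, ℝ)).flip (w n))).toLinearMap
      with hV
  have hmem : ∀ f, f ∈ V ↔ ∀ n, integralIcc (f * w n) = 0 := fun f => by
    simp [hV, Submodule.mem_iInf, mul_comm f]
  have hVc : IsClosed (V : Set C(unitInterval, ℝ)) := by
    have : (V : Set C(unitInterval, ℝ)) = ⋂ n, {f | integralIcc (f * w n) = 0} := by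
      ext f; simp [hmem]
    rw [this]
    exact isClosed_iInter fun n => isClosed_eq (by fun_prop) continuous_const
  have hVT : ∀ f ∈ V, greenCLM f ∈ V := fun f hf => by
    rw [hmem] at hf ⊢
    intro n
    rw [integralIcc_greenCLM_comm, hTw, mul_smul_comm, map_smul, hf n, smul_zero]
  set g' : C(unitInterval, ℝ) := ⟨fun x => g x, hg.domRestrict⟩
  have hg'V : g' ∈ V := by
    rw [hmem]
    intro n
    rw [hw]
    refine Eq.trans ?_ (h n)
    refine intervalIntegral.integral_congr fun x hx => ?_
    rw [uIcc_of_le zero_le_one] at hx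
    simp only [extendIcc_of_mem g' hx]
    rfl
  have hg'0 : g' = 0 := by
    by_contra hne
    -- An eigenfunction in V is f(0)E₀(x/r); it vanishes at 1, so 1/r is some a_n and f is a
    -- multiple of the n-th mode. Being orthogonal to that mode, it must vanish.
    obtain ⟨r, hr, f, hfV, hf0, hfT⟩ := exists_greenCLM_eigenvector hVc hVT hg'V hne
    have heig : ∀ x ∈ Icc (0 : ℝ) 1, extendIcc f x = r⁻¹ * greenOp (extendIcc f) x := fun x hx => by
      rw [← extendIcc_greenCLM f hx, hfT]
      have : extendIcc (r • f) x = r * extendIcc f x := rfl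
      rw [this]; field_simp
    have hf := eq_besselE_of_greenOp_eq (continuous_extendIcc f) (inv_pos.2 hr) heig
    have hfne : extendIcc f 0 ≠ 0 := fun h0 => hf0 <| by
      ext x
      rw [← extendIcc_val, hf x x.2, h0]; simp
    have h1 : besselE 0 r⁻¹ = 0 := by
      have := hf 1 (right_mem_Icc.2 zero_le_one)
      rw [heig 1 (right_mem_Icc.2 zero_le_one), greenOp_one, mul_zero, mul_one] at this
      exact (mul_eq_zero.1 this.symm).resolve_left hfne
    obtain ⟨n, hn⟩ : ∃ n, besselZero n = 2 * √r⁻¹ := by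
      refine exists_besselZero_eq (by positivity) ?_
      rw [besselJ_zero_eq, mul_pow, Real.sq_sqrt (by positivity)]
      convert h1 using 2
      ring
    have hra : coeffA 1 n = r⁻¹ := by
      rw [coeffA, hn, mul_pow, Real.sq_sqrt (by positivity)]; ring
    have h2 := (hmem f).1 hfV n
    have h3 : ∫ x in (0 : ℝ)..1, extendIcc f x * besselE 0 (coeffA 1 n * x) =
        extendIcc f 0 * ∫ x in (0 : ℝ)..1, besselE 0 (coeffA 1 n * x) ^ 2 := by
      rw [← intervalIntegral.integral_const_mul]
      refine intervalIntegral.integral_congr fun x hx => ?_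
      rw [uIcc_of_le zero_le_one] at hx
      simp only [hf x hx, hra]
      ring
    rw [hw, h3, integral_mode_sq one_pos] at h2
    rcases mul_eq_zero.1 h2 with h4 | h4
    · exact hfne h4
    · rw [one_mul] at h4
      exact pow_ne_zero 2 (besselJ_one_besselZero_ne_zero n) h4
  intro x hx
  have := congrArg (fun f : C(unitInterval, ℝ) => f ⟨x, hx⟩) hg'0
  exact this

/-! ### Summability of the coefficients and termwise integration -/

theorem hasSum_intervalIntegral_of_le {E : Type*} [NormedAddCommGroup E] [NormedSpace ℝ E]
    [CompleteSpace E] {F : ℕ → ℝ → E} {B : ℕ → ℝ} (hB : Summable B) {a b : ℝ} (hab : a ≤ b)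
    (hF : ∀ n, AEStronglyMeasurable (F n) (volume.restrict (Ioc a b)))
    (hle : ∀ n, ∀ t ∈ Icc a b, ‖F n t‖ ≤ B n) :
    HasSum (fun n => ∫ t in a..b, F n t) (∫ t in a..b, ∑' n, F n t) := by
  have hle' : ∀ n, ∀ t ∈ uIoc a b, ‖F n t‖ ≤ B n := fun n t ht =>
    hle n t (Ioc_subset_Icc_self (by rwa [uIoc_of_le hab] at ht))
  refine intervalIntegral.hasSum_integral_of_dominated_convergence (fun n _ => B n)
    (fun n => by rw [uIoc_of_le hab]; exact hF n) (fun n => Eventually.of_forall (hle' n))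
    (Eventually.of_forall fun _ _ => hB) (intervalIntegrable_const) (Eventually.of_forall fun t ht =>
      (Summable.of_norm_bounded hB fun n => hle' n t ht).hasSum)

/-- The terms are O(j_n^{-1/2} · j_n^{-1}), and j_n grows at least linearly. This series dominates
the c_n, the modes of ψ and those of φ. -/
theorem summable_abs_coeffB_div_sqrt (σL : ℝ) :
    Summable fun n => |coeffB n| / √(coeffA σL n) := by
  obtain ⟨C, hC, h⟩ := exists_abs_coeffB_le
  refine Summable.of_nonneg_of_le (fun n => by positivity) (fun n => ?_)
    ((summable_besselZero_rpow (p := 3 / 2) (by norm_num)).mul_left (C * (2 * √σL)))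
  have hj := besselZero_pos n
  rw [sqrt_coeffA, div_div_eq_mul_div, div_eq_mul_inv, show (-(3 / 2) : ℝ) = -(1 / 2) + -1 by norm_num,
    Real.rpow_add hj, Real.rpow_neg_one]
  calc |coeffB n| * (2 * √σL) * (besselZero n)⁻¹
      ≤ C * besselZero n ^ (-(1 / 2) : ℝ) * (2 * √σL) * (besselZero n)⁻¹ := by
        gcongr; exact h n
    _ = _ := by ring

theorem summable_abs_coeffB_div {σL : ℝ} (hσL : 0 < σL) :
    Summable fun n => |coeffB n| / coeffA σL n := by
  refine Summable.of_nonneg_of_le (fun n => ?_) (fun n => ?_)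
    ((summable_abs_coeffB_div_sqrt σL).mul_left (2 * √σL))
  · have := coeffA_pos hσL n; positivity
  · have ha := coeffA_pos hσL n
    have hs := Real.sqrt_pos.2 ha
    have hL := Real.sqrt_pos.2 hσL
    have h1 : 1 ≤ 2 * √σL * √(coeffA σL n) := by
      rw [sqrt_coeffA]
      field_simp
      exact (one_lt_besselZero n).le
    rw [mul_div_assoc', div_le_div_iff₀ ha hs]
    calc |coeffB n| * √(coeffA σL n) = |coeffB n| * √(coeffA σL n) * 1 := by ring
      _ ≤ |coeffB n| * √(coeffA σL n) * (2 * √σL * √(coeffA σL n)) := by gcongr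
      _ = 2 * √σL * |coeffB n| * (√(coeffA σL n) * √(coeffA σL n)) := by ring
      _ = _ := by rw [Real.mul_self_sqrt ha.le]

theorem tendsto_coeffA_atTop {σL : ℝ} (hσL : 0 < σL) : Tendsto (coeffA σL) atTop atTop := by
  obtain ⟨δ, hδ, h⟩ := exists_mul_succ_le_besselZero
  have h1 : Tendsto besselZero atTop atTop := by
    refine tendsto_atTop_mono (fun n => (?_ : δ * n ≤ besselZero n))
      (tendsto_natCast_atTop_atTop.const_mul_atTop hδ)
    have := h n
    linarith
  exact ((tendsto_pow_atTop two_ne_zero).comp h1).atTop_div_const (by positivity)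

/-! ### Fourier–Bessel expansion and the transfer factor -/

section Expansion

variable {σL : ℝ}

/-- Completeness of the modes on `[0, σ_L]`. -/
theorem eqOn_zero_of_forall_integral_mode_eq_zero (hσL : 0 < σL) {g : ℝ → ℝ}
    (hg : ContinuousOn g (Icc 0 σL))
    (h : ∀ n, ∫ x in (0 : ℝ)..σL, g x * besselE 0 (coeffA σL n * x) = 0) :
    ∀ x ∈ Icc (0 : ℝ) σL, g x = 0 := by
  have hmaps : MapsTo (fun x => σL * x) (Icc 0 1) (Icc 0 σL) := fun x hx =>
    ⟨mul_nonneg hσL.le hx.1, mul_le_of_le_one_right hσL.le hx.2⟩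
  have key := eqOn_zero_of_forall_integral_besselE_eq_zero (g := fun x => g (σL * x))
    (hg.comp (by fun_prop) hmaps) fun n => by
      have h1 := intervalIntegral.smul_integral_comp_mul_left
        (fun x => g x * besselE 0 (coeffA σL n * x)) σL (a := 0) (b := 1)
      rw [mul_zero, mul_one, h n, smul_eq_mul] at h1
      have h2 := (mul_eq_zero.1 h1).resolve_left hσL.ne'
      rw [← h2]
      congr 1; ext x
      rw [show coeffA σL n * (σL * x) = coeffA 1 n * x by rw [coeffA, coeffA]; field_simp]
  intro x hx
  have := key (x / σL) ⟨div_nonneg hx.1 hσL.le, div_le_one_of_le₀ hx.2 hσL.le⟩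
  rwa [mul_div_cancel₀ _ hσL.ne'] at this

/-- A continuous function whose Fourier-Bessel coefficients are absolutely summable is the sum of
its Fourier-Bessel series. -/
theorem hasSum_fourierBessel (hσL : 0 < σL) {h : ℝ → ℝ} (hh : ContinuousOn h (Icc 0 σL))
    {c : ℕ → ℝ} (hc : Summable fun n => |c n|)
    (hcoeff : ∀ n, ∫ x in (0 : ℝ)..σL, h x * besselE 0 (coeffA σL n * x) =
      c n * (σL * besselJ 1 (besselZero n) ^ 2)) {x : ℝ} (hx : x ∈ Icc 0 σL) :
    HasSum (fun n => c n * besselE 0 (coeffA σL n * x)) (h x) := by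
  have hle : ∀ n, ∀ y ∈ Icc 0 σL, ‖c n * besselE 0 (coeffA σL n * y)‖ ≤ |c n| := fun n y hy => by
    rw [norm_mul, Real.norm_eq_abs, Real.norm_eq_abs]
    exact mul_le_of_le_one_right (abs_nonneg _)
      (abs_besselE_zero_le_one (mul_nonneg (coeffA_pos hσL n).le hy.1))
  have hcont : ∀ n, Continuous fun y => c n * besselE 0 (coeffA σL n * y) := fun n =>
    continuous_const.mul (continuous_besselE_mul_real 0 _)
  -- The series converges uniformly to a continuous S. By orthogonality S has the same coefficients
  -- as h, so h − S is orthogonal to all modes and completeness applies.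
  set S : ℝ → ℝ := fun y => ∑' n, c n * besselE 0 (coeffA σL n * y)
  have hS : ContinuousOn S (Icc 0 σL) :=
    continuousOn_tsum (fun n => (hcont n).continuousOn) hc hle
  have hzero := eqOn_zero_of_forall_integral_mode_eq_zero hσL (hh.sub hS) fun m => by
    have hw := continuous_besselE_mul_real 0 (coeffA σL m)
    have h1 := hasSum_intervalIntegral_of_le (F := fun n y =>
      c n * besselE 0 (coeffA σL n * y) * besselE 0 (coeffA σL m * y)) hc hσL.le
      (fun n => ((hcont n).mul hw).aestronglyMeasurable) fun n y hy => by
        rw [norm_mul]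
        exact (mul_le_of_le_one_right (norm_nonneg _)
          (abs_besselE_zero_le_one (mul_nonneg (coeffA_pos hσL m).le hy.1))).trans (hle n y hy)
    have h2 : HasSum (fun n => ∫ y in (0 : ℝ)..σL,
        c n * besselE 0 (coeffA σL n * y) * besselE 0 (coeffA σL m * y))
        (c m * (σL * besselJ 1 (besselZero m) ^ 2)) := by
      have : ∀ n, ∫ y in (0 : ℝ)..σL,
          c n * besselE 0 (coeffA σL n * y) * besselE 0 (coeffA σL m * y) =
          if n = m then c m * (σL * besselJ 1 (besselZero m) ^ 2) else 0 := fun n => by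
        simp_rw [mul_assoc]
        rw [intervalIntegral.integral_const_mul]
        split_ifs with hnm
        · subst hnm
          rw [← integral_mode_sq hσL]
          simp_rw [sq]
        · rw [integral_mode_mul_mode hσL hnm, mul_zero]
      simp_rw [this]
      exact hasSum_ite_eq m _
    have h3 : ∫ y in (0 : ℝ)..σL, S y * besselE 0 (coeffA σL m * y) =
        c m * (σL * besselJ 1 (besselZero m) ^ 2) := by
      rw [← h1.unique h2]
      simp_rw [S, tsum_mul_right]
    have hu : uIcc 0 σL = Icc 0 σL := uIcc_of_le hσL.le
    simp only [Pi.sub_apply, sub_mul]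
    rw [intervalIntegral.integral_sub, hcoeff, h3, sub_self]
    · exact ContinuousOn.intervalIntegrable (by rw [hu]; exact hh.mul hw.continuousOn)
    · exact ContinuousOn.intervalIntegrable (by rw [hu]; exact hS.mul hw.continuousOn)
  have hxz := hzero x hx
  simp only [Pi.sub_apply, sub_eq_zero] at hxz
  rw [hxz]
  exact (Summable.of_norm_bounded hc fun n => hle n x hx).hasSum

theorem hasSum_fourierBessel_complex (hσL : 0 < σL) {h : ℝ → ℂ} (hh : ContinuousOn h (Icc 0 σL))
    {c : ℕ → ℂ} (hc : Summable fun n => ‖c n‖)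
    (hcoeff : ∀ n, ∫ x in (0 : ℝ)..σL, h x * (besselE 0 (coeffA σL n * x) : ℝ) =
      c n * (σL * besselJ 1 (besselZero n) ^ 2 : ℝ)) {x : ℝ} (hx : x ∈ Icc 0 σL) :
    HasSum (fun n => c n * (besselE 0 (coeffA σL n * x) : ℝ)) (h x) := by
  have hint : ∀ n, IntervalIntegrable (fun x => h x * (besselE 0 (coeffA σL n * x) : ℝ))
      volume 0 σL := fun n => by
    refine ContinuousOn.intervalIntegrable ?_
    rw [uIcc_of_le hσL.le]
    exact hh.mul (Complex.continuous_ofReal.comp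
      (continuous_besselE_mul_real 0 _)).continuousOn
  have hre : ∀ n, ∫ x in (0 : ℝ)..σL, (h x).re * besselE 0 (coeffA σL n * x) =
      (c n).re * (σL * besselJ 1 (besselZero n) ^ 2) := fun n => by
    have h1 := Complex.reCLM.intervalIntegral_comp_comm (hint n)
    rw [hcoeff n] at h1
    generalize σL * besselJ 1 (besselZero n) ^ 2 = N at h1 ⊢
    simpa using h1
  have him : ∀ n, ∫ x in (0 : ℝ)..σL, (h x).im * besselE 0 (coeffA σL n * x) =
      (c n).im * (σL * besselJ 1 (besselZero n) ^ 2) := fun n => by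
    have h1 := Complex.imCLM.intervalIntegral_comp_comm (hint n)
    rw [hcoeff n] at h1
    generalize σL * besselJ 1 (besselZero n) ^ 2 = N at h1 ⊢
    simpa using h1
  rw [Complex.hasSum_iff]
  constructor
  · simpa using hasSum_fourierBessel hσL (Complex.continuous_re.comp_continuousOn hh)
      (hc.of_nonneg_of_le (fun n => abs_nonneg _) fun n => Complex.abs_re_le_norm _) hre hx
  · simpa using hasSum_fourierBessel hσL (Complex.continuous_im.comp_continuousOn hh)
      (hc.of_nonneg_of_le (fun n => abs_nonneg _) fun n => Complex.abs_im_le_norm _) him hx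

/-- If Re s > 0, then s² is never a negative real number. -/
theorem coeffA_add_sq_ne_zero (hσL : 0 < σL) (n : ℕ) {s : ℂ} (hs : 0 < s.re) :
    (coeffA σL n : ℂ) + s ^ 2 ≠ 0 := fun h => by
  have ha := coeffA_pos hσL n
  have him := congrArg Complex.im h
  have hre := congrArg Complex.re h
  simp [sq] at him hre
  have : s.im = 0 := by
    have : s.re * s.im = 0 := by linarith
    exact (mul_eq_zero.1 this).resolve_left hs.ne'
  rw [this] at hre
  nlinarith

/-- For all but finitely many n one has a_n ≥ 2|s|², hence |a_n + s²| ≥ a_n/2; the remaining terms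
do not affect summability, so no condition on s is needed. -/
theorem summable_coeffB_div_coeffA_add_sq (hσL : 0 < σL) (s : ℂ) :
    Summable fun n => ‖(coeffB n : ℂ) / ((coeffA σL n : ℂ) + s ^ 2)‖ := by
  refine Summable.of_norm_bounded_eventually ((summable_abs_coeffB_div hσL).mul_left 2) ?_
  rw [Nat.cofinite_eq_atTop]
  filter_upwards [(tendsto_coeffA_atTop hσL).eventually_ge_atTop (2 * ‖s‖ ^ 2)] with n hn
  have ha := coeffA_pos hσL n
  have h1 : coeffA σL n / 2 ≤ ‖(coeffA σL n : ℂ) + s ^ 2‖ := by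
    have := norm_sub_le_norm_add (coeffA σL n : ℂ) (s ^ 2)
    rw [Complex.norm_real, Real.norm_eq_abs, abs_of_pos ha, norm_pow] at this
    linarith
  rw [norm_norm, norm_div, Complex.norm_real, Real.norm_eq_abs]
  calc |coeffB n| / ‖(coeffA σL n : ℂ) + s ^ 2‖ ≤ |coeffB n| / (coeffA σL n / 2) := by gcongr
    _ = _ := by field_simp

/-- The transfer factor is the reciprocal of `I₀(2 s √σ_L)`. -/
theorem transferFactor_eq (hσL : 0 < σL) {s : ℂ} (hs : 0 < s.re) :
    besselE 0 (-s ^ 2 * σL) ≠ 0 ∧ transferFactor σL s = (besselE 0 (-s ^ 2 * σL))⁻¹ := by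
  have hD : besselE 0 (-s ^ 2 * σL) ≠ 0 := by
    -- For Re s > 0 the number −s²σ_L is either non-real or a nonpositive real, hence no zero of E₀.
    refine besselE_zero_ne_zero ?_
    by_cases him : s.im = 0
    · right
      simp [sq, him]
      positivity
    · left
      simp [sq]
      refine ⟨fun h => ?_, hσL.ne'⟩
      have : s.re * s.im ≠ 0 := mul_ne_zero hs.ne' him
      apply this
      linarith
  refine ⟨hD, ?_⟩
  set D := besselE 0 (-s ^ 2 * (σL : ℂ))
  set c : ℕ → ℂ := fun n => -s ^ 2 * ((coeffB n : ℂ) / ((coeffA σL n : ℂ) + s ^ 2)) with hc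
  have hcs : Summable fun n => ‖c n‖ := by
    simp only [hc, norm_mul]
    exact (summable_coeffB_div_coeffA_add_sq hσL s).mul_left _
  have hv := continuous_besselE_mul_ofReal 0 (-s ^ 2)
  -- The function 1 − E₀(−s²x)/D vanishes at σ_L. Lagrange's identity between E₀(−s²x) and a mode
  -- gives its coefficients −s² b_n/(a_n + s²); evaluation at x = 0, where all modes equal 1, yields
  -- K = 1/D.
  have key := hasSum_fourierBessel_complex hσL (h := fun x => 1 - D⁻¹ * besselE 0 (-s ^ 2 * x))
    (c := c) (continuous_const.sub (continuous_const.mul hv)).continuousOn hcs (fun n => by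
      have hw : Continuous fun x : ℝ => ((besselE 0 (coeffA σL n * x) : ℝ) : ℂ) :=
        Complex.continuous_ofReal.comp (continuous_besselE_mul_real 0 _)
      have h1 := besselE_lagrange (-s ^ 2) (coeffA σL n : ℂ) σL
      simp only [← Complex.ofReal_mul, ← ofReal_besselE, besselE_coeffA_mul hσL] at h1
      have h2 := integral_mode hσL n
      rw [integral_besselE_zero_mul] at h2
      have h3 : ∫ x in (0 : ℝ)..σL, ((besselE 0 (coeffA σL n * x) : ℝ) : ℂ) =
          (-coeffB n * (σL * besselJ 1 (besselZero n) ^ 2) : ℝ) := by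
        rw [intervalIntegral.integral_ofReal, integral_mode hσL n]
      have hi : Continuous fun x : ℝ => D⁻¹ *
          (besselE 0 (-s ^ 2 * x) * ((besselE 0 (coeffA σL n * x) : ℝ) : ℂ)) :=
        continuous_const.mul (hv.mul hw)
      simp only [sub_mul, one_mul, mul_assoc]
      rw [intervalIntegral.integral_sub (hw.intervalIntegrable _ _) (hi.intervalIntegrable _ _),
        intervalIntegral.integral_const_mul, h3]
      have hne := coeffA_add_sq_ne_zero hσL n hs
      have h4 : ∫ x in (0 : ℝ)..σL, besselE 0 (-s ^ 2 * x) * ((besselE 0 (coeffA σL n * x) : ℝ) : ℂ) =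
          D * coeffA σL n * ((-coeffB n * (σL * besselJ 1 (besselZero n) ^ 2) : ℝ) : ℂ) /
            ((coeffA σL n : ℂ) + s ^ 2) := by
        rw [eq_div_iff hne, ← h2]
        push_cast at h1 ⊢
        simp only [mul_zero, zero_sub] at h1
        linear_combination -h1
      rw [h4]
      simp only [c]
      push_cast
      field_simp
      ring) (left_mem_Icc.2 hσL.le)
  simp only [Complex.ofReal_zero, mul_zero, besselE_zero_right] at key
  simp only [Nat.factorial_zero, Nat.cast_one, div_one, Complex.ofReal_one, mul_one] at key
  rw [transferFactor, ← tsum_mul_left]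
  have h5 : ∑' n, s ^ 2 * ((coeffB n : ℂ) / ((coeffA σL n : ℂ) + s ^ 2)) = -(1 - D⁻¹) := by
    rw [← key.tsum_eq, ← tsum_neg]
    simp [c]
  rw [h5]
  ring

end Expansion

/-! ### Duhamel convolutions and the mode coefficients c_n -/

/-- `∫₀^τ sin(k(τ-ξ)) f(ξ) dξ`. -/
def sinConv (k : ℝ) (f : ℝ → ℝ) (τ : ℝ) : ℝ := ∫ ξ in (0 : ℝ)..τ, Real.sin (k * (τ - ξ)) * f ξ

/-- `∫₀^τ cos(k(τ-ξ)) f(ξ) dξ`. -/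
def cosConv (k : ℝ) (f : ℝ → ℝ) (τ : ℝ) : ℝ := ∫ ξ in (0 : ℝ)..τ, Real.cos (k * (τ - ξ)) * f ξ

theorem modeCoeff_eq_sinConv (σL : ℝ) (f : ℝ → ℝ) (n : ℕ) (τ : ℝ) :
    modeCoeff σL f n τ = coeffB n / √(coeffA σL n) * sinConv √(coeffA σL n) f τ := rfl

theorem sinConv_congr {k : ℝ} {f g : ℝ → ℝ} (h : ∀ ξ, 0 ≤ ξ → f ξ = g ξ) {τ : ℝ} (hτ : 0 ≤ τ) :
    sinConv k f τ = sinConv k g τ := by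
  refine intervalIntegral.integral_congr fun ξ hξ => ?_
  rw [uIcc_of_le hτ] at hξ
  simp only [h ξ hξ.1]

theorem modeCoeff_congr {σL : ℝ} {f g : ℝ → ℝ} (h : ∀ ξ, 0 ≤ ξ → f ξ = g ξ) (n : ℕ) {τ : ℝ}
    (hτ : 0 ≤ τ) : modeCoeff σL f n τ = modeCoeff σL g n τ := by
  rw [modeCoeff_eq_sinConv, modeCoeff_eq_sinConv, sinConv_congr h hτ]

theorem hasDerivAt_mul_arg (k x : ℝ) : HasDerivAt (fun y => k * y) k x := by
  simpa using (hasDerivAt_id x).const_mul k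

/-- The addition formula moves τ out of the integrand, so the derivative in τ needs only the product
rule and the fundamental theorem of calculus. -/
theorem sinConv_eq (k : ℝ) {f : ℝ → ℝ} (hf : Continuous f) (τ : ℝ) :
    sinConv k f τ = Real.sin (k * τ) * (∫ ξ in (0 : ℝ)..τ, Real.cos (k * ξ) * f ξ) -
      Real.cos (k * τ) * ∫ ξ in (0 : ℝ)..τ, Real.sin (k * ξ) * f ξ := by
  rw [sinConv, ← intervalIntegral.integral_const_mul, ← intervalIntegral.integral_const_mul,
    ← intervalIntegral.integral_sub]
  · congr 1; ext ξ
    rw [mul_sub, Real.sin_sub]; ring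
  all_goals exact Continuous.intervalIntegrable (by fun_prop) _ _

theorem cosConv_eq (k : ℝ) {f : ℝ → ℝ} (hf : Continuous f) (τ : ℝ) :
    cosConv k f τ = Real.cos (k * τ) * (∫ ξ in (0 : ℝ)..τ, Real.cos (k * ξ) * f ξ) +
      Real.sin (k * τ) * ∫ ξ in (0 : ℝ)..τ, Real.sin (k * ξ) * f ξ := by
  rw [cosConv, ← intervalIntegral.integral_const_mul, ← intervalIntegral.integral_const_mul,
    ← intervalIntegral.integral_add]
  · congr 1; ext ξ
    rw [mul_sub, Real.cos_sub]; ring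
  all_goals exact Continuous.intervalIntegrable (by fun_prop) _ _

theorem hasDerivAt_sinConv (k : ℝ) {f : ℝ → ℝ} (hf : Continuous f) (τ : ℝ) :
    HasDerivAt (sinConv k f) (k * cosConv k f τ) τ := by
  rw [show sinConv k f = _ from funext (sinConv_eq k hf), cosConv_eq k hf]
  have h1 := hasDerivAt_integral_zero (f := fun ξ => Real.cos (k * ξ) * f ξ) (by fun_prop) τ
  have h2 := hasDerivAt_integral_zero (f := fun ξ => Real.sin (k * ξ) * f ξ) (by fun_prop) τ
  refine (((hasDerivAt_mul_arg k τ).sin.mul h1).sub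
    ((hasDerivAt_mul_arg k τ).cos.mul h2)).congr_deriv ?_
  ring

theorem hasDerivAt_cosConv (k : ℝ) {f : ℝ → ℝ} (hf : Continuous f) (τ : ℝ) :
    HasDerivAt (cosConv k f) (f τ - k * sinConv k f τ) τ := by
  rw [show cosConv k f = _ from funext (cosConv_eq k hf), sinConv_eq k hf]
  have h1 := hasDerivAt_integral_zero (f := fun ξ => Real.cos (k * ξ) * f ξ) (by fun_prop) τ
  have h2 := hasDerivAt_integral_zero (f := fun ξ => Real.sin (k * ξ) * f ξ) (by fun_prop) τ
  refine (((hasDerivAt_mul_arg k τ).cos.mul h1).add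
    ((hasDerivAt_mul_arg k τ).sin.mul h2)).congr_deriv ?_
  have := Real.sin_sq_add_cos_sq (k * τ)
  linear_combination (f τ) * this

theorem continuous_sinConv (k : ℝ) {f : ℝ → ℝ} (hf : Continuous f) : Continuous (sinConv k f) :=
  continuous_iff_continuousAt.2 fun x => (hasDerivAt_sinConv k hf x).continuousAt

section Datum

variable {ψb ψb' ψb'' : ℝ → ℝ}

theorem IsBoundaryDatum.continuousOn (h : IsBoundaryDatum ψb ψb' ψb'') : ContinuousOn ψb (Ici 0) :=
  fun τ hτ => (h.hasDeriv_one τ hτ).continuousWithinAt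

theorem IsBoundaryDatum.continuousOn_deriv (h : IsBoundaryDatum ψb ψb' ψb'') :
    ContinuousOn ψb' (Ici 0) :=
  fun τ hτ => (h.hasDeriv_two τ hτ).continuousWithinAt

/-- The function ψ_b'' is only assumed to exist, not to be continuous; it is measurable because on
[0,∞) it is the right derivative of ψ_b'. With a bound this makes it integrable. -/
theorem IsBoundaryDatum.aestronglyMeasurable (h : IsBoundaryDatum ψb ψb' ψb'') :
    AEStronglyMeasurable ψb'' (volume.restrict (Ici 0)) := by
  refine (measurable_derivWithin_Ici ψb').aestronglyMeasurable.congr ?_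
  filter_upwards [ae_restrict_mem measurableSet_Ici] with τ hτ
  exact ((h.hasDeriv_two τ hτ).mono (Ici_subset_Ici.2 hτ)).derivWithin (uniqueDiffWithinAt_Ici τ)

theorem IsBoundaryDatum.intervalIntegrable (h : IsBoundaryDatum ψb ψb' ψb'') {T M : ℝ}
    (hT : 0 ≤ T) (hM : ∀ τ ∈ Icc 0 T, |ψb'' τ| ≤ M) : IntervalIntegrable ψb'' volume 0 T := by
  rw [intervalIntegrable_iff_integrableOn_Ioc_of_le hT]
  refine Integrable.of_bound
    (h.aestronglyMeasurable.mono_set (Ioc_subset_Icc_self.trans Icc_subset_Ici_self)) M ?_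
  filter_upwards [ae_restrict_mem measurableSet_Ioc] with τ hτ
  exact hM τ (Ioc_subset_Icc_self hτ)

/-- Two integrations by parts. The terms at ξ = 0 vanish because ψ_b(0) = ψ_b'(0) = 0, and the sine
vanishes at ξ = T. -/
theorem IsBoundaryDatum.sinConv_deriv (h : IsBoundaryDatum ψb ψb' ψb'') {T M : ℝ}
    (hT : 0 ≤ T) (hM : ∀ τ ∈ Icc 0 T, |ψb'' τ| ≤ M) (k : ℝ) :
    sinConv k ψb'' T = k * cosConv k ψb' T ∧ cosConv k ψb' T = ψb T - k * sinConv k ψb T := by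
  have hu : uIcc 0 T = Icc 0 T := uIcc_of_le hT
  have harg : ∀ x, HasDerivAt (fun ξ => k * (T - ξ)) (-k) x := fun x => by
    simpa using ((hasDerivAt_id x).const_sub T).const_mul k
  have h1 := intervalIntegral.integral_mul_deriv_eq_deriv_mul_of_hasDerivWithinAt
    (a := 0) (b := T) (u := fun ξ => Real.sin (k * (T - ξ))) (v := ψb')
    (fun x _ => (harg x).sin.hasDerivWithinAt)
    (fun x hx => by
      rw [hu] at hx ⊢
      exact (h.hasDeriv_two x hx.1).mono fun y hy => hy.1)
    (Continuous.intervalIntegrable (by fun_prop) _ _) (h.intervalIntegrable hT hM)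
  have hint : IntervalIntegrable ψb' volume 0 T := ContinuousOn.intervalIntegrable (by
    rw [hu]; exact h.continuousOn_deriv.mono fun y hy => hy.1)
  have h2 := intervalIntegral.integral_mul_deriv_eq_deriv_mul_of_hasDerivWithinAt
    (a := 0) (b := T) (u := fun ξ => Real.cos (k * (T - ξ))) (v := ψb)
    (fun x _ => (harg x).cos.hasDerivWithinAt)
    (fun x hx => by
      rw [hu] at hx ⊢
      exact (h.hasDeriv_one x hx.1).mono fun y hy => hy.1)
    (Continuous.intervalIntegrable (by fun_prop) _ _) hint
  rw [h.deriv_zero] at h1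
  rw [h.zero] at h2
  simp only [sub_self, mul_zero, Real.sin_zero, Real.cos_zero, zero_mul, one_mul] at h1 h2
  constructor
  · rw [sinConv, h1, cosConv, ← intervalIntegral.integral_const_mul, zero_sub,
      ← intervalIntegral.integral_neg]
    congr 1; ext ξ; ring
  · rw [cosConv, h2, sinConv, ← intervalIntegral.integral_const_mul, sub_zero]
    congr 2; ext ξ; ring

/-- The formula for `c_n` without derivatives of the datum. -/
theorem IsBoundaryDatum.modeCoeff_eq {σL : ℝ} (hσL : 0 < σL) (h : IsBoundaryDatum ψb ψb' ψb'')
    {T M : ℝ} (hT : 0 ≤ T) (hM : ∀ τ ∈ Icc 0 T, |ψb'' τ| ≤ M) (n : ℕ) :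
    modeCoeff σL ψb'' n T =
      coeffB n * (ψb T - √(coeffA σL n) * sinConv √(coeffA σL n) ψb T) := by
  obtain ⟨h1, h2⟩ := h.sinConv_deriv hT hM √(coeffA σL n)
  have hk := (Real.sqrt_pos.2 (coeffA_pos hσL n)).ne'
  rw [modeCoeff_eq_sinConv, h1, h2]
  field_simp

theorem abs_sinConv_le {k M T : ℝ} {f : ℝ → ℝ} (hT : 0 ≤ T) (hM : ∀ τ ∈ Icc 0 T, |f τ| ≤ M) :
    |sinConv k f T| ≤ M * T := by
  have := intervalIntegral.norm_integral_le_of_norm_le_const (a := 0) (b := T)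
    (f := fun ξ => Real.sin (k * (T - ξ)) * f ξ) (C := M) fun ξ hξ => by
      rw [uIoc_of_le hT] at hξ
      rw [norm_mul]
      exact (mul_le_of_le_one_left (norm_nonneg _) (Real.abs_sin_le_one _)).trans
        (hM ξ (Ioc_subset_Icc_self hξ))
  rwa [sub_zero, abs_of_nonneg hT] at this

theorem abs_modeCoeff_le {σL M T : ℝ} {f : ℝ → ℝ} (hT : 0 ≤ T) (hM : ∀ τ ∈ Icc 0 T, |f τ| ≤ M)
    (n : ℕ) : |modeCoeff σL f n T| ≤ |coeffB n| / √(coeffA σL n) * (M * T) := by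
  rw [modeCoeff_eq_sinConv, abs_mul, abs_div, abs_of_nonneg (Real.sqrt_nonneg _)]
  gcongr
  exact abs_sinConv_le hT hM

theorem abs_modeCoeff_le_of_le {σL M T τ : ℝ} {f : ℝ → ℝ} (hM : ∀ τ ∈ Icc 0 T, |f τ| ≤ M)
    (hτ : τ ∈ Icc 0 T) (n : ℕ) :
    |modeCoeff σL f n τ| ≤ |coeffB n| / √(coeffA σL n) * (M * T) := by
  refine (abs_modeCoeff_le hτ.1 (fun x hx => hM x ⟨hx.1, hx.2.trans hτ.2⟩) n).trans ?_
  have : 0 ≤ M := (abs_nonneg _).trans (hM τ hτ)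
  have := hτ.2
  gcongr

theorem summable_modeCoeff {σL M T : ℝ} {f : ℝ → ℝ} (hT : 0 ≤ T)
    (hM : ∀ τ ∈ Icc 0 T, |f τ| ≤ M) : Summable fun n => |modeCoeff σL f n T| :=
  Summable.of_nonneg_of_le (fun _ => abs_nonneg _) (abs_modeCoeff_le hT hM)
    ((summable_abs_coeffB_div_sqrt σL).mul_right _)

theorem tendstoUniformlyOn_sum_modeCoeff {σL M T : ℝ} {f : ℝ → ℝ}
    (hM : ∀ τ ∈ Icc 0 T, |f τ| ≤ M) :
    TendstoUniformlyOn (fun (N : ℕ) (τ : ℝ) => ∑ n ∈ Finset.range N, modeCoeff σL f n τ)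
      (fun τ => ∑' n, modeCoeff σL f n τ) atTop (Icc 0 T) :=
  tendstoUniformlyOn_tsum_nat ((summable_abs_coeffB_div_sqrt σL).mul_right (M * T))
    fun n _ hτ => abs_modeCoeff_le_of_le hM hτ n

/-- A continuous extension to `ℝ` of a function on `[0,∞)`. -/
def extendIci (f : ℝ → ℝ) (x : ℝ) : ℝ := f (max x 0)

theorem continuous_extendIci {f : ℝ → ℝ} (hf : ContinuousOn f (Ici 0)) :
    Continuous (extendIci f) :=
  hf.comp_continuous (by fun_prop) fun x => mem_Ici.2 (le_max_right x 0)

theorem extendIci_of_nonneg (f : ℝ → ℝ) {x : ℝ} (hx : 0 ≤ x) : extendIci f x = f x := by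
  rw [extendIci, max_eq_left hx]

/-- Read off from the formula for c_n that involves ψ_b alone, since ψ_b'' may be discontinuous. -/
theorem IsBoundaryDatum.continuousOn_modeCoeff {σL : ℝ} (hσL : 0 < σL)
    (h : IsBoundaryDatum ψb ψb' ψb'') {T M : ℝ} (hM : ∀ τ ∈ Icc 0 T, |ψb'' τ| ≤ M) (n : ℕ) :
    ContinuousOn (modeCoeff σL ψb'' n) (Icc 0 T) := by
  have hc := continuous_extendIci h.continuousOn
  have hs := continuous_sinConv √(coeffA σL n) hc
  refine ContinuousOn.congr (f := fun τ => coeffB n * (extendIci ψb τ - √(coeffA σL n) *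
    sinConv √(coeffA σL n) (extendIci ψb) τ)) (by fun_prop) fun τ hτ => ?_
  beta_reduce
  rw [h.modeCoeff_eq hσL hτ.1 (fun x hx => hM x ⟨hx.1, hx.2.trans hτ.2⟩),
    extendIci_of_nonneg _ hτ.1,
    sinConv_congr (fun ξ hξ => (extendIci_of_nonneg ψb hξ).symm) hτ.1]

theorem laplaceIntegrand_tsum (F : ℕ → ℝ → ℝ) (s : ℂ) (τ : ℝ) :
    ∑' n, laplaceIntegrand (F n) s τ = laplaceIntegrand (fun τ => ∑' n, F n τ) s τ := by
  simp only [laplaceIntegrand]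
  rw [tsum_mul_left, Complex.ofReal_tsum]

theorem norm_laplaceIntegrand (f : ℝ → ℝ) (s : ℂ) (τ : ℝ) :
    ‖laplaceIntegrand f s τ‖ = Real.exp (-s.re * τ) * |f τ| := by
  rw [laplaceIntegrand, norm_mul, Complex.norm_exp, Complex.norm_real, Real.norm_eq_abs]
  simp

theorem IsBoundaryDatum.hasSum_integral_laplaceIntegrand {σL : ℝ} (hσL : 0 < σL)
    (h : IsBoundaryDatum ψb ψb' ψb'') {T M : ℝ} (hT : 0 ≤ T)
    (hM : ∀ τ ∈ Icc 0 T, |ψb'' τ| ≤ M) (s : ℂ) :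
    HasSum (fun n => ∫ τ in (0 : ℝ)..T, laplaceIntegrand (modeCoeff σL ψb'' n) s τ)
      (∫ τ in (0 : ℝ)..T, laplaceIntegrand (fun τ => ∑' n, modeCoeff σL ψb'' n τ) s τ) := by
  simp_rw [← laplaceIntegrand_tsum]
  refine hasSum_intervalIntegral_of_le
    (((summable_abs_coeffB_div_sqrt σL).mul_right (M * T)).mul_left (Real.exp (|s.re| * T))) hT
    (fun n => ?_) fun n τ hτ => ?_
  · refine ContinuousOn.aestronglyMeasurable ?_ measurableSet_Ioc
    have := h.continuousOn_modeCoeff hσL hM n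
    refine ContinuousOn.mul (Continuous.continuousOn (by fun_prop))
      (Complex.continuous_ofReal.comp_continuousOn (this.mono Ioc_subset_Icc_self))
  · rw [norm_laplaceIntegrand]
    refine mul_le_mul (Real.exp_le_exp.2 ?_) ?_ (abs_nonneg _) (Real.exp_pos _).le
    · have h1 := mul_le_mul_of_nonneg_right (neg_le_abs s.re) hτ.1
      exact h1.trans (mul_le_mul_of_nonneg_left hτ.2 (abs_nonneg _))
    · exact abs_modeCoeff_le_of_le hM hτ n

end Datum

/-! ### Partial derivatives of functions of two variables -/

section Partial

theorem HasFDerivAt.hasDerivAt_fst {f : ℝ × ℝ → ℝ} {f' : ℝ × ℝ →L[ℝ] ℝ} {x y : ℝ}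
    (h : HasFDerivAt f f' (x, y)) : HasDerivAt (fun s => f (s, y)) (f' (1, 0)) x := by
  have h1 : HasDerivAt (fun s : ℝ => (s, y)) ((1 : ℝ), (0 : ℝ)) x :=
    (hasDerivAt_id x).prodMk (hasDerivAt_const x y)
  exact h.comp_hasDerivAt x h1

theorem HasFDerivAt.hasDerivAt_snd {f : ℝ × ℝ → ℝ} {f' : ℝ × ℝ →L[ℝ] ℝ} {x y : ℝ}
    (h : HasFDerivAt f f' (x, y)) : HasDerivAt (fun t => f (x, t)) (f' (0, 1)) y := by
  have h1 : HasDerivAt (fun s : ℝ => (x, s)) ((0 : ℝ), (1 : ℝ)) y :=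
    (hasDerivAt_const y x).prodMk (hasDerivAt_id y)
  exact h.comp_hasDerivAt y h1

variable {f : ℝ × ℝ → ℝ} {U : Set (ℝ × ℝ)} {v w : ℝ × ℝ}

theorem ContDiffOn.fderiv_apply_of_isOpen (hf : ContDiffOn ℝ 2 f U) (hU : IsOpen U) (v : ℝ × ℝ) :
    ContDiffOn ℝ 1 (fun p => fderiv ℝ f p v) U :=
  (hf.fderiv_of_isOpen hU (by norm_num)).clm_apply contDiffOn_const

theorem ContDiffOn.hasFDerivAt_fderiv_apply (hf : ContDiffOn ℝ 2 f U) (hU : IsOpen U)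
    (v : ℝ × ℝ) {p : ℝ × ℝ} (hp : p ∈ U) :
    HasFDerivAt (fun p => fderiv ℝ f p v) (fderiv ℝ (fun p => fderiv ℝ f p v) p) p :=
  (((hf.fderiv_apply_of_isOpen hU v).differentiableOn (by norm_num)).differentiableAt
    (hU.mem_nhds hp)).hasFDerivAt

theorem ContDiffOn.continuousOn_fderiv_fderiv (hf : ContDiffOn ℝ 2 f U) (hU : IsOpen U)
    (v w : ℝ × ℝ) : ContinuousOn (fun p => fderiv ℝ (fun p => fderiv ℝ f p v) p w) U :=
  ((hf.fderiv_apply_of_isOpen hU v).continuousOn_fderiv_of_isOpen hU le_rfl).clm_apply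
    continuousOn_const

theorem ContDiffOn.hasFDerivAt_of_isOpen (hf : ContDiffOn ℝ 2 f U) (hU : IsOpen U)
    {p : ℝ × ℝ} (hp : p ∈ U) : HasFDerivAt f (fderiv ℝ f p) p :=
  ((hf.differentiableOn (by norm_num)).differentiableAt (hU.mem_nhds hp)).hasFDerivAt

/-- Symmetry of the second derivative, in the form needed to eliminate φ from the hodograph system.
-/
theorem ContDiffOn.fderiv_fderiv_comm (hf : ContDiffOn ℝ 2 f U) (hU : IsOpen U)
    (v w : ℝ × ℝ) {p : ℝ × ℝ} (hp : p ∈ U) :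
    fderiv ℝ (fun p => fderiv ℝ f p v) p w = fderiv ℝ (fun p => fderiv ℝ f p w) p v := by
  have hd : HasFDerivAt (fderiv ℝ f) (fderiv ℝ (fderiv ℝ f) p) p :=
    (((hf.fderiv_of_isOpen hU (m := 1) (by norm_num)).differentiableOn
      (by norm_num)).differentiableAt (hU.mem_nhds hp)).hasFDerivAt
  have happ : ∀ u : ℝ × ℝ, ∀ z, fderiv ℝ (fun p => fderiv ℝ f p u) p z =
      fderiv ℝ (fderiv ℝ f) p z u := fun u z => by
    rw [(hd.clm_apply (hasFDerivAt_const u p)).fderiv]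
    simp
  rw [happ, happ]
  exact second_derivative_symmetric_of_eventually (𝕜 := ℝ)
    (Filter.eventually_of_mem (hU.mem_nhds hp) fun y hy => hf.hasFDerivAt_of_isOpen hU hy) hd w v

end Partial

/-! ### The domain of the problem, clamped extensions, exchange of integrals -/

theorem isOpen_Ioo_prod_Ioi (σL : ℝ) : IsOpen (Ioo 0 σL ×ˢ Ioi (0 : ℝ)) := isOpen_Ioo.prod isOpen_Ioi

theorem uniqueDiffOn_Ioo_prod_Ici (σL : ℝ) : UniqueDiffOn ℝ (Ioo 0 σL ×ˢ Ici (0 : ℝ)) :=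
  isOpen_Ioo.uniqueDiffOn.prod (uniqueDiffOn_Ici 0)

theorem fderivWithin_Ioo_prod_Ici {σL : ℝ} {f : ℝ × ℝ → ℝ} {p : ℝ × ℝ}
    (hp : p ∈ Ioo 0 σL ×ˢ Ioi (0 : ℝ)) :
    fderivWithin ℝ f (Ioo 0 σL ×ˢ Ici 0) p = fderiv ℝ f p :=
  fderivWithin_of_mem_nhds (mem_of_superset ((isOpen_Ioo_prod_Ioi σL).mem_nhds hp)
    (prod_mono le_rfl Ioi_subset_Ici_self))

/-- Clamping a real number to `[a,b]`. -/
def clamp (a b x : ℝ) : ℝ := max a (min x b)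

theorem continuous_clamp (a b : ℝ) : Continuous (clamp a b) := by unfold clamp; fun_prop

theorem clamp_mem {a b : ℝ} (hab : a ≤ b) (x : ℝ) : clamp a b x ∈ Icc a b :=
  ⟨le_max_left _ _, max_le hab (min_le_right _ _)⟩

theorem clamp_of_mem {a b x : ℝ} (hx : x ∈ Icc a b) : clamp a b x = x := by
  rw [clamp, min_eq_left hx.2, max_eq_right hx.1]

/-- A function continuous on `[a,b] × [c,∞)` extends continuously to the plane. -/
theorem continuous_clamp_prod {f : ℝ × ℝ → ℝ} {a b c : ℝ} (hab : a ≤ b)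
    (hf : ContinuousOn f (Icc a b ×ˢ Ici c)) :
    Continuous fun p : ℝ × ℝ => f (clamp a b p.1, max p.2 c) :=
  hf.comp_continuous (by have := continuous_clamp a b; fun_prop) fun p =>
    ⟨clamp_mem hab _, mem_Ici.2 (le_max_right _ _)⟩

theorem intervalIntegral_swap_of_continuousOn {F : ℝ → ℝ → ℝ} {a b c d : ℝ} (hab : a ≤ b)
    (hcd : c ≤ d) (hF : ContinuousOn F.uncurry (Icc a b ×ˢ Icc c d)) :
    ∫ x in a..b, ∫ y in c..d, F x y = ∫ y in c..d, ∫ x in a..b, F x y := by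
  refine intervalIntegral_intervalIntegral_swap ?_
  rw [uIoc_of_le hab, uIoc_of_le hcd]
  exact (hF.integrableOn_compact (isCompact_Icc.prod isCompact_Icc)).mono_set
    (prod_mono Ioc_subset_Icc_self Ioc_subset_Icc_self)

/-! ### Green's identity for solutions of the linearised problem -/

section Solution

variable {σL : ℝ} {ψb : ℝ → ℝ} {ψ : ℝ → ℝ → ℝ}

theorem deriv_eq_fderiv_snd {f : ℝ × ℝ → ℝ} {U : Set (ℝ × ℝ)} (hf : ContDiffOn ℝ 2 f U)
    (hU : IsOpen U) {σ τ : ℝ} (hp : (σ, τ) ∈ U) :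
    deriv (fun t => f (σ, t)) τ = fderiv ℝ f (σ, τ) (0, 1) ∧
      iteratedDeriv 2 (fun t => f (σ, t)) τ =
        fderiv ℝ (fun p => fderiv ℝ f p (0, 1)) (σ, τ) (0, 1) := by
  refine ⟨(hf.hasFDerivAt_of_isOpen hU hp).hasDerivAt_snd.deriv, ?_⟩
  rw [iteratedDeriv_succ, iteratedDeriv_one]
  have hev : deriv (fun t => f (σ, t)) =ᶠ[𝓝 τ] fun t => fderiv ℝ f (σ, t) (0, 1) := by
    have : Continuous fun t : ℝ => (σ, t) := by fun_prop
    filter_upwards [this.continuousAt.preimage_mem_nhds (hU.mem_nhds hp)] with t ht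
    exact (hf.hasFDerivAt_of_isOpen hU ht).hasDerivAt_snd.deriv
  rw [hev.deriv_eq]
  exact (hf.hasFDerivAt_fderiv_apply hU (0, 1) hp).hasDerivAt_snd.deriv

theorem deriv_eq_fderiv_fst {f : ℝ × ℝ → ℝ} {U : Set (ℝ × ℝ)} (hf : ContDiffOn ℝ 2 f U)
    (hU : IsOpen U) {σ τ : ℝ} (hp : (σ, τ) ∈ U) :
    deriv (fun y => f (y, τ)) σ = fderiv ℝ f (σ, τ) (1, 0) ∧
      iteratedDeriv 2 (fun y => f (y, τ)) σ =
        fderiv ℝ (fun p => fderiv ℝ f p (1, 0)) (σ, τ) (1, 0) := by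
  refine ⟨(hf.hasFDerivAt_of_isOpen hU hp).hasDerivAt_fst.deriv, ?_⟩
  rw [iteratedDeriv_succ, iteratedDeriv_one]
  have hev : deriv (fun y => f (y, τ)) =ᶠ[𝓝 σ] fun y => fderiv ℝ f (y, τ) (1, 0) := by
    have : Continuous fun y : ℝ => (y, τ) := by fun_prop
    filter_upwards [this.continuousAt.preimage_mem_nhds (hU.mem_nhds hp)] with t ht
    exact (hf.hasFDerivAt_of_isOpen hU ht).hasDerivAt_fst.deriv
  rw [hev.deriv_eq]
  exact (hf.hasFDerivAt_fderiv_apply hU (1, 0) hp).hasDerivAt_fst.deriv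

theorem IsIBVPSolution.pde_fderiv (h : IsIBVPSolution σL ψb ψ) {σ τ : ℝ}
    (hp : (σ, τ) ∈ Ioo 0 σL ×ˢ Ioi (0 : ℝ)) :
    fderiv ℝ (fun p => fderiv ℝ (fun p : ℝ × ℝ => ψ p.1 p.2) p (0, 1)) (σ, τ) (0, 1) =
      σ * fderiv ℝ (fun p => fderiv ℝ (fun p : ℝ × ℝ => ψ p.1 p.2) p (1, 0)) (σ, τ) (1, 0) +
        fderiv ℝ (fun p : ℝ × ℝ => ψ p.1 p.2) (σ, τ) (1, 0) := by
  have hU := isOpen_Ioo_prod_Ioi σL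
  have h1 := deriv_eq_fderiv_snd h.contDiffOn_two hU hp
  have h2 := deriv_eq_fderiv_fst h.contDiffOn_two hU hp
  rw [← h1.2, ← h2.2, ← h2.1]
  exact h.pde σ hp.1 τ hp.2

/-- Green's identity on `[α,β] × [δ,T]` with the test function `χ(σ) sin(k(T-τ))`. -/
theorem IsIBVPSolution.green_identity (h : IsIBVPSolution σL ψb ψ) {α β δ T : ℝ} (hα : 0 < α)
    (hαβ : α ≤ β) (hβ : β < σL) (hδ : 0 < δ) (hδT : δ ≤ T) {k w₀ q : ℝ} {χ V : ℝ → ℝ}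
    (hχ : ∀ σ, χ σ = besselE 0 (k ^ 2 * σ) - w₀ - q * Real.log σ)
    (hχα : χ α = 0) (hχβ : χ β = 0)
    (hV : ∀ σ, V σ = ∫ τ in δ..T, ψ σ τ * Real.sin (k * (T - τ))) :
    ∫ σ in α..β, (k * ψ σ T -
        (fderiv ℝ (fun p : ℝ × ℝ => ψ p.1 p.2) (σ, δ) (0, 1) * Real.sin (k * (T - δ)) +
          k * ψ σ δ * Real.cos (k * (T - δ))) - k ^ 2 * V σ) * χ σ =
      (k ^ 2 * (β * besselE 1 (k ^ 2 * β)) + q) * V β -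
        (k ^ 2 * (α * besselE 1 (k ^ 2 * α)) + q) * V α -
        k ^ 2 * ∫ σ in α..β, V σ * besselE 0 (k ^ 2 * σ) := by
  -- Constants and log σ solve (σ y')' = 0, so (σχ')' = −k²E₀(k²σ), while −σχ' = k²σE₁(k²σ) + q. As
  -- χ vanishes at α and β, the boundary terms of the spatial integration by parts contain ψ but not
  -- ψ_σ.
  set Ψ : ℝ × ℝ → ℝ := fun p => ψ p.1 p.2
  have hU := isOpen_Ioo_prod_Ioi σL
  have hΨ := h.contDiffOn_two
  have hsub : Icc α β ×ˢ Icc δ T ⊆ Ioo 0 σL ×ˢ Ioi (0 : ℝ) := fun p hp =>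
    ⟨⟨hα.trans_le hp.1.1, hp.1.2.trans_lt hβ⟩, hδ.trans_le hp.2.1⟩
  have hc0 : ContinuousOn Ψ (Icc α β ×ˢ Icc δ T) := hΨ.continuousOn.mono hsub
  have hc1 : ∀ v, ContinuousOn (fun p => fderiv ℝ Ψ p v) (Icc α β ×ˢ Icc δ T) := fun v =>
    (hΨ.fderiv_apply_of_isOpen hU v).continuousOn.mono hsub
  have hc2 : ∀ v w, ContinuousOn (fun p => fderiv ℝ (fun p => fderiv ℝ Ψ p v) p w)
      (Icc α β ×ˢ Icc δ T) := fun v w => (hΨ.continuousOn_fderiv_fderiv hU v w).mono hsub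
  have hslice1 : ∀ {g : ℝ × ℝ → ℝ}, ContinuousOn g (Icc α β ×ˢ Icc δ T) → ∀ τ ∈ Icc δ T,
      ContinuousOn (fun σ => g (σ, τ)) (uIcc α β) := fun hg τ hτ => by
    rw [uIcc_of_le hαβ]
    exact hg.comp (by fun_prop) fun σ hσ => ⟨hσ, hτ⟩
  have hslice2 : ∀ {g : ℝ × ℝ → ℝ}, ContinuousOn g (Icc α β ×ˢ Icc δ T) → ∀ σ ∈ Icc α β,
      ContinuousOn (fun τ => g (σ, τ)) (uIcc δ T) := fun hg σ hσ => by
    rw [uIcc_of_le hδT]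
    exact hg.comp (by fun_prop) fun τ hτ => ⟨hσ, hτ⟩
  have hw := continuous_besselE_mul_real 0 (k ^ 2)
  have hχc : ContinuousOn χ (Icc α β) := by
    rw [show χ = _ from funext hχ]
    refine (hw.continuousOn.sub continuousOn_const).sub (continuousOn_const.mul ?_)
    exact Real.continuousOn_log.mono fun x hx => (hα.trans_le hx.1).ne'
  -- integration in time
  have htime : ∀ σ ∈ Icc α β,
      ∫ τ in δ..T, fderiv ℝ (fun p => fderiv ℝ Ψ p (0, 1)) (σ, τ) (0, 1) * Real.sin (k * (T - τ)) =
      k * ψ σ T - (fderiv ℝ Ψ (σ, δ) (0, 1) * Real.sin (k * (T - δ)) +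
          k * ψ σ δ * Real.cos (k * (T - δ))) - k ^ 2 * V σ := fun σ hσ => by
    have harg : ∀ x, HasDerivAt (fun ξ => k * (T - ξ)) (-k) x := fun x => by
      simpa using ((hasDerivAt_id x).const_sub T).const_mul k
    have hd : ∀ τ ∈ uIcc δ T, HasDerivAt (fun τ => fderiv ℝ Ψ (σ, τ) (0, 1) *
        Real.sin (k * (T - τ)) + k * ψ σ τ * Real.cos (k * (T - τ)))
        (fderiv ℝ (fun p => fderiv ℝ Ψ p (0, 1)) (σ, τ) (0, 1) * Real.sin (k * (T - τ)) +
          k ^ 2 * (ψ σ τ * Real.sin (k * (T - τ)))) τ := fun τ hτ => by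
      rw [uIcc_of_le hδT] at hτ
      have hp := hsub (show (σ, τ) ∈ _ from ⟨hσ, hτ⟩)
      have h1 := (hΨ.hasFDerivAt_fderiv_apply hU (0, 1) hp).hasDerivAt_snd
      have h2 : HasDerivAt (fun τ => ψ σ τ) (fderiv ℝ Ψ (σ, τ) (0, 1)) τ :=
        (hΨ.hasFDerivAt_of_isOpen hU hp).hasDerivAt_snd
      refine ((h1.mul (harg τ).sin).add ((h2.const_mul k).mul (harg τ).cos)).congr_deriv ?_
      ring
    have hi1 : IntervalIntegrable (fun τ => fderiv ℝ (fun p => fderiv ℝ Ψ p (0, 1)) (σ, τ) (0, 1) *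
        Real.sin (k * (T - τ))) volume δ T :=
      ((hslice2 (hc2 (0, 1) (0, 1)) σ hσ).mul (by fun_prop)).intervalIntegrable
    have hi2 : IntervalIntegrable (fun τ => k ^ 2 * (ψ σ τ * Real.sin (k * (T - τ)))) volume δ T :=
      (continuousOn_const.mul ((hslice2 hc0 σ hσ).mul (by fun_prop))).intervalIntegrable
    have h1 := intervalIntegral.integral_eq_sub_of_hasDerivAt hd (hi1.add hi2)
    rw [intervalIntegral.integral_add hi1 hi2, intervalIntegral.integral_const_mul, ← hV] at h1
    simp only [sub_self, mul_zero, Real.sin_zero, Real.cos_zero, mul_one, zero_add] at h1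
    linarith
  -- integration in space
  have hspace : ∀ τ ∈ Icc δ T,
      ∫ σ in α..β, fderiv ℝ (fun p => fderiv ℝ Ψ p (0, 1)) (σ, τ) (0, 1) * χ σ =
      (k ^ 2 * (β * besselE 1 (k ^ 2 * β)) + q) * ψ β τ -
        (k ^ 2 * (α * besselE 1 (k ^ 2 * α)) + q) * ψ α τ -
        k ^ 2 * ∫ σ in α..β, ψ σ τ * besselE 0 (k ^ 2 * σ) := fun τ hτ => by
    have hd : ∀ σ ∈ uIcc α β, HasDerivAt (fun σ => σ * fderiv ℝ Ψ (σ, τ) (1, 0) * χ σ +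
        (k ^ 2 * (σ * besselE 1 (k ^ 2 * σ)) + q) * ψ σ τ)
        (fderiv ℝ (fun p => fderiv ℝ Ψ p (0, 1)) (σ, τ) (0, 1) * χ σ +
          k ^ 2 * (ψ σ τ * besselE 0 (k ^ 2 * σ))) σ := fun σ hσ => by
      rw [uIcc_of_le hαβ] at hσ
      have hp := hsub (show (σ, τ) ∈ _ from ⟨hσ, hτ⟩)
      have hσ0 : σ ≠ 0 := (hα.trans_le hσ.1).ne'
      have h1 := (hΨ.hasFDerivAt_fderiv_apply hU (1, 0) hp).hasDerivAt_fst
      have h2 : HasDerivAt (fun σ => ψ σ τ) (fderiv ℝ Ψ (σ, τ) (1, 0)) σ :=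
        (hΨ.hasFDerivAt_of_isOpen hU hp).hasDerivAt_fst
      have h3 : HasDerivAt χ (-besselE 1 (k ^ 2 * σ) * k ^ 2 - q * σ⁻¹) σ := by
        rw [show χ = _ from funext hχ]
        exact ((hasDerivAt_besselE_mul_real 0 (k ^ 2) σ).sub_const w₀).sub
          ((Real.hasDerivAt_log hσ0).const_mul q)
      have h4 := ((hasDerivAt_self_mul_besselE_one (k ^ 2) σ).const_mul (k ^ 2)).add_const q
      refine ((((hasDerivAt_id σ).mul h1).mul h3).add (h4.mul h2)).congr_deriv ?_
      rw [h.pde_fderiv hp]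
      simp only [id, Pi.mul_apply]
      field_simp
      ring
    have hi1 : IntervalIntegrable (fun σ => fderiv ℝ (fun p => fderiv ℝ Ψ p (0, 1)) (σ, τ) (0, 1) *
        χ σ) volume α β :=
      ((hslice1 (hc2 (0, 1) (0, 1)) τ hτ).mul (by rwa [uIcc_of_le hαβ])).intervalIntegrable
    have hi2 : IntervalIntegrable (fun σ => k ^ 2 * (ψ σ τ * besselE 0 (k ^ 2 * σ))) volume α β :=
      (continuousOn_const.mul ((hslice1 hc0 τ hτ).mul hw.continuousOn)).intervalIntegrable
    have h1 := intervalIntegral.integral_eq_sub_of_hasDerivAt hd (hi1.add hi2)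
    rw [intervalIntegral.integral_add hi1 hi2, intervalIntegral.integral_const_mul] at h1
    simp only [hχα, hχβ, mul_zero, zero_add] at h1
    linarith
  have hα' : α ∈ Icc α β := left_mem_Icc.2 hαβ
  have hβ' : β ∈ Icc α β := right_mem_Icc.2 hαβ
  have hsin : Continuous fun τ => Real.sin (k * (T - τ)) := by fun_prop
  calc _ = ∫ σ in α..β, ∫ τ in δ..T,
        fderiv ℝ (fun p => fderiv ℝ Ψ p (0, 1)) (σ, τ) (0, 1) * χ σ * Real.sin (k * (T - τ)) := by
        refine intervalIntegral.integral_congr fun σ hσ => ?_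
        rw [uIcc_of_le hαβ] at hσ
        rw [← htime σ hσ, ← intervalIntegral.integral_mul_const]
        congr 1; ext τ; ring
    _ = ∫ τ in δ..T, ∫ σ in α..β,
        fderiv ℝ (fun p => fderiv ℝ Ψ p (0, 1)) (σ, τ) (0, 1) * χ σ * Real.sin (k * (T - τ)) := by
        refine intervalIntegral_swap_of_continuousOn hαβ hδT ?_
        exact ((hc2 (0, 1) (0, 1)).mul (hχc.comp continuousOn_fst fun p hp => hp.1)).mul
          (hsin.comp continuous_snd).continuousOn
    _ = ∫ τ in δ..T, ((k ^ 2 * (β * besselE 1 (k ^ 2 * β)) + q) * (ψ β τ * Real.sin (k * (T - τ))) -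
        (k ^ 2 * (α * besselE 1 (k ^ 2 * α)) + q) * (ψ α τ * Real.sin (k * (T - τ))) -
        k ^ 2 * ∫ σ in α..β, ψ σ τ * Real.sin (k * (T - τ)) * besselE 0 (k ^ 2 * σ)) := by
        refine intervalIntegral.integral_congr fun τ hτ => ?_
        rw [uIcc_of_le hδT] at hτ
        rw [intervalIntegral.integral_mul_const, hspace τ hτ]
        have : ∫ σ in α..β, ψ σ τ * Real.sin (k * (T - τ)) * besselE 0 (k ^ 2 * σ) =
            (∫ σ in α..β, ψ σ τ * besselE 0 (k ^ 2 * σ)) * Real.sin (k * (T - τ)) := by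
          rw [← intervalIntegral.integral_mul_const]
          congr 1; ext σ; ring
        rw [this]
        ring
    _ = _ := by
        have hFc : ContinuousOn (fun p : ℝ × ℝ => ψ p.1 p.2 * Real.sin (k * (T - p.2)) *
            besselE 0 (k ^ 2 * p.1)) (Icc α β ×ˢ Icc δ T) :=
          (hc0.mul (hsin.comp continuous_snd).continuousOn).mul
            (hw.comp continuous_fst).continuousOn
        have hswap := intervalIntegral_swap_of_continuousOn
          (F := fun σ τ => ψ σ τ * Real.sin (k * (T - τ)) * besselE 0 (k ^ 2 * σ)) hαβ hδT hFc
        have hi : ∀ σ ∈ Icc α β, ∀ c : ℝ, IntervalIntegrable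
            (fun τ => c * (ψ σ τ * Real.sin (k * (T - τ)))) volume δ T := fun σ hσ c =>
          (continuousOn_const.mul ((hslice2 hc0 σ hσ).mul hsin.continuousOn)).intervalIntegrable
        have hi3 : IntervalIntegrable (fun τ => k ^ 2 *
            ∫ σ in α..β, ψ σ τ * Real.sin (k * (T - τ)) * besselE 0 (k ^ 2 * σ)) volume δ T := by
          refine IntervalIntegrable.const_mul ?_ _
          rw [intervalIntegrable_iff_integrableOn_Ioc_of_le hδT]
          simp_rw [intervalIntegral.integral_of_le hαβ]
          have hint : Integrable (fun p : ℝ × ℝ => ψ p.1 p.2 * Real.sin (k * (T - p.2)) *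
            besselE 0 (k ^ 2 * p.1)) ((volume.restrict (Ioc α β)).prod
              (volume.restrict (Ioc δ T))) := by
            rw [Measure.prod_restrict, ← Measure.volume_eq_prod]
            exact (hFc.integrableOn_compact (isCompact_Icc.prod isCompact_Icc)).mono_set
              (prod_mono Ioc_subset_Icc_self Ioc_subset_Icc_self)
          exact hint.integral_prod_right
        rw [intervalIntegral.integral_sub ((hi β hβ' _).sub (hi α hα' _)) hi3,
          intervalIntegral.integral_sub (hi β hβ' _) (hi α hα' _),
          intervalIntegral.integral_const_mul, intervalIntegral.integral_const_mul,
          intervalIntegral.integral_const_mul, ← hV, ← hV, ← hswap]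
        congr 2
        refine intervalIntegral.integral_congr fun σ _ => ?_
        rw [hV, intervalIntegral.integral_mul_const]

end Solution

/-! ### Fourier–Bessel coefficients of a solution -/

section Solution

variable {σL : ℝ} {ψb : ℝ → ℝ} {ψ : ℝ → ℝ → ℝ}

theorem IsIBVPSolution.fderivWithin_zero (h : IsIBVPSolution σL ψb ψ) {σ : ℝ} (hσ : σ ∈ Ioo 0 σL) :
    fderivWithin ℝ (fun p : ℝ × ℝ => ψ p.1 p.2) (Ioo 0 σL ×ˢ Ici 0) (σ, 0) (0, 1) = 0 := by
  have h1 : HasFDerivWithinAt (fun p : ℝ × ℝ => ψ p.1 p.2)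
      (fderivWithin ℝ (fun p : ℝ × ℝ => ψ p.1 p.2) (Ioo 0 σL ×ˢ Ici 0) (σ, 0))
      (Ioo 0 σL ×ˢ Ici 0) (σ, 0) :=
    (h.contDiffOn_one.differentiableOn (by norm_num) _ ⟨hσ, self_mem_Ici⟩).hasFDerivWithinAt
  have h2 : HasDerivWithinAt (fun t : ℝ => (σ, t)) ((0 : ℝ), (1 : ℝ)) (Ici 0) 0 :=
    ((hasDerivAt_const 0 σ).prodMk (hasDerivAt_id 0)).hasDerivWithinAt
  have h3 : HasDerivWithinAt (fun t => ψ σ t) _ (Ici 0) 0 :=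
    h1.comp_hasDerivWithinAt (0 : ℝ) h2 fun t ht => ⟨hσ, ht⟩
  exact (uniqueDiffWithinAt_Ici 0).eq_deriv _ h3 (h.init_velocity σ hσ)

/-- Green's identity on `[α,β] × [0,T]`. -/
theorem IsIBVPSolution.green_identity_zero (h : IsIBVPSolution σL ψb ψ) {α β T : ℝ} (hα : 0 < α)
    (hαβ : α ≤ β) (hβ : β < σL) (hT : 0 < T) {k w₀ q : ℝ} {χ V : ℝ → ℝ}
    (hχ : ∀ σ, χ σ = besselE 0 (k ^ 2 * σ) - w₀ - q * Real.log σ)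
    (hχα : χ α = 0) (hχβ : χ β = 0)
    (hV : ∀ σ, V σ = ∫ τ in (0 : ℝ)..T, ψ σ τ * Real.sin (k * (T - τ))) :
    ∫ σ in α..β, (k * ψ σ T - k ^ 2 * V σ) * χ σ =
      (k ^ 2 * (β * besselE 1 (k ^ 2 * β)) + q) * V β -
        (k ^ 2 * (α * besselE 1 (k ^ 2 * α)) + q) * V α -
        k ^ 2 * ∫ σ in α..β, V σ * besselE 0 (k ^ 2 * σ) := by
  set Ψ : ℝ × ℝ → ℝ := fun p => ψ p.1 p.2
  have hσL : 0 < σL := (hα.trans_le hαβ).trans hβ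
  have hmem : ∀ σ ∈ Icc α β, σ ∈ Ioo 0 σL := fun σ hσ => ⟨hα.trans_le hσ.1, hσ.2.trans_lt hβ⟩
  set P : ℝ → ℝ → ℝ := fun σ τ => Ψ (clamp 0 σL σ, max τ 0)
  have hP : Continuous fun p : ℝ × ℝ => P p.1 p.2 := continuous_clamp_prod hσL.le h.continuousOn
  have hPψ : ∀ σ ∈ Icc α β, ∀ τ, 0 ≤ τ → P σ τ = ψ σ τ := fun σ hσ τ hτ => by
    simp only [P, clamp_of_mem (Ioo_subset_Icc_self (hmem σ hσ)), max_eq_left hτ, Ψ]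
  -- The τ-derivative, continuous up to τ = 0 only for 0 < σ < σ_L; hence the clamping to [α,β]
  -- here, whereas ψ itself is clamped to [0,σ_L].
  set D : ℝ → ℝ → ℝ := fun σ τ =>
    fderivWithin ℝ Ψ (Ioo 0 σL ×ˢ Ici 0) (clamp α β σ, max τ 0) (0, 1)
  have hD : Continuous fun p : ℝ × ℝ => D p.1 p.2 := by
    refine continuous_clamp_prod
      (f := fun p => fderivWithin ℝ Ψ (Ioo 0 σL ×ˢ Ici 0) p (0, 1)) hαβ ?_
    exact ((h.contDiffOn_one.continuousOn_fderivWithin (uniqueDiffOn_Ioo_prod_Ici σL)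
      le_rfl).clm_apply continuousOn_const).mono fun p hp => ⟨hmem _ hp.1, hp.2⟩
  set χ' : ℝ → ℝ := fun σ => χ (clamp α β σ)
  have hχ' : Continuous χ' := by
    have hlog : Continuous fun σ => Real.log (clamp α β σ) :=
      (continuous_clamp α β).log fun σ => (hα.trans_le (clamp_mem hαβ σ).1).ne'
    have hw : Continuous fun σ => besselE 0 (k ^ 2 * clamp α β σ) :=
      (continuous_besselE_mul_real 0 (k ^ 2)).comp (continuous_clamp α β)
    have : χ' = fun σ => besselE 0 (k ^ 2 * clamp α β σ) - w₀ - q * Real.log (clamp α β σ) :=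
      funext fun σ => hχ _
    rw [this]
    fun_prop
  have hχχ : ∀ σ ∈ Icc α β, χ' σ = χ σ := fun σ hσ => by simp only [χ', clamp_of_mem hσ]
  -- The integral from δ to T, reversed so that the moving endpoint is the upper one.
  set W : ℝ → ℝ → ℝ := fun σ δ => -∫ τ in T..δ, P σ τ * Real.sin (k * (T - τ))
  have hW : Continuous fun p : ℝ × ℝ => W p.1 p.2 := by
    refine Continuous.neg ?_
    refine intervalIntegral.continuous_parametric_intervalIntegral_of_continuous
      (f := fun (p : ℝ × ℝ) τ => P p.1 τ * Real.sin (k * (T - τ))) ?_ continuous_snd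
    exact (hP.comp (f := fun x : (ℝ × ℝ) × ℝ => (x.1.1, x.2)) (by fun_prop)).mul (by fun_prop)
  have hWV : ∀ σ ∈ Icc α β, ∀ δ, 0 ≤ δ → δ ≤ T →
      W σ δ = ∫ τ in δ..T, ψ σ τ * Real.sin (k * (T - τ)) := fun σ hσ δ hδ hδT => by
    simp only [W]
    rw [← intervalIntegral.integral_symm]
    refine intervalIntegral.integral_congr fun τ hτ => ?_
    rw [uIcc_of_le hδT] at hτ
    simp only [hPψ σ hσ τ (hδ.trans hτ.1)]
  have hw := continuous_besselE_mul_real 0 (k ^ 2)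
  have hα' : α ∈ Icc α β := left_mem_Icc.2 hαβ
  have hβ' : β ∈ Icc α β := right_mem_Icc.2 hαβ
  set L : ℝ → ℝ := fun δ => ∫ σ in α..β, (k * P σ T - (D σ δ * Real.sin (k * (T - δ)) +
    k * P σ δ * Real.cos (k * (T - δ))) - k ^ 2 * W σ δ) * χ' σ
  set R : ℝ → ℝ := fun δ => (k ^ 2 * (β * besselE 1 (k ^ 2 * β)) + q) * W β δ -
        (k ^ 2 * (α * besselE 1 (k ^ 2 * α)) + q) * W α δ -
        k ^ 2 * ∫ σ in α..β, W σ δ * besselE 0 (k ^ 2 * σ)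
  have hflip : Continuous fun x : ℝ × ℝ => (x.2, x.1) := by fun_prop
  have hL : Continuous L := by
    refine intervalIntegral.continuous_parametric_intervalIntegral_of_continuous' ?_ _ _
    have h1 := hD.comp hflip
    have h2 := hP.comp hflip
    have h3 := hW.comp hflip
    have h4 : Continuous fun x : ℝ × ℝ => P x.2 T :=
      hP.comp (f := fun x : ℝ × ℝ => (x.2, T)) (by fun_prop)
    have h5 := hχ'.comp continuous_snd (X := ℝ × ℝ)
    exact (((h4.const_mul k).sub ((h1.mul (by fun_prop)).add ((h2.const_mul k).mul
      (by fun_prop)))).sub (h3.const_mul _)).mul h5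
  have hR : Continuous R := by
    have h1 : Continuous fun δ => ∫ σ in α..β, W σ δ * besselE 0 (k ^ 2 * σ) :=
      intervalIntegral.continuous_parametric_intervalIntegral_of_continuous'
        ((hW.comp hflip).mul (hw.comp continuous_snd)) _ _
    have h2 : ∀ c, Continuous fun δ => W c δ := fun c =>
      hW.comp (f := fun δ : ℝ => (c, δ)) (by fun_prop)
    have h3 := h2 α
    have h4 := h2 β
    fun_prop
  have hLR : ∀ δ ∈ Ioc 0 T, L δ = R δ := fun δ hδ => by
    have key := h.green_identity hα hαβ hβ hδ.1 hδ.2 hχ hχα hχβ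
      (V := fun σ => ∫ τ in δ..T, ψ σ τ * Real.sin (k * (T - τ))) fun _ => rfl
    simp only [R]
    rw [hWV α hα' δ hδ.1.le hδ.2, hWV β hβ' δ hδ.1.le hδ.2]
    refine Eq.trans ?_ (key.trans ?_)
    · refine intervalIntegral.integral_congr fun σ hσ => ?_
      rw [uIcc_of_le hαβ] at hσ
      rw [hWV σ hσ δ hδ.1.le hδ.2, hPψ σ hσ δ hδ.1.le, hPψ σ hσ T hT.le, hχχ σ hσ]
      simp only [D, clamp_of_mem hσ, max_eq_left hδ.1.le]
      rw [fderivWithin_Ioo_prod_Ici (show (σ, δ) ∈ Ioo 0 σL ×ˢ Ioi (0 : ℝ) from ⟨hmem σ hσ, hδ.1⟩)]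
    · congr 2
      refine intervalIntegral.integral_congr fun σ hσ => ?_
      rw [uIcc_of_le hαβ] at hσ
      rw [hWV σ hσ δ hδ.1.le hδ.2]
  -- Both sides of the identity are continuous in δ and agree for δ in (0,T], hence also at δ = 0.
  -- There ψ and ψ_τ vanish and the initial terms drop out.
  have hLR0 : L 0 = R 0 := by
    have hcl : closure (Ioc 0 T) ⊆ {δ | L δ = R δ} :=
      closure_minimal hLR (isClosed_eq hL hR)
    rw [closure_Ioc hT.ne] at hcl
    exact hcl (left_mem_Icc.2 hT.le)
  have hWV0 : ∀ σ ∈ Icc α β, W σ 0 = V σ := fun σ hσ => by rw [hWV σ hσ 0 le_rfl hT.le, hV]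
  simp only [R] at hLR0
  rw [hWV0 α hα', hWV0 β hβ'] at hLR0
  refine Eq.trans ?_ (hLR0.trans ?_)
  · refine intervalIntegral.integral_congr fun σ hσ => ?_
    rw [uIcc_of_le hαβ] at hσ
    rw [hWV0 σ hσ, hPψ σ hσ 0 le_rfl, hPψ σ hσ T hT.le, hχχ σ hσ,
      h.init σ (Ioo_subset_Icc_self (hmem σ hσ))]
    simp only [D, clamp_of_mem hσ, max_self]
    rw [h.fderivWithin_zero (hmem σ hσ)]
    ring
  · congr 2
    refine intervalIntegral.integral_congr fun σ hσ => ?_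
    rw [uIcc_of_le hαβ] at hσ
    rw [hWV0 σ hσ]

/-- Bounds the contribution of the corrector to Green's identity. The integral of log β − log σ over
[α,β] is at most β uniformly in α, so no singularity arises as α → 0. -/
theorem abs_integral_mul_log_le {α β C c q : ℝ} {H : ℝ → ℝ} (hα : 0 < α) (hαβ : α ≤ β)
    (hC : ∀ σ ∈ Icc α β, |H σ| ≤ C) :
    |∫ σ in α..β, H σ * (c + q * (Real.log σ - Real.log β))| ≤ C * (|c| + |q|) * β := by
  have hC0 : 0 ≤ C := (abs_nonneg _).trans (hC α (left_mem_Icc.2 hαβ))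
  have hli : IntervalIntegrable (fun σ => Real.log β - Real.log σ) volume α β :=
    intervalIntegrable_const.sub (intervalIntegral.intervalIntegrable_log'
      (a := α) (b := β))
  have h1 := intervalIntegral.norm_integral_le_of_norm_le hαβ
    (f := fun σ => H σ * (c + q * (Real.log σ - Real.log β)))
    (g := fun σ => C * |c| + C * |q| * (Real.log β - Real.log σ)) (μ := volume)
    (Eventually.of_forall fun σ hσ => by
      have hle : Real.log σ ≤ Real.log β := Real.log_le_log (hα.trans hσ.1) hσ.2
      rw [norm_mul, Real.norm_eq_abs, Real.norm_eq_abs]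
      have h2 : |c + q * (Real.log σ - Real.log β)| ≤ |c| + |q| * (Real.log β - Real.log σ) := by
        refine (abs_add_le _ _).trans ?_
        rw [abs_mul, abs_of_nonpos (sub_nonpos.2 hle), neg_sub]
      calc _ ≤ C * (|c| + |q| * (Real.log β - Real.log σ)) :=
            mul_le_mul (hC σ (Ioc_subset_Icc_self hσ)) h2 (abs_nonneg _) hC0
        _ = _ := by ring)
    (intervalIntegrable_const.add (hli.const_mul _))
  refine h1.trans ?_
  rw [intervalIntegral.integral_add intervalIntegrable_const (hli.const_mul _),
    intervalIntegral.integral_const_mul (C * |q|), intervalIntegral.integral_sub intervalIntegrable_const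
      intervalIntegral.intervalIntegrable_log', integral_log]
  simp only [intervalIntegral.integral_const, smul_eq_mul]
  have hlog : Real.log α ≤ Real.log β := Real.log_le_log hα hαβ
  have h3 : (β - α) * Real.log β - (β * Real.log β - α * Real.log α - β + α) ≤ β := by
    nlinarith [mul_le_mul_of_nonneg_left hlog hα.le]
  have h4 : (β - α) * (C * |c|) ≤ C * |c| * β := by
    have : 0 ≤ C * |c| := by positivity
    nlinarith
  have h5 := mul_le_mul_of_nonneg_left h3 (by positivity : 0 ≤ C * |q|)
  linarith

/-- The Fourier-Bessel coefficients of a solution, without the boundary correction. -/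
theorem IsIBVPSolution.integral_mul_mode (hσL : 0 < σL) (h : IsIBVPSolution σL ψb ψ) {T : ℝ}
    (hT : 0 ≤ T) {k : ℝ} (hw : besselE 0 (k ^ 2 * σL) = 0) :
    k * ∫ σ in (0 : ℝ)..σL, ψ σ T * besselE 0 (k ^ 2 * σ) =
      k ^ 2 * (σL * besselE 1 (k ^ 2 * σL)) * sinConv k ψb T := by
  rcases hT.eq_or_lt with rfl | hT
  · have : ∫ σ in (0 : ℝ)..σL, ψ σ 0 * besselE 0 (k ^ 2 * σ) = 0 := by
      have h0 : ∫ σ in (0 : ℝ)..σL, ψ σ 0 * besselE 0 (k ^ 2 * σ) = ∫ _ in (0 : ℝ)..σL, (0 : ℝ) := by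
        refine intervalIntegral.integral_congr fun σ hσ => ?_
        rw [uIcc_of_le hσL.le] at hσ
        simp only [h.init σ hσ, zero_mul]
      rw [h0, intervalIntegral.integral_zero]
    rw [this, sinConv]
    simp
  set P : ℝ → ℝ → ℝ := fun σ τ => ψ (clamp 0 σL σ) (max τ 0)
  have hP : Continuous fun p : ℝ × ℝ => P p.1 p.2 := continuous_clamp_prod hσL.le h.continuousOn
  have hPψ : ∀ σ ∈ Icc 0 σL, ∀ τ, 0 ≤ τ → P σ τ = ψ σ τ := fun σ hσ τ hτ => by
    simp only [P, clamp_of_mem hσ, max_eq_left hτ]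
  set w : ℝ → ℝ := fun σ => besselE 0 (k ^ 2 * σ) with hwdef
  have hwc : Continuous w := continuous_besselE_mul_real 0 (k ^ 2)
  set V : ℝ → ℝ := fun σ => ∫ τ in (0 : ℝ)..T, P σ τ * Real.sin (k * (T - τ))
  have hVc : Continuous V :=
    intervalIntegral.continuous_parametric_intervalIntegral_of_continuous'
      (hP.mul (by fun_prop)) _ _
  have hVψ : ∀ σ ∈ Icc 0 σL, V σ = ∫ τ in (0 : ℝ)..T, ψ σ τ * Real.sin (k * (T - τ)) :=
    fun σ hσ => by
      refine intervalIntegral.integral_congr fun τ hτ => ?_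
      rw [uIcc_of_le hT.le] at hτ
      simp only [hPψ σ hσ τ hτ.1]
  set H : ℝ → ℝ := fun σ => k * P σ T - k ^ 2 * V σ
  have hPT : Continuous fun σ => P σ T := hP.comp (f := fun σ => (σ, T)) (by fun_prop)
  have hHc : Continuous H := by fun_prop
  obtain ⟨C, hC⟩ := isCompact_Icc.exists_bound_of_continuousOn (hHc.continuousOn (s := Icc 0 σL))
  -- The coefficient of log σ for which the corrected mode vanishes at both ε and σ_L − ε. The
  -- numerator stays bounded while log(σ_L − ε) − log ε → ∞, so q → 0; the other error w(σ_L − ε)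
  -- tends to 0 because the mode vanishes at σ_L.
  set q : ℝ → ℝ := fun ε => (w (σL - ε) - w ε) / (Real.log (σL - ε) - Real.log ε)
  -- the identity on `[ε, σ_L - ε]`
  have hid : ∀ ε ∈ Ioo 0 (σL / 2),
      |(∫ σ in ε..σL - ε, H σ * w σ) -
        ((k ^ 2 * ((σL - ε) * besselE 1 (k ^ 2 * (σL - ε))) + q ε) * V (σL - ε) -
        (k ^ 2 * (ε * besselE 1 (k ^ 2 * ε)) + q ε) * V ε -
        k ^ 2 * ∫ σ in ε..σL - ε, V σ * w σ)| ≤ C * (|w (σL - ε)| + |q ε|) * σL := by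
    intro ε hε
    have hεβ : ε < σL - ε := by linarith [hε.2]
    have hβ : σL - ε < σL := by linarith [hε.1]
    have hsub : ∀ σ ∈ Icc ε (σL - ε), σ ∈ Icc 0 σL := fun σ hσ =>
      ⟨hε.1.le.trans hσ.1, hσ.2.trans hβ.le⟩
    have hlog : Real.log (σL - ε) - Real.log ε ≠ 0 :=
      (sub_pos.2 (Real.log_lt_log hε.1 hεβ)).ne'
    have key := h.green_identity_zero hε.1 hεβ.le hβ hT (k := k)
      (w₀ := w (σL - ε) - q ε * Real.log (σL - ε)) (q := q ε)
      (χ := fun σ => w σ - (w (σL - ε) - q ε * Real.log (σL - ε)) - q ε * Real.log σ)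
      (fun _ => rfl) (by simp only [q]; field_simp; ring) (by ring) (fun _ => rfl)
    rw [← hVψ ε (hsub _ (left_mem_Icc.2 hεβ.le)),
      ← hVψ (σL - ε) (hsub _ (right_mem_Icc.2 hεβ.le))] at key
    have e1 : ∫ σ in ε..σL - ε, (k * ψ σ T - k ^ 2 * ∫ τ in (0 : ℝ)..T, ψ σ τ *
        Real.sin (k * (T - τ))) * (w σ - (w (σL - ε) - q ε * Real.log (σL - ε)) -
          q ε * Real.log σ) = (∫ σ in ε..σL - ε, H σ * w σ) -
        ∫ σ in ε..σL - ε, H σ * (w (σL - ε) + q ε * (Real.log σ - Real.log (σL - ε))) := by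
      rw [← intervalIntegral.integral_sub]
      · refine intervalIntegral.integral_congr fun σ hσ => ?_
        rw [uIcc_of_le hεβ.le] at hσ
        simp only [H]
        rw [hVψ σ (hsub σ hσ), hPψ σ (hsub σ hσ) T hT.le]
        ring
      · exact (hHc.mul hwc).intervalIntegrable _ _
      · exact (intervalIntegrable_const.add ((intervalIntegral.intervalIntegrable_log'.sub
          intervalIntegrable_const).const_mul _)).continuousOn_mul hHc.continuousOn
    have e2 : ∫ σ in ε..σL - ε, (∫ τ in (0 : ℝ)..T, ψ σ τ * Real.sin (k * (T - τ))) *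
        besselE 0 (k ^ 2 * σ) = ∫ σ in ε..σL - ε, V σ * w σ := by
      refine intervalIntegral.integral_congr fun σ hσ => ?_
      rw [uIcc_of_le hεβ.le] at hσ
      simp only [hwdef]
      rw [hVψ σ (hsub σ hσ)]
    rw [e1, e2] at key
    rw [← key, sub_sub_cancel]
    have hC0 : 0 ≤ C := (norm_nonneg _).trans (hC 0 (left_mem_Icc.2 hσL.le))
    refine (abs_integral_mul_log_le hε.1 hεβ.le fun σ hσ => hC σ (hsub σ hσ)).trans ?_
    exact mul_le_mul_of_nonneg_left hβ.le (by positivity)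
  -- passing to the limit
  have hid0 : Tendsto (fun ε : ℝ => ε) (𝓝[>] 0) (𝓝 0) := tendsto_nhdsWithin_of_tendsto_nhds tendsto_id
  have hq : Tendsto q (𝓝[>] 0) (𝓝 0) := by
    have h1 : Tendsto (fun ε => w (σL - ε) - w ε) (𝓝[>] 0) (𝓝 (w (σL - 0) - w 0)) :=
      ((by fun_prop : Continuous fun ε => w (σL - ε) - w ε).tendsto 0).comp hid0
    refine h1.div_atTop ?_
    have h2 : Tendsto (fun ε => Real.log (σL - ε)) (𝓝[>] 0) (𝓝 (Real.log (σL - 0))) :=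
      (Real.continuousAt_log (by linarith)).tendsto.comp (tendsto_const_nhds.sub hid0)
    exact h2.add_atTop (tendsto_neg_atBot_atTop.comp Real.tendsto_log_nhdsGT_zero)
  have hG : ∀ {G : ℝ → ℝ}, Continuous G → Tendsto (fun ε => ∫ σ in ε..σL - ε, G σ) (𝓝[>] 0)
      (𝓝 (∫ σ in (0 : ℝ)..σL, G σ)) := fun {G} hG => by
    have hc : Continuous fun x => ∫ σ in (0 : ℝ)..x, G σ :=
      continuous_iff_continuousAt.2 fun x => (hasDerivAt_integral_zero hG x).continuousAt
    have h1 : Continuous fun ε => (∫ σ in (0 : ℝ)..σL - ε, G σ) - ∫ σ in (0 : ℝ)..ε, G σ := by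
      fun_prop
    have h2 := (h1.tendsto 0).comp hid0
    simp only [sub_zero, intervalIntegral.integral_same] at h2
    refine h2.congr fun ε => ?_
    exact intervalIntegral.integral_interval_sub_left (hG.intervalIntegrable _ _)
      (hG.intervalIntegrable _ _)
  have hE1 := continuous_besselE_mul_real 1 (k ^ 2)
  have hlim : Tendsto (fun ε => |(∫ σ in ε..σL - ε, H σ * w σ) -
        ((k ^ 2 * ((σL - ε) * besselE 1 (k ^ 2 * (σL - ε))) + q ε) * V (σL - ε) -
        (k ^ 2 * (ε * besselE 1 (k ^ 2 * ε)) + q ε) * V ε -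
        k ^ 2 * ∫ σ in ε..σL - ε, V σ * w σ)|) (𝓝[>] 0)
      (𝓝 |(∫ σ in (0 : ℝ)..σL, H σ * w σ) -
        ((k ^ 2 * (σL * besselE 1 (k ^ 2 * σL)) + 0) * V σL -
        (k ^ 2 * (0 * besselE 1 (k ^ 2 * 0)) + 0) * V 0 -
        k ^ 2 * ∫ σ in (0 : ℝ)..σL, V σ * w σ)|) := by
    have c1 : Tendsto (fun ε => k ^ 2 * ((σL - ε) * besselE 1 (k ^ 2 * (σL - ε)))) (𝓝[>] 0)
        (𝓝 (k ^ 2 * (σL * besselE 1 (k ^ 2 * σL)))) := by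
      have hc : Continuous fun ε => besselE 1 (k ^ 2 * (σL - ε)) := hE1.comp (by fun_prop)
      have := ((by fun_prop : Continuous fun ε =>
        k ^ 2 * ((σL - ε) * besselE 1 (k ^ 2 * (σL - ε)))).tendsto 0).comp hid0
      simpa [Function.comp_def] using this
    have c2 : Tendsto (fun ε => k ^ 2 * (ε * besselE 1 (k ^ 2 * ε))) (𝓝[>] 0)
        (𝓝 (k ^ 2 * (0 * besselE 1 (k ^ 2 * 0)))) :=
      ((by fun_prop : Continuous fun ε => k ^ 2 * (ε * besselE 1 (k ^ 2 * ε))).tendsto 0).comp hid0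
    have c3 : Tendsto (fun ε => V (σL - ε)) (𝓝[>] 0) (𝓝 (V σL)) := by
      have := ((by fun_prop : Continuous fun ε => V (σL - ε)).tendsto 0).comp hid0
      simpa [Function.comp_def] using this
    have c4 : Tendsto V (𝓝[>] 0) (𝓝 (V 0)) := (hVc.tendsto 0).comp hid0
    exact ((hG (hHc.mul hwc)).sub ((((c1.add hq).mul c3).sub ((c2.add hq).mul c4)).sub
      ((hG (hVc.mul hwc)).const_mul _))).abs
  have hlim0 : Tendsto (fun ε => C * (|w (σL - ε)| + |q ε|) * σL) (𝓝[>] 0) (𝓝 0) := by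
    have c1 : Tendsto (fun ε => |w (σL - ε)|) (𝓝[>] 0) (𝓝 |w (σL - 0)|) :=
      ((by fun_prop : Continuous fun ε => |w (σL - ε)|).tendsto 0).comp hid0
    have := ((c1.add hq.abs).const_mul C).mul_const σL
    simpa [hwdef, hw] using this
  have hfin := le_of_tendsto_of_tendsto hlim hlim0 (by
    filter_upwards [Ioo_mem_nhdsGT (by positivity : 0 < σL / 2)] with ε hε using hid ε hε)
  have h0 := sub_eq_zero.1 (abs_eq_zero.1 (le_antisymm hfin (abs_nonneg _)))
  have hsplit : ∫ σ in (0 : ℝ)..σL, H σ * w σ =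
      k * (∫ σ in (0 : ℝ)..σL, P σ T * w σ) - k ^ 2 * ∫ σ in (0 : ℝ)..σL, V σ * w σ := by
    rw [← intervalIntegral.integral_const_mul, ← intervalIntegral.integral_const_mul,
      ← intervalIntegral.integral_sub]
    · congr 1; ext σ; simp only [H]; ring
    all_goals exact Continuous.intervalIntegrable (by fun_prop) _ _
  have hPw : ∫ σ in (0 : ℝ)..σL, P σ T * w σ =
      ∫ σ in (0 : ℝ)..σL, ψ σ T * besselE 0 (k ^ 2 * σ) := by
    refine intervalIntegral.integral_congr fun σ hσ => ?_
    rw [uIcc_of_le hσL.le] at hσ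
    simp only [hPψ σ hσ T hT.le, hwdef]
  have hVL : V σL = sinConv k ψb T := by
    rw [hVψ σL (right_mem_Icc.2 hσL.le), sinConv]
    refine intervalIntegral.integral_congr fun τ hτ => ?_
    rw [uIcc_of_le hT.le] at hτ
    simp only [h.boundary τ hτ.1]
    ring
  rw [hsplit, hPw, hVL] at h0
  linarith

/-- The Fourier-Bessel expansion of a solution. -/
theorem IsIBVPSolution.hasSum_psiMode (hσL : 0 < σL) {ψb' ψb'' : ℝ → ℝ}
    (h : IsIBVPSolution σL ψb ψ) (hb : IsBoundaryDatum ψb ψb' ψb'') {τ M : ℝ} (hτ : 0 ≤ τ)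
    (hM : ∀ t ∈ Icc 0 τ, |ψb'' t| ≤ M) {σ : ℝ} (hσ : σ ∈ Icc 0 σL) :
    HasSum (fun n => psiMode σL ψb'' n σ τ) (ψ σ τ - ψb τ) := by
  simp only [psiMode, besselJ_zero_mode hσL hσ.1]
  have hψ : ContinuousOn (fun σ => ψ σ τ) (Icc 0 σL) :=
    h.continuousOn.comp (f := fun σ : ℝ => (σ, τ)) (by fun_prop) fun σ hσ => ⟨hσ, hτ⟩
  refine hasSum_fourierBessel hσL (h := fun σ => ψ σ τ - ψb τ) (hψ.sub continuousOn_const)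
    (summable_modeCoeff hτ hM) (fun n => ?_) hσ
  have ha := coeffA_pos hσL n
  have hk := Real.sqrt_pos.2 ha
  have hk2 : √(coeffA σL n) ^ 2 = coeffA σL n := Real.sq_sqrt ha.le
  have h1 := h.integral_mul_mode hσL hτ (k := √(coeffA σL n))
    (by rw [hk2]; exact besselE_coeffA_mul hσL n)
  have h2 := integral_mode hσL n
  -- The boundary factor σ_L E₁(a_n σ_L) is the integral of the mode, that is, −b_n times its
  -- squared norm. This brings the coefficient of ψ to −b_n √a_n `sinConv`, and subtracting that of
  -- ψ_b gives c_n.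
  rw [hk2, ← integral_besselE_zero_mul, h2] at h1
  have hw := continuous_besselE_mul_real 0 (coeffA σL n)
  have hi1 : IntervalIntegrable (fun σ => ψ σ τ * besselE 0 (coeffA σL n * σ)) volume 0 σL :=
    ContinuousOn.intervalIntegrable (by rw [uIcc_of_le hσL.le]; exact hψ.mul hw.continuousOn)
  have hi2 : IntervalIntegrable (fun σ => ψb τ * besselE 0 (coeffA σL n * σ)) volume 0 σL :=
    (hw.const_mul _).intervalIntegrable _ _
  simp only [sub_mul]
  rw [intervalIntegral.integral_sub hi1 hi2, intervalIntegral.integral_const_mul, h2,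
    hb.modeCoeff_eq hσL hτ hM]
  have h3 : ∫ σ in (0 : ℝ)..σL, ψ σ τ * besselE 0 (coeffA σL n * σ) = √(coeffA σL n) *
      (-coeffB n * (σL * besselJ 1 (besselZero n) ^ 2)) * sinConv √(coeffA σL n) ψb τ := by
    refine mul_left_cancel₀ hk.ne' (h1.trans ?_)
    nth_rewrite 1 [← hk2]
    ring
  rw [h3]
  ring

end Solution

theorem besselJ_zero_zero : besselJ 0 0 = 1 := by
  simp [besselJ_zero_eq, besselE_zero_right]

theorem psiMode_zero (σL : ℝ) (f : ℝ → ℝ) (n : ℕ) (τ : ℝ) :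
    psiMode σL f n 0 τ = modeCoeff σL f n τ := by
  simp [psiMode, besselJ_zero_zero]

/-! ### Laplace transforms of functions of at most quadratic growth -/

theorem integrableOn_one_add_sq_mul_exp_neg {ε : ℝ} (hε : 0 < ε) :
    IntegrableOn (fun τ : ℝ => (1 + τ ^ 2) * Real.exp (-ε * τ)) (Ioi 0) := by
  have h0 := integrableOn_rpow_mul_exp_neg_mul_rpow (p := 1) (s := 0) (by norm_num) one_pos hε
  have h2 := integrableOn_rpow_mul_exp_neg_mul_rpow (p := 1) (s := 2) (by norm_num) one_pos hε
  refine (h0.add h2).congr_fun (fun τ _ => ?_) measurableSet_Ioi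
  simp only [Pi.add_apply, Real.rpow_zero, Real.rpow_one, Real.rpow_two]
  ring

theorem tendsto_one_add_sq_mul_exp_neg {ε : ℝ} (hε : 0 < ε) :
    Tendsto (fun τ : ℝ => (1 + τ ^ 2) * Real.exp (-ε * τ)) atTop (𝓝 0) := by
  have h := (tendsto_rpow_mul_exp_neg_mul_atTop_nhds_zero 0 ε hε).add
    (tendsto_rpow_mul_exp_neg_mul_atTop_nhds_zero 2 ε hε)
  rw [add_zero] at h
  refine h.congr fun τ => ?_
  simp only [Real.rpow_zero, Real.rpow_two]
  ring

section Growth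

variable {f f' : ℝ → ℝ} {C : ℝ} {s : ℂ}

theorem norm_laplaceIntegrand_le (hC : ∀ τ, 0 ≤ τ → |f τ| ≤ C * (1 + τ ^ 2)) {τ : ℝ} (hτ : 0 ≤ τ) :
    ‖laplaceIntegrand f s τ‖ ≤ C * ((1 + τ ^ 2) * Real.exp (-s.re * τ)) := by
  rw [norm_laplaceIntegrand]
  have := mul_le_mul_of_nonneg_left (hC τ hτ) (Real.exp_pos (-s.re * τ)).le
  linarith

theorem aestronglyMeasurable_laplaceIntegrand
    (hf : AEStronglyMeasurable f (volume.restrict (Ioi 0))) :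
    AEStronglyMeasurable (laplaceIntegrand f s) (volume.restrict (Ioi 0)) :=
  (Continuous.aestronglyMeasurable (by fun_prop)).mul
    (Complex.continuous_ofReal.comp_aestronglyMeasurable hf)

/-- Quadratic growth suits the data: bounded ψ_b'' with zero initial values gives |ψ_b| ≤ Mτ², and
the coefficients c_n grow at most linearly. -/
theorem laplaceConvergent_of_le (hs : 0 < s.re)
    (hf : AEStronglyMeasurable f (volume.restrict (Ioi 0)))
    (hC : ∀ τ, 0 ≤ τ → |f τ| ≤ C * (1 + τ ^ 2)) : LaplaceConvergent f s := by
  refine Integrable.mono' ((integrableOn_one_add_sq_mul_exp_neg hs).const_mul C)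
    (aestronglyMeasurable_laplaceIntegrand hf) ?_
  filter_upwards [ae_restrict_mem measurableSet_Ioi] with τ hτ
  exact norm_laplaceIntegrand_le hC (le_of_lt hτ)

theorem ContinuousOn.aestronglyMeasurable_Ioi (hf : ContinuousOn f (Ici 0)) :
    AEStronglyMeasurable f (volume.restrict (Ioi 0)) :=
  (hf.mono Ioi_subset_Ici_self).aestronglyMeasurable measurableSet_Ioi

theorem laplace_congr {g : ℝ → ℝ} (h : ∀ τ, 0 ≤ τ → f τ = g τ) (s : ℂ) :
    laplace f s = laplace g s :=
  setIntegral_congr_fun measurableSet_Ioi fun τ hτ => by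
    simp only [laplaceIntegrand, h τ (le_of_lt hτ)]

theorem laplaceConvergent_congr {g : ℝ → ℝ} (h : ∀ τ, 0 ≤ τ → f τ = g τ)
    (hf : LaplaceConvergent f s) : LaplaceConvergent g s :=
  hf.congr_fun (fun τ hτ => by simp only [laplaceIntegrand, h τ (le_of_lt hτ)]) measurableSet_Ioi

theorem laplaceIntegrand_lin (a b : ℝ) (f g : ℝ → ℝ) (s : ℂ) :
    laplaceIntegrand (fun τ => a * f τ + b * g τ) s =
      fun τ => a * laplaceIntegrand f s τ + b * laplaceIntegrand g s τ := by
  ext τ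
  simp only [laplaceIntegrand]
  push_cast
  ring

theorem LaplaceConvergent.lin {g : ℝ → ℝ} (hf : LaplaceConvergent f s)
    (hg : LaplaceConvergent g s) (a b : ℝ) :
    LaplaceConvergent (fun τ => a * f τ + b * g τ) s ∧
      laplace (fun τ => a * f τ + b * g τ) s = a * laplace f s + b * laplace g s := by
  have h1 : IntegrableOn (fun τ => (a : ℂ) * laplaceIntegrand f s τ) (Ioi 0) := hf.const_mul _
  have h2 : IntegrableOn (fun τ => (b : ℂ) * laplaceIntegrand g s τ) (Ioi 0) := hg.const_mul _
  constructor
  · rw [LaplaceConvergent, laplaceIntegrand_lin]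
    exact h1.add h2
  · rw [laplace, laplaceIntegrand_lin, integral_add h1 h2, integral_const_mul, integral_const_mul]
    rfl

/-- Integration by parts with no term at 0 or ∞. The derivative need only have a convergent Laplace
integral, so the lemma covers a discontinuous ψ_b''. -/
theorem laplace_deriv (hs : 0 < s.re) (hf : ∀ τ, 0 ≤ τ → HasDerivWithinAt f (f' τ) (Ici 0) τ)
    (h0 : f 0 = 0) (hC : ∀ τ, 0 ≤ τ → |f τ| ≤ C * (1 + τ ^ 2)) (hf' : LaplaceConvergent f' s) :
    laplace f' s = s * laplace f s := by
  have hfc : ContinuousOn f (Ici 0) := fun τ hτ => (hf τ hτ).continuousWithinAt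
  have hfi : LaplaceConvergent f s := laplaceConvergent_of_le hs hfc.aestronglyMeasurable_Ioi hC
  have hfi' : IntegrableOn (fun τ => -s * laplaceIntegrand f s τ) (Ioi 0) := hfi.const_mul _
  have hd : ∀ τ ∈ Ioi (0 : ℝ), HasDerivAt (laplaceIntegrand f s)
      (-s * laplaceIntegrand f s τ + laplaceIntegrand f' s τ) τ := fun τ hτ => by
    have h1 : HasDerivAt f (f' τ) τ := (hf τ (le_of_lt hτ)).hasDerivAt (Ici_mem_nhds hτ)
    have h2 : HasDerivAt (fun τ : ℝ => Complex.exp (-s * τ)) (Complex.exp (-s * τ) * (-s)) τ := by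
      have : HasDerivAt (fun τ : ℝ => -s * (τ : ℂ)) (-s) τ := by
        simpa using (hasDerivAt_id τ).ofReal_comp.const_mul (-s)
      exact this.cexp
    refine (h2.mul h1.ofReal_comp).congr_deriv ?_
    simp only [laplaceIntegrand]
    ring
  have hcont : ContinuousWithinAt (laplaceIntegrand f s) (Ici 0) 0 :=
    (Continuous.continuousWithinAt (by fun_prop)).mul
      (Complex.continuous_ofReal.continuousAt.comp_continuousWithinAt (hfc 0 self_mem_Ici))
  have hlim : Tendsto (laplaceIntegrand f s) atTop (𝓝 0) := by
    have hlim0 := (tendsto_one_add_sq_mul_exp_neg hs).const_mul C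
    rw [mul_zero] at hlim0
    refine squeeze_zero_norm' ?_ hlim0
    filter_upwards [eventually_ge_atTop 0] with τ hτ
    exact norm_laplaceIntegrand_le hC hτ
  have key := integral_Ioi_of_hasDerivAt_of_tendsto hcont hd (hfi'.add hf') hlim
  rw [integral_add hfi' hf', integral_const_mul] at key
  simp only [laplaceIntegrand, h0, Complex.ofReal_zero, mul_zero, sub_zero] at key
  simp only [laplace, laplaceIntegrand]
  linear_combination key

theorem norm_laplace_le {M : ℝ} (hs : 0 < s.re) (hM : ∀ τ, 0 ≤ τ → |f τ| ≤ M) :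
    ‖laplace f s‖ ≤ M / s.re := by
  have hi : IntegrableOn (fun τ : ℝ => M * Real.exp (-s.re * τ)) (Ioi 0) :=
    (integrableOn_exp_mul_Ioi (neg_lt_zero.2 hs) 0).const_mul M
  refine (norm_integral_le_of_norm_le hi ?_).trans_eq ?_
  · filter_upwards [ae_restrict_mem measurableSet_Ioi] with τ hτ
    rw [norm_laplaceIntegrand, mul_comm]
    exact mul_le_mul_of_nonneg_right (hM τ (le_of_lt hτ)) (Real.exp_pos _).le
  · rw [integral_const_mul, integral_exp_mul_Ioi (neg_lt_zero.2 hs)]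
    simp
    ring

/-- Laplace inversion. -/
theorem laplace_inversion (hf : ContinuousOn f (Ici 0)) (h0 : f 0 = 0)
    (hC : ∀ τ, 0 ≤ τ → |f τ| ≤ C * (1 + τ ^ 2)) {γ : ℝ} (hγ : 0 < γ) {D : ℝ}
    (hD : ∀ ω : ℝ, ‖laplace f (γ + ω * Complex.I)‖ ≤ D * (1 + ω ^ 2)⁻¹) {F : ℂ → ℂ}
    (hF : ∀ ω : ℝ, F (γ + ω * Complex.I) = laplace f (γ + ω * Complex.I)) {τ : ℝ} (hτ : 0 ≤ τ) :
    Integrable (bromwichIntegrand γ F τ) ∧ (f τ : ℂ) = inverseLaplace γ F τ := by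
  -- The damped function e^{−γx} f(x), extended by 0 to x < 0. It is continuous because f(0) = 0,
  -- and its Fourier transform is the Laplace transform of f along Re s = γ; the quadratic decay
  -- makes that integrable, so pointwise Fourier inversion applies.
  set g : ℝ → ℂ := fun x => Complex.exp (-γ * x) * (extendIci f x : ℂ)
  have hre : ∀ ω : ℝ, ((γ : ℂ) + ω * Complex.I).re = γ := fun ω => by simp
  have hg0 : ∀ x, x ∉ Ioi (0 : ℝ) → extendIci f x = 0 := fun x hx => by
    rw [extendIci, max_eq_right (not_lt.1 hx), h0]
  have hgc : Continuous g := by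
    have := continuous_extendIci hf
    fun_prop
  have hgi : Integrable g := by
    have h1 : IntegrableOn g (Ioi 0) := by
      refine (laplaceConvergent_of_le (s := γ) (by simpa) hf.aestronglyMeasurable_Ioi hC).congr_fun
        (fun x hx => ?_) measurableSet_Ioi
      simp only [laplaceIntegrand, g, extendIci_of_nonneg f (le_of_lt hx)]
    refine (integrableOn_iff_integrable_of_support_subset fun x hx => ?_).1 h1
    by_contra h
    exact hx (by simp only [g, hg0 x h, Complex.ofReal_zero, mul_zero])
  have h𝓕 : ∀ w : ℝ, FourierTransform.fourier g w =
      laplace f (γ + (2 * Real.pi * w : ℝ) * Complex.I) := fun w => by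
    rw [Real.fourier_real_eq_integral_exp_smul, laplace,
      ← setIntegral_eq_integral_of_forall_compl_eq_zero (s := Ioi (0 : ℝ))]
    · refine setIntegral_congr_fun measurableSet_Ioi fun x hx => ?_
      simp only [g, laplaceIntegrand, extendIci_of_nonneg f (le_of_lt hx), smul_eq_mul]
      rw [← mul_assoc, ← Complex.exp_add]
      congr 2
      push_cast
      ring
    · intro x hx
      simp only [g, hg0 x hx, Complex.ofReal_zero, mul_zero, smul_zero]
  have h2π : (2 * Real.pi) ≠ 0 := by positivity
  have h𝓕c : Continuous (FourierTransform.fourier g) :=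
    VectorFourier.fourierIntegral_continuous Real.continuous_fourierChar (by fun_prop) hgi
  have hLc : Continuous fun ω : ℝ => laplace f (γ + ω * Complex.I) := by
    have : (fun ω : ℝ => laplace f (γ + ω * Complex.I)) =
        fun ω : ℝ => FourierTransform.fourier g (ω / (2 * Real.pi)) := by
      ext ω
      rw [h𝓕, mul_div_cancel₀ _ h2π]
    rw [this]
    fun_prop
  have hLi : Integrable fun ω : ℝ => laplace f (γ + ω * Complex.I) :=
    (integrable_inv_one_add_sq.const_mul D).mono' hLc.aestronglyMeasurable
      (Eventually.of_forall hD)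
  have h𝓕i : Integrable (FourierTransform.fourier g) := by
    have := hLi.comp_mul_left' h2π
    exact this.congr (Eventually.of_forall fun w => (h𝓕 w).symm)
  have hB : bromwichIntegrand γ F τ = fun ω : ℝ => Complex.exp ((γ + ω * Complex.I) * τ) *
      laplace f (γ + ω * Complex.I) := funext fun ω => by rw [bromwichIntegrand, hF]
  constructor
  · rw [hB]
    refine hLi.bdd_mul (c := Real.exp (γ * τ)) (Continuous.aestronglyMeasurable (by fun_prop))
      (Eventually.of_forall fun ω => ?_)
    rw [Complex.norm_exp]
    simp
  · have key := hgi.fourierInv_fourier_eq h𝓕i (hgc.continuousAt (x := τ))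
    rw [Real.fourierInv_eq'] at key
    have h1 : g τ = Complex.exp (-γ * τ) * (f τ : ℂ) := by
      simp only [g, extendIci_of_nonneg f hτ]
    have h2 : (f τ : ℂ) = Complex.exp (γ * τ) * g τ := by
      rw [h1, ← mul_assoc, ← Complex.exp_add]
      simp
    rw [h2, ← key, inverseLaplace, hB, ← integral_const_mul]
    have h3 := Measure.integral_comp_mul_left (fun ω : ℝ => Complex.exp ((γ + ω * Complex.I) * τ) *
      laplace f (γ + ω * Complex.I)) (2 * Real.pi)
    rw [abs_of_pos (by positivity), Complex.real_smul] at h3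
    have h4 : (1 : ℂ) / (2 * (Real.pi : ℂ)) = (((2 * Real.pi)⁻¹ : ℝ) : ℂ) := by
      push_cast; rw [one_div]
    rw [h4, ← h3]
    congr 1; ext w
    rw [h𝓕, smul_eq_mul, ← mul_assoc, ← Complex.exp_add]
    congr 2
    simp only [RCLike.inner_apply, conj_trivial]
    push_cast
    ring

end Growth

/-! ### The Laplace transform of the shoreline equation -/

section Shoreline

variable {σL M : ℝ} {ψb ψb' ψb'' : ℝ → ℝ}

theorem abs_le_mul_of_hasDerivWithinAt {f f' : ℝ → ℝ} {C T : ℝ} (hT : 0 ≤ T)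
    (hf : ∀ τ, 0 ≤ τ → HasDerivWithinAt f (f' τ) (Ici 0) τ) (h0 : f 0 = 0)
    (hC : ∀ τ ∈ Icc 0 T, |f' τ| ≤ C) : |f T| ≤ C * T := by
  have := (convex_Icc 0 T).norm_image_sub_le_of_norm_hasDerivWithin_le (f := f) (f' := f')
    (x := 0) (y := T) (fun τ hτ => (hf τ hτ.1).mono Icc_subset_Ici_self) hC
    (left_mem_Icc.2 hT) (right_mem_Icc.2 hT)
  rwa [h0, sub_zero, sub_zero, Real.norm_eq_abs, Real.norm_of_nonneg hT] at this

theorem IsBoundaryDatum.abs_deriv_le (h : IsBoundaryDatum ψb ψb' ψb'')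
    (hM : ∀ τ, 0 ≤ τ → |ψb'' τ| ≤ M) {τ : ℝ} (hτ : 0 ≤ τ) : |ψb' τ| ≤ M * τ :=
  abs_le_mul_of_hasDerivWithinAt hτ h.hasDeriv_two h.deriv_zero fun t ht => hM t ht.1

theorem IsBoundaryDatum.abs_le (h : IsBoundaryDatum ψb ψb' ψb'')
    (hM : ∀ τ, 0 ≤ τ → |ψb'' τ| ≤ M) {τ : ℝ} (hτ : 0 ≤ τ) : |ψb τ| ≤ M * τ * τ := by
  have hM0 : 0 ≤ M := (abs_nonneg _).trans (hM 0 le_rfl)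
  exact abs_le_mul_of_hasDerivWithinAt hτ h.hasDeriv_one h.zero fun t ht =>
    (h.abs_deriv_le hM ht.1).trans (mul_le_mul_of_nonneg_left ht.2 hM0)

theorem linear_le_quadratic {M τ : ℝ} (hM : 0 ≤ M) : M * τ ≤ M * (1 + τ ^ 2) :=
  mul_le_mul_of_nonneg_left (by nlinarith [sq_nonneg (τ - 1)]) hM

theorem square_le_quadratic {M τ : ℝ} (hM : 0 ≤ M) : M * τ * τ ≤ M * (1 + τ ^ 2) := by
  nlinarith

theorem IsBoundaryDatum.laplaceConvergent (h : IsBoundaryDatum ψb ψb' ψb'')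
    (hM : ∀ τ, 0 ≤ τ → |ψb'' τ| ≤ M) {s : ℂ} (hs : 0 < s.re) : LaplaceConvergent ψb s :=
  have hM0 : 0 ≤ M := (abs_nonneg _).trans (hM 0 le_rfl)
  laplaceConvergent_of_le hs h.continuousOn.aestronglyMeasurable_Ioi
    fun _ hτ => (h.abs_le hM hτ).trans (square_le_quadratic hM0)

theorem IsBoundaryDatum.laplace_deriv_eq (h : IsBoundaryDatum ψb ψb' ψb'')
    (hM : ∀ τ, 0 ≤ τ → |ψb'' τ| ≤ M) {s : ℂ} (hs : 0 < s.re) :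
    LaplaceConvergent ψb' s ∧ laplace ψb' s = s * laplace ψb s ∧
      laplace ψb'' s = s ^ 2 * laplace ψb s := by
  have hM0 : 0 ≤ M := (abs_nonneg _).trans (hM 0 le_rfl)
  have h1 : LaplaceConvergent ψb' s := laplaceConvergent_of_le hs
    h.continuousOn_deriv.aestronglyMeasurable_Ioi
    fun _ hτ => (h.abs_deriv_le hM hτ).trans (linear_le_quadratic hM0)
  have h2 : LaplaceConvergent ψb'' s := laplaceConvergent_of_le hs
    (h.aestronglyMeasurable.mono_set Ioi_subset_Ici_self) (C := M)
    fun τ hτ => (hM τ hτ).trans (by nlinarith [sq_nonneg τ])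
  have e1 := laplace_deriv hs h.hasDeriv_one h.zero
    (fun _ hτ => (h.abs_le hM hτ).trans (square_le_quadratic hM0)) h1
  have e2 := laplace_deriv hs h.hasDeriv_two h.deriv_zero
    (fun _ hτ => (h.abs_deriv_le hM hτ).trans (linear_le_quadratic hM0)) h2
  refine ⟨h1, e1, ?_⟩
  rw [e2, e1]
  ring

/-- One integration by parts gives c_n = b_n z, where z is the cosine convolution of ψ_b'. With w
the sine convolution, z' = ψ_b' − k w and w' = k z hold classically because ψ_b' is continuous. -/
theorem IsBoundaryDatum.laplace_modeCoeff (hσL : 0 < σL) (h : IsBoundaryDatum ψb ψb' ψb'')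
    (hM : ∀ τ, 0 ≤ τ → |ψb'' τ| ≤ M) {s : ℂ} (hs : 0 < s.re) (n : ℕ) :
    LaplaceConvergent (modeCoeff σL ψb'' n) s ∧
      laplace (modeCoeff σL ψb'' n) s =
        s ^ 2 * ((coeffB n : ℂ) / ((coeffA σL n : ℂ) + s ^ 2)) * laplace ψb s := by
  have hM0 : 0 ≤ M := (abs_nonneg _).trans (hM 0 le_rfl)
  have ha := coeffA_pos hσL n
  have hk := Real.sqrt_pos.2 ha
  have hk2 : √(coeffA σL n) ^ 2 = coeffA σL n := Real.sq_sqrt ha.le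
  set k := √(coeffA σL n) with hkdef
  have hfc := continuous_extendIci h.continuousOn_deriv
  set f := extendIci ψb' with hfdef
  have hf : ∀ τ, 0 ≤ τ → ψb' τ = f τ := fun τ hτ => (extendIci_of_nonneg ψb' hτ).symm
  have hfle : ∀ τ, 0 ≤ τ → |f τ| ≤ M * τ := fun τ hτ => by
    rw [← hf τ hτ]; exact h.abs_deriv_le hM hτ
  have hz : ∀ τ, 0 ≤ τ → sinConv k ψb'' τ = k * cosConv k f τ := fun τ hτ => by
    rw [(h.sinConv_deriv hτ (fun t ht => hM t ht.1) k).1]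
    congr 1
    refine intervalIntegral.integral_congr fun ξ hξ => ?_
    rw [uIcc_of_le hτ] at hξ
    simp only [hf ξ hξ.1]
  have hzle : ∀ τ, 0 ≤ τ → |cosConv k f τ| ≤ M / k * (1 + τ ^ 2) := fun τ hτ => by
    have h1 := abs_sinConv_le (k := k) hτ fun t ht => hM t ht.1
    rw [hz τ hτ, abs_mul, abs_of_pos hk] at h1
    have h2 : |cosConv k f τ| ≤ M / k * τ := by
      rw [div_mul_eq_mul_div, le_div_iff₀ hk]
      linarith
    exact h2.trans (linear_le_quadratic (by positivity))
  have hwle : ∀ τ, 0 ≤ τ → |sinConv k f τ| ≤ M * (1 + τ ^ 2) := fun τ hτ =>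
    (abs_sinConv_le hτ fun t ht => (hfle t ht.1).trans
      (mul_le_mul_of_nonneg_left ht.2 hM0)).trans (square_le_quadratic hM0)
  have hdz := hasDerivAt_cosConv k hfc
  have hdw := hasDerivAt_sinConv k hfc
  have hzc : Continuous (cosConv k f) :=
    continuous_iff_continuousAt.2 fun x => (hdz x).continuousAt
  have hLz : LaplaceConvergent (cosConv k f) s :=
    laplaceConvergent_of_le hs hzc.continuousOn.aestronglyMeasurable_Ioi hzle
  have hLw : LaplaceConvergent (sinConv k f) s :=
    laplaceConvergent_of_le hs (continuous_sinConv k hfc).continuousOn.aestronglyMeasurable_Ioi hwle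
  obtain ⟨h1, h2, -⟩ := h.laplace_deriv_eq hM hs
  have hLf : LaplaceConvergent f s := laplaceConvergent_congr hf h1
  have e1 := hLf.lin hLw 1 (-k)
  have e2 := hLz.lin hLz k 0
  have e3 := laplace_deriv (f := cosConv k f) (f' := fun τ => 1 * f τ + -k * sinConv k f τ) hs
    (fun τ _ => ((hdz τ).congr_deriv (by ring)).hasDerivWithinAt) (by simp [cosConv]) hzle e1.1
  have e4 := laplace_deriv (f := sinConv k f) (f' := fun τ => k * cosConv k f τ + 0 * cosConv k f τ)
    hs (fun τ _ => ((hdw τ).congr_deriv (by ring)).hasDerivWithinAt) (by simp [sinConv]) hwle e2.1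
  rw [e1.2, ← laplace_congr hf, h2] at e3
  rw [e2.2] at e4
  have hc : ∀ τ, 0 ≤ τ → coeffB n * cosConv k f τ + 0 * cosConv k f τ = modeCoeff σL ψb'' n τ :=
    fun τ hτ => by
      rw [modeCoeff_eq_sinConv, ← hkdef, hz τ hτ]
      field_simp
      ring
  have e5 := hLz.lin hLz (coeffB n) 0
  refine ⟨laplaceConvergent_congr hc e5.1, ?_⟩
  rw [← laplace_congr hc, e5.2]
  have hne := coeffA_add_sq_ne_zero hσL n hs
  have hs0 : s ≠ 0 := fun h => by simp [h] at hs
  have hk2' : ((k : ℝ) : ℂ) ^ 2 = (coeffA σL n : ℂ) := by exact_mod_cast congrArg Complex.ofReal hk2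
  -- Eliminate ℒw from s ℒz = s ℒψ_b − k ℒw and s ℒw = k ℒz, with k² = a_n.
  have e6 : (s ^ 2 + coeffA σL n) * laplace (cosConv k f) s = s ^ 2 * laplace ψb s := by
    rw [← hk2']
    push_cast at e3 e4
    linear_combination (-s) * e3 + k * e4
  field_simp
  push_cast
  linear_combination (coeffB n : ℂ) * e6

theorem IsBoundaryDatum.continuousOn_modeCoeff_Ici (hσL : 0 < σL)
    (h : IsBoundaryDatum ψb ψb' ψb'') (hM : ∀ τ, 0 ≤ τ → |ψb'' τ| ≤ M) (n : ℕ) :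
    ContinuousOn (modeCoeff σL ψb'' n) (Ici 0) := fun τ hτ => by
  have hτ : (0 : ℝ) ≤ τ := hτ
  have := h.continuousOn_modeCoeff hσL (T := τ + 1) (fun t ht => hM t ht.1) n τ ⟨hτ, by linarith⟩
  refine this.mono_of_mem_nhdsWithin ?_
  rw [← Ici_inter_Iic]
  exact inter_mem self_mem_nhdsWithin (mem_nhdsWithin_of_mem_nhds (Iic_mem_nhds (by linarith)))

theorem abs_modeCoeff_le_quadratic {f : ℝ → ℝ} (hM : ∀ τ, 0 ≤ τ → |f τ| ≤ M) {τ : ℝ} (hτ : 0 ≤ τ)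
    (n : ℕ) : |modeCoeff σL f n τ| ≤ |coeffB n| / √(coeffA σL n) * (M * (1 + τ ^ 2)) := by
  have hM0 : 0 ≤ M := (abs_nonneg _).trans (hM 0 le_rfl)
  exact (abs_modeCoeff_le hτ (fun t ht => hM t ht.1) n).trans
    (mul_le_mul_of_nonneg_left (linear_le_quadratic hM0) (by positivity))

/-- Dominated convergence: each c_n is at most |b_n|/√a_n times M(1 + τ²), a summable factor times
one that e^{−τ Re s} makes integrable. -/
theorem IsBoundaryDatum.hasSum_laplace_modeCoeff (hσL : 0 < σL)
    (h : IsBoundaryDatum ψb ψb' ψb'') (hM : ∀ τ, 0 ≤ τ → |ψb'' τ| ≤ M) {ψsh : ℝ → ℝ}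
    (hsh : ShorelineEquation σL ψb ψb'' ψsh) {s : ℂ} (hs : 0 < s.re) :
    LaplaceConvergent ψsh s ∧
      HasSum (fun n => laplace (modeCoeff σL ψb'' n) s) (laplace ψsh s - laplace ψb s) := by
  have hM0 : 0 ≤ M := (abs_nonneg _).trans (hM 0 le_rfl)
  set S : ℝ → ℝ := fun τ => ∑' n, modeCoeff σL ψb'' n τ
  have hS : ∀ τ, 0 ≤ τ → 1 * S τ + 1 * ψb τ = ψsh τ := fun τ hτ => by
    have := (hsh τ hτ).tsum_eq
    simp only [S]
    rw [this]; ring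
  have hmeas : ∀ n, AEStronglyMeasurable (modeCoeff σL ψb'' n) (volume.restrict (Ioi 0)) :=
    fun n => (h.continuousOn_modeCoeff_Ici hσL hM n).aestronglyMeasurable_Ioi
  have hSmeas : AEStronglyMeasurable S (volume.restrict (Ioi 0)) := by
    refine aestronglyMeasurable_of_tendsto_ae atTop
      (f := fun N τ => ∑ n ∈ Finset.range N, modeCoeff σL ψb'' n τ)
      (fun N => Finset.aestronglyMeasurable_fun_sum _ fun n _ => hmeas n) ?_
    filter_upwards [ae_restrict_mem measurableSet_Ioi] with τ hτ
    exact ((hsh τ (le_of_lt hτ)).summable.hasSum).tendsto_sum_nat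
  have hsum := summable_abs_coeffB_div_sqrt σL
  have hSle : ∀ τ, 0 ≤ τ → |S τ| ≤ (∑' n, |coeffB n| / √(coeffA σL n)) * M * (1 + τ ^ 2) :=
    fun τ hτ => by
      rw [mul_assoc, ← tsum_mul_right]
      exact tsum_of_norm_bounded (f := fun n => modeCoeff σL ψb'' n τ) (hsum.mul_right _).hasSum
        fun n => abs_modeCoeff_le_quadratic hM hτ n
  have hLS : LaplaceConvergent S s := laplaceConvergent_of_le hs hSmeas hSle
  have hLb := h.laplaceConvergent hM hs
  have e := hLS.lin hLb 1 1
  refine ⟨laplaceConvergent_congr hS e.1, ?_⟩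
  have e2 : laplace ψsh s - laplace ψb s = laplace S s := by
    rw [← laplace_congr hS, e.2]; push_cast; ring
  rw [e2]
  refine hasSum_integral_of_dominated_convergence
    (fun n τ => |coeffB n| / √(coeffA σL n) * (M * ((1 + τ ^ 2) * Real.exp (-s.re * τ))))
    (fun n => aestronglyMeasurable_laplaceIntegrand (hmeas n)) (fun n => ?_)
    (Eventually.of_forall fun τ => hsum.mul_right _) ?_ ?_
  · filter_upwards [ae_restrict_mem measurableSet_Ioi] with τ hτ
    refine (norm_laplaceIntegrand_le (fun t ht => (abs_modeCoeff_le_quadratic hM ht n).trans_eq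
      (mul_assoc _ _ _).symm) (le_of_lt hτ)).trans_eq (by ring)
  · simp_rw [tsum_mul_right]
    exact ((integrableOn_one_add_sq_mul_exp_neg hs).const_mul M).const_mul _
  · filter_upwards [ae_restrict_mem measurableSet_Ioi] with τ hτ
    have h1 : HasSum (fun n => modeCoeff σL ψb'' n τ) (S τ) :=
      (hsh τ (le_of_lt hτ)).summable.hasSum
    exact (Complex.hasSum_ofReal.2 h1).mul_left (Complex.exp (-s * τ))

theorem IsBoundaryDatum.laplace_shoreline (hσL : 0 < σL)
    (h : IsBoundaryDatum ψb ψb' ψb'') (hM : ∀ τ, 0 ≤ τ → |ψb'' τ| ≤ M) {ψsh : ℝ → ℝ}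
    (hsh : ShorelineEquation σL ψb ψb'' ψsh) {s : ℂ} (hs : 0 < s.re) :
    laplace ψsh s = laplace ψb s * transferFactor σL s ∧ transferFactor σL s ≠ 0 := by
  obtain ⟨h1, h2⟩ := transferFactor_eq hσL hs
  refine ⟨?_, by rw [h2]; exact inv_ne_zero h1⟩
  have h3 := (h.hasSum_laplace_modeCoeff hσL hM hsh hs).2
  simp_rw [fun n => (h.laplace_modeCoeff hσL hM hs n).2] at h3
  have h4 := ((summable_coeffB_div_coeffA_add_sq hσL s).of_norm.hasSum.mul_left
    (s ^ 2)).mul_right (laplace ψb s)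
  have h5 := h3.unique h4
  rw [transferFactor]
  linear_combination h5

/-- Recovery of the boundary datum from the shoreline values. -/
theorem IsBoundaryDatum.inversion (hσL : 0 < σL)
    (h : IsBoundaryDatum ψb ψb' ψb'') (hM : ∀ τ, 0 ≤ τ → |ψb'' τ| ≤ M) {ψsh : ℝ → ℝ}
    (hsh : ShorelineEquation σL ψb ψb'' ψsh) {γ : ℝ} (hγ : 0 < γ) {τ : ℝ} (hτ : 0 ≤ τ) :
    Integrable (bromwichIntegrand γ (fun s => laplace ψsh s * (transferFactor σL s)⁻¹) τ) ∧
      (ψb τ : ℂ) = inverseLaplace γ (fun s => laplace ψsh s * (transferFactor σL s)⁻¹) τ := by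
  have hM0 : 0 ≤ M := (abs_nonneg _).trans (hM 0 le_rfl)
  have hre : ∀ ω : ℝ, ((γ : ℂ) + ω * Complex.I).re = γ := fun ω => by simp
  refine laplace_inversion h.continuousOn h.zero (C := M)
    (fun τ hτ => (h.abs_le hM hτ).trans (square_le_quadratic hM0)) hγ
    -- On Re s = γ the identity s²ℒψ_b = ℒψ_b'' gives |ℒψ_b| ≤ M/(γ(γ² + ω²)), and 1 + ω² ≤ (1 +
    -- γ⁻²)(γ² + ω²).
    (D := M / γ * (1 + (γ ^ 2)⁻¹)) (fun ω => ?_) (fun ω => ?_) hτ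
  · have hs : 0 < ((γ : ℂ) + ω * Complex.I).re := by rw [hre]; exact hγ
    set s : ℂ := γ + ω * Complex.I with hsdef
    have h1 := norm_laplace_le hs hM
    rw [(h.laplace_deriv_eq hM hs).2.2, norm_mul, norm_pow, hre] at h1
    have h2 : ‖s‖ ^ 2 = γ ^ 2 + ω ^ 2 := by
      rw [hsdef, ← Complex.normSq_eq_norm_sq, Complex.normSq_add_mul_I]
    rw [h2] at h1
    have h3 : 1 + ω ^ 2 ≤ (1 + (γ ^ 2)⁻¹) * (γ ^ 2 + ω ^ 2) := by
      have : (γ ^ 2)⁻¹ * γ ^ 2 = 1 := inv_mul_cancel₀ (by positivity)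
      have : 0 ≤ (γ ^ 2)⁻¹ * ω ^ 2 := by positivity
      nlinarith [sq_nonneg γ]
    rw [← div_eq_mul_inv, le_div_iff₀ (by positivity)]
    calc ‖laplace ψb s‖ * (1 + ω ^ 2)
        ≤ ‖laplace ψb s‖ * ((1 + (γ ^ 2)⁻¹) * (γ ^ 2 + ω ^ 2)) := by gcongr
      _ = (γ ^ 2 + ω ^ 2) * ‖laplace ψb s‖ * (1 + (γ ^ 2)⁻¹) := by ring
      _ ≤ _ := by gcongr
  · obtain ⟨h1, h2⟩ := h.laplace_shoreline hσL hM hsh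
      (s := γ + ω * Complex.I) (by rw [hre]; exact hγ)
    rw [h1, mul_inv_cancel_right₀ h2]

end Shoreline

/-! ### The Carrier-Greenspan transform -/

section Wave

variable {σL : ℝ} {R R' X : ℝ → ℝ} {u η φ ψ : ℝ → ℝ → ℝ}

/-- The inverse of the Carrier-Greenspan map in terms of the transformed unknowns. -/
def carrierGreenspanInv (φ ψ : ℝ → ℝ → ℝ) (q : ℝ × ℝ) : ℝ × ℝ :=
  (q.1 - ψ q.1 q.2 + φ q.1 q.2 ^ 2 / 2, q.2 + φ q.1 q.2)

/-- The four chain-rule relations form a linear system for the derivatives of φ and ψ, with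
determinant the Jacobian of the Carrier–Greenspan map. Cramer's rule (`j1` to `j4`) combined with
the shallow water equations gives the linear system times that Jacobian. -/
theorem hodograph_algebra {ux ut hx ht fs ft gs gt U σ : ℝ} (e1 : ux = (1 + hx) * fs - ux * ft)
    (e2 : ut = ht * fs + (1 - ut) * ft) (e3 : hx + U * ux = (1 + hx) * gs - ux * gt)
    (e4 : ht + U * ut = ht * gs + (1 - ut) * gt) (hm : ht + U * (1 + hx) + σ * ux = 0)
    (hmo : ut + U * ux + hx = 0) : gt + σ * fs + U = 0 ∧ ft + gs = 0 := by
  have j1 : fs * ((1 + hx) * (1 - ut) + ht * ux) = ux := by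
    linear_combination -(1 - ut) * e1 - ux * e2
  have j2 : ft * ((1 + hx) * (1 - ut) + ht * ux) = (1 + hx) * ut - ht * ux := by
    linear_combination ht * e1 - (1 + hx) * e2
  have j3 : gs * ((1 + hx) * (1 - ut) + ht * ux) = hx * (1 - ut) + U * ux + ht * ux := by
    linear_combination -(1 - ut) * e3 - ux * e4
  have j4 : gt * ((1 + hx) * (1 - ut) + ht * ux) = ht + U * ut + hx * U * ut - U * ht * ux := by
    linear_combination ht * e3 - (1 + hx) * e4
  -- Nondegeneracy follows from the relations themselves: a zero Jacobian forces 1 + η_x = 0, u_t =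
  -- 1 and η_t = 0, and then the second relation reads 1 = 0.
  have hJ : (1 + hx) * (1 - ut) + ht * ux ≠ 0 := fun hJ => by
    rw [hJ, mul_zero] at j1 j2 j3 j4
    have a1 : 1 + hx = 0 := by linear_combination hJ - j2
    have a2 : ut = 1 := by
      linear_combination -j3 - (1 - ut) * a1 + (U + ht) * j1
    have a3 : ht = 0 := by
      linear_combination -j4 - U * ut * a1 - U * ht * j1
    rw [a2, a3] at e2
    linarith
  constructor
  · refine (mul_eq_zero.1 (?_ : _ * ((1 + hx) * (1 - ut) + ht * ux) = 0)).resolve_right hJ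
    linear_combination j4 + σ * j1 + hm
  · refine (mul_eq_zero.1 (?_ : _ * ((1 + hx) * (1 - ut) + ht * ux) = 0)).resolve_right hJ
    linear_combination j2 + j3 + hmo

namespace IsNonbreakingWave

theorem inv_carrierGreenspan (h : IsNonbreakingWave σL R R' X u η φ ψ) {p : ℝ × ℝ}
    (hp : p ∈ wetRegion R X) : carrierGreenspanInv φ ψ (carrierGreenspan u η p) = p := by
  obtain ⟨x, t⟩ := p
  simp only [carrierGreenspanInv, carrierGreenspan, h.phi_eq x t hp, h.psi_eq x t hp]
  ext
  · simp only
    ring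
  · simp only
    ring

theorem carrierGreenspan_inv (h : IsNonbreakingWave σL R R' X u η φ ψ) {q : ℝ × ℝ}
    (hq : q ∈ Icc 0 σL ×ˢ Ici (0 : ℝ)) : carrierGreenspanInv φ ψ q ∈ wetRegion R X ∧
      carrierGreenspan u η (carrierGreenspanInv φ ψ q) = q := by
  obtain ⟨p, hp, rfl⟩ := h.bijOn.surjOn hq
  rw [h.inv_carrierGreenspan hp]
  exact ⟨hp, rfl⟩

theorem shore_mem (h : IsNonbreakingWave σL R R' X u η φ ψ) {t : ℝ} (ht : 0 ≤ t) :
    (-R t, t) ∈ wetRegion R X := ⟨ht, le_rfl, (h.shore_lt_right t ht).le⟩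

theorem carrierGreenspan_shore (h : IsNonbreakingWave σL R R' X u η φ ψ) {t : ℝ} (ht : 0 ≤ t) :
    carrierGreenspan u η (-R t, t) = (0, t + R' t) := by
  simp [carrierGreenspan, h.shore_eta t ht, h.shore_u t ht]

theorem right_zero (h : IsNonbreakingWave σL R R' X u η φ ψ) : X 0 = σL := by
  have h0 := h.shore_lt_right 0 le_rfl
  rw [h.init_runup, neg_zero] at h0
  have h1 := h.right_sigma 0 le_rfl
  rwa [h.init_eta (X 0) (right_mem_Icc.2 h0.le), add_zero] at h1

theorem init_mem (h : IsNonbreakingWave σL R R' X u η φ ψ) {x : ℝ} (hx : x ∈ Icc 0 σL) :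
    (x, 0) ∈ wetRegion R X := by
  refine ⟨le_rfl, ?_, ?_⟩
  · simpa [h.init_runup] using hx.1
  · simpa [h.right_zero] using hx.2

theorem init_phi_psi (h : IsNonbreakingWave σL R R' X u η φ ψ) {x : ℝ} (hx : x ∈ Icc 0 σL) :
    φ x 0 = 0 ∧ ψ x 0 = 0 := by
  have hx' : x ∈ Icc 0 (X 0) := by rwa [h.right_zero]
  have h1 := h.phi_eq x 0 (h.init_mem hx)
  have h2 := h.psi_eq x 0 (h.init_mem hx)
  simp only [h.init_u x hx', h.init_eta x hx', add_zero, sub_zero] at h1 h2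
  exact ⟨h1, by rw [h2]; ring⟩

/-- The three boundary pieces of the wet region are sent to the boundary: t = 0 to τ = 0, the
shoreline to σ = 0, the right end to σ = σ_L. -/
theorem mem_interior_of_mem (h : IsNonbreakingWave σL R R' X u η φ ψ) {x t : ℝ}
    (hp : (x, t) ∈ wetRegion R X)
    (hq : carrierGreenspan u η (x, t) ∈ Ioo 0 σL ×ˢ Ioi (0 : ℝ)) :
    0 < t ∧ x ∈ Ioo (-R t) (X t) := by
  obtain ⟨ht, hx1, hx2⟩ := hp
  simp only at ht hx1 hx2
  obtain ⟨⟨hq1, hq2⟩, hq3⟩ := hq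
  simp only [carrierGreenspan, mem_Ioi] at hq1 hq2 hq3
  refine ⟨ht.lt_of_ne' fun h0 => ?_, hx1.lt_of_ne fun h0 => ?_, hx2.lt_of_ne fun h0 => ?_⟩
  · subst h0
    rw [h.init_runup, neg_zero] at hx1
    rw [h.init_u x ⟨hx1, hx2⟩] at hq3
    simp at hq3
  · rw [← h0, h.shore_eta t ht] at hq1
    simp at hq1
  · rw [h0, h.right_sigma t ht] at hq2
    exact lt_irrefl _ hq2

theorem eventually_mem (h : IsNonbreakingWave σL R R' X u η φ ψ) {x t : ℝ} (ht : 0 < t)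
    (hx : x ∈ Ioo (-R t) (X t)) : ∀ᶠ p in 𝓝 (x, t), p ∈ wetRegion R X := by
  have hR : ContinuousAt (fun p : ℝ × ℝ => R p.2) (x, t) :=
    ContinuousAt.comp (f := fun p : ℝ × ℝ => p.2) (g := R)
      ((h.hasDeriv_runup t ht.le).hasDerivAt (Ici_mem_nhds ht)).continuousAt continuousAt_snd
  have hX : ContinuousAt (fun p : ℝ × ℝ => X p.2) (x, t) :=
    ContinuousAt.comp (f := fun p : ℝ × ℝ => p.2) (g := X)
      (h.continuousOn_right.continuousAt (Ici_mem_nhds ht)) continuousAt_snd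
  have h1 : ContinuousAt (fun p : ℝ × ℝ => p.1) (x, t) := continuousAt_fst
  have h2 : ContinuousAt (fun p : ℝ × ℝ => p.2) (x, t) := continuousAt_snd
  filter_upwards [h2.eventually_const_lt ht, hR.neg.eventually_lt h1 hx.1,
    h1.eventually_lt hX hx.2] with p hp1 hp2 hp3
  exact ⟨hp1.le, hp2.le, hp3.le⟩

/-- The linear hodograph system. -/
theorem hodograph (h : IsNonbreakingWave σL R R' X u η φ ψ) {σ τ : ℝ}
    (hq : (σ, τ) ∈ Ioo 0 σL ×ˢ Ioi (0 : ℝ)) :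
    fderiv ℝ (fun p : ℝ × ℝ => ψ p.1 p.2) (σ, τ) (0, 1) +
        σ * fderiv ℝ (fun p : ℝ × ℝ => φ p.1 p.2) (σ, τ) (1, 0) + φ σ τ = 0 ∧
      fderiv ℝ (fun p : ℝ × ℝ => φ p.1 p.2) (σ, τ) (0, 1) +
        fderiv ℝ (fun p : ℝ × ℝ => ψ p.1 p.2) (σ, τ) (1, 0) = 0 := by
  have hU := isOpen_Ioo_prod_Ioi σL
  have hΦ := h.contDiffOn_two_phi.hasFDerivAt_of_isOpen hU hq
  have hΨ := h.contDiffOn_two_psi.hasFDerivAt_of_isOpen hU hq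
  obtain ⟨⟨x, t⟩, hp, hpq⟩ := h.bijOn.surjOn
    (show (σ, τ) ∈ Icc 0 σL ×ˢ Ici (0 : ℝ) from ⟨Ioo_subset_Icc_self hq.1, Ioi_subset_Ici_self hq.2⟩)
  have hq' := hq
  rw [← hpq] at hq'
  obtain ⟨ht, hx⟩ := h.mem_interior_of_mem hp hq'
  have hev := h.eventually_mem ht hx
  have hu := (h.differentiableAt_u t ht x hx).hasFDerivAt
  have hη := (h.differentiableAt_eta t ht x hx).hasFDerivAt
  set u' := fderiv ℝ (fun p : ℝ × ℝ => u p.1 p.2) (x, t)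
  set η' := fderiv ℝ (fun p : ℝ × ℝ => η p.1 p.2) (x, t)
  set Φ' := fderiv ℝ (fun p : ℝ × ℝ => φ p.1 p.2) (σ, τ)
  set Ψ' := fderiv ℝ (fun p : ℝ × ℝ => ψ p.1 p.2) (σ, τ)
  have hcg : HasFDerivAt (carrierGreenspan u η)
      ((ContinuousLinearMap.fst ℝ ℝ ℝ + η').prod (ContinuousLinearMap.snd ℝ ℝ ℝ - u')) (x, t) :=
    (hasFDerivAt_fst.add hη).prodMk (hasFDerivAt_snd.sub hu)
  rw [← hpq] at hΦ hΨ
  -- The relations defining φ and ψ hold in a neighbourhood of (x,t), so they may be differentiated;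
  -- uniqueness of the derivative yields the four chain-rule relations.
  have hΦu : HasFDerivAt (fun p : ℝ × ℝ => u p.1 p.2) _ (x, t) :=
    (hΦ.comp (x, t) hcg).congr_of_eventuallyEq
      (by filter_upwards [hev] with p hp using (h.phi_eq p.1 p.2 hp).symm)
  have hΨη : HasFDerivAt (fun p : ℝ × ℝ => η p.1 p.2 + u p.1 p.2 ^ 2 / 2) _ (x, t) :=
    (hΨ.comp (x, t) hcg).congr_of_eventuallyEq
      (by filter_upwards [hev] with p hp using (h.psi_eq p.1 p.2 hp).symm)
  have eφ := hu.unique hΦu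
  have hΨ2 : HasFDerivAt (fun p : ℝ × ℝ => η p.1 p.2 + u p.1 p.2 ^ 2 / 2) (η' + u x t • u') (x, t) := by
    have h1 : HasFDerivAt (fun p : ℝ × ℝ => u p.1 p.2 ^ 2 / 2) (u x t • u') (x, t) := by
      have h2 : HasDerivAt (fun y : ℝ => y ^ 2 / 2) (u x t) (u x t) := by
        refine ((hasDerivAt_pow 2 (u x t)).div_const 2).congr_deriv ?_
        ring
      exact h2.comp_hasFDerivAt (x, t) hu
    exact hη.add h1
  have eψ := hΨ2.unique hΨη
  have ev : ∀ (Λ : ℝ × ℝ →L[ℝ] ℝ) (a b : ℝ), Λ (a, b) = a * Λ (1, 0) + b * Λ (0, 1) :=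
    fun Λ a b => by
      rw [← smul_eq_mul, ← smul_eq_mul, ← map_smul, ← map_smul, ← map_add]
      simp
  have e1 := DFunLike.congr_fun eφ (1, 0)
  have e2 := DFunLike.congr_fun eφ (0, 1)
  have e3 := DFunLike.congr_fun eψ (1, 0)
  have e4 := DFunLike.congr_fun eψ (0, 1)
  simp only [ContinuousLinearMap.comp_apply, ContinuousLinearMap.prod_apply,
    add_apply, sub_apply, ContinuousLinearMap.coe_fst',
    ContinuousLinearMap.coe_snd', smul_apply, smul_eq_mul] at e1 e2 e3 e4
  rw [ev Φ'] at e1 e2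
  rw [ev Ψ'] at e3 e4
  have hux := hu.hasDerivAt_fst.deriv
  have hut := hu.hasDerivAt_snd.deriv
  have hηx := hη.hasDerivAt_fst
  have hηt := hη.hasDerivAt_snd.deriv
  have hm := h.mass t ht x hx
  have hmo := h.momentum t ht x hx
  have hid : deriv (fun y => y + η y t) x = 1 + η' (1, 0) := ((hasDerivAt_id x).add hηx).deriv
  rw [hid, hux, hηt] at hm
  rw [hux, hut, hηx.deriv] at hmo
  have hφu := h.phi_eq x t hp
  have hσ : x + η x t = σ := congrArg Prod.fst hpq
  have hτ : t - u x t = τ := congrArg Prod.snd hpq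
  rw [hσ, hτ] at hφu
  rw [hσ] at hm
  rw [hφu]
  exact hodograph_algebra (by linarith) (by linarith) (by linarith) (by linarith) hm hmo

end IsNonbreakingWave

end Wave

namespace IsNonbreakingWave

variable {σL : ℝ} {R R' X : ℝ → ℝ} {u η φ ψ : ℝ → ℝ → ℝ}

theorem hodograph_deriv (h : IsNonbreakingWave σL R R' X u η φ ψ) {σ τ : ℝ}
    (hσ : σ ∈ Ioo 0 σL) (hτ : τ ∈ Ioi (0 : ℝ)) :
    deriv (fun t => ψ σ t) τ + σ * deriv (fun y => φ y τ) σ + φ σ τ = 0 ∧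
      deriv (fun t => φ σ t) τ + deriv (fun y => ψ y τ) σ = 0 := by
  have hq : (σ, τ) ∈ Ioo 0 σL ×ˢ Ioi (0 : ℝ) := ⟨hσ, hτ⟩
  have hU := isOpen_Ioo_prod_Ioi σL
  have hΦ := h.contDiffOn_two_phi.hasFDerivAt_of_isOpen hU hq
  have hΨ := h.contDiffOn_two_psi.hasFDerivAt_of_isOpen hU hq
  rw [hΨ.hasDerivAt_snd.deriv, hΨ.hasDerivAt_fst.deriv, hΦ.hasDerivAt_snd.deriv,
    hΦ.hasDerivAt_fst.deriv]
  exact h.hodograph hq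

/-- Differentiate the first hodograph equation in τ and the second in σ, and eliminate φ by equality
of mixed derivatives. -/
theorem wave_equation (h : IsNonbreakingWave σL R R' X u η φ ψ) {σ τ : ℝ}
    (hσ : σ ∈ Ioo 0 σL) (hτ : τ ∈ Ioi (0 : ℝ)) :
    iteratedDeriv 2 (fun t => ψ σ t) τ =
      σ * iteratedDeriv 2 (fun y => ψ y τ) σ + deriv (fun y => ψ y τ) σ := by
  have hq : (σ, τ) ∈ Ioo 0 σL ×ˢ Ioi (0 : ℝ) := ⟨hσ, hτ⟩
  have hU := isOpen_Ioo_prod_Ioi σL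
  have hΦ2 := h.contDiffOn_two_phi
  have hΨ2 := h.contDiffOn_two_psi
  have hmem := hU.mem_nhds hq
  set Φ : ℝ × ℝ → ℝ := fun p => φ p.1 p.2
  set Ψ : ℝ × ℝ → ℝ := fun p => ψ p.1 p.2
  have d1 := deriv_eq_fderiv_snd hΨ2 hU hq
  have d2 := deriv_eq_fderiv_fst hΨ2 hU hq
  change iteratedDeriv 2 (fun t => Ψ (σ, t)) τ =
    σ * iteratedDeriv 2 (fun y => Ψ (y, τ)) σ + deriv (fun y => Ψ (y, τ)) σ
  rw [d1.2, d2.2, d2.1]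
  have e1 : HasDerivAt (fun t => fderiv ℝ Ψ (σ, t) (0, 1))
      (fderiv ℝ (fun p => fderiv ℝ Ψ p (0, 1)) (σ, τ) (0, 1)) τ :=
    (hΨ2.hasFDerivAt_fderiv_apply hU (0, 1) hq).hasDerivAt_snd
  have e2 : HasDerivAt (fun t => -(σ * fderiv ℝ Φ (σ, t) (1, 0)) - Φ (σ, t))
      (-(σ * fderiv ℝ (fun p => fderiv ℝ Φ p (1, 0)) (σ, τ) (0, 1)) - fderiv ℝ Φ (σ, τ) (0, 1)) τ :=
    (((hΦ2.hasFDerivAt_fderiv_apply hU (1, 0) hq).hasDerivAt_snd.const_mul σ).neg).sub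
      (hΦ2.hasFDerivAt_of_isOpen hU hq).hasDerivAt_snd
  have ev2 : ∀ᶠ t in 𝓝 τ, (σ, t) ∈ Ioo 0 σL ×ˢ Ioi (0 : ℝ) :=
    Filter.mem_of_superset (Ioi_mem_nhds (mem_Ioi.1 hτ)) fun t ht => ⟨hσ, ht⟩
  have ev1 : ∀ᶠ y in 𝓝 σ, (y, τ) ∈ Ioo 0 σL ×ˢ Ioi (0 : ℝ) :=
    Filter.mem_of_superset (Ioo_mem_nhds hσ.1 hσ.2) fun y hy => ⟨hy, hτ⟩
  have e3 := e1.unique (e2.congr_of_eventuallyEq (by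
    filter_upwards [ev2] with t ht
    linarith [(h.hodograph ht).1]))
  have e4 : HasDerivAt (fun y => fderiv ℝ Φ (y, τ) (0, 1))
      (fderiv ℝ (fun p => fderiv ℝ Φ p (0, 1)) (σ, τ) (1, 0)) σ :=
    (hΦ2.hasFDerivAt_fderiv_apply hU (0, 1) hq).hasDerivAt_fst
  have e5 : HasDerivAt (fun y => -fderiv ℝ Ψ (y, τ) (1, 0))
      (-fderiv ℝ (fun p => fderiv ℝ Ψ p (1, 0)) (σ, τ) (1, 0)) σ :=
    (hΨ2.hasFDerivAt_fderiv_apply hU (1, 0) hq).hasDerivAt_fst.neg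
  have e6 := e4.unique (e5.congr_of_eventuallyEq (by
    filter_upwards [ev1] with y hy
    linarith [(h.hodograph hy).2]))
  rw [e3, hΦ2.fderiv_fderiv_comm hU (1, 0) (0, 1) hq, e6]
  linarith [(h.hodograph hq).2]

/-- For τ > 0 one has ψ_τ = −σφ_σ − φ. The C¹ regularity up to τ = 0 lets τ tend to 0, where φ
vanishes identically in σ. -/
theorem init_velocity (h : IsNonbreakingWave σL R R' X u η φ ψ) {σ : ℝ} (hσ : σ ∈ Ioo 0 σL) :
    HasDerivWithinAt (fun t => ψ σ t) 0 (Ici 0) 0 := by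
  set Φ : ℝ × ℝ → ℝ := fun p => φ p.1 p.2
  set Ψ : ℝ × ℝ → ℝ := fun p => ψ p.1 p.2
  have hu := uniqueDiffOn_Ioo_prod_Ici σL
  have hmem : (σ, (0 : ℝ)) ∈ Ioo 0 σL ×ˢ Ici (0 : ℝ) := ⟨hσ, self_mem_Ici⟩
  have hc : ∀ {f : ℝ × ℝ → ℝ}, ContDiffOn ℝ 1 f (Ioo 0 σL ×ˢ Ici 0) → ∀ v, Tendsto
      (fun t : ℝ => fderivWithin ℝ f (Ioo 0 σL ×ˢ Ici 0) (σ, t) v) (𝓝[>] 0)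
      (𝓝 (fderivWithin ℝ f (Ioo 0 σL ×ˢ Ici 0) (σ, 0) v)) := fun {f} hf v => by
    have h1 : ContinuousOn (fun p => fderivWithin ℝ f (Ioo 0 σL ×ˢ Ici 0) p v)
        (Ioo 0 σL ×ˢ Ici 0) := (hf.continuousOn_fderivWithin hu le_rfl).clm_apply continuousOn_const
    have h2 : ContinuousOn (fun t : ℝ => fderivWithin ℝ f (Ioo 0 σL ×ˢ Ici 0) (σ, t) v) (Ici 0) :=
      h1.comp (f := fun t : ℝ => (σ, t)) (by fun_prop) fun t ht => ⟨hσ, ht⟩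
    exact (h2 0 self_mem_Ici).mono_left (nhdsWithin_mono _ Ioi_subset_Ici_self)
  have hφc : Tendsto (fun t => φ σ t) (𝓝[>] 0) (𝓝 (φ σ 0)) := by
    have : ContinuousOn (fun t => φ σ t) (Ici 0) := h.continuousOn_phi.comp
      (f := fun t : ℝ => (σ, t)) (by fun_prop) fun t ht => ⟨Ioo_subset_Icc_self hσ, ht⟩
    exact (this 0 self_mem_Ici).mono_left (nhdsWithin_mono _ Ioi_subset_Ici_self)
  have hfd : ∀ {f : ℝ × ℝ → ℝ}, ContDiffOn ℝ 1 f (Ioo 0 σL ×ˢ Ici 0) →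
      HasFDerivWithinAt f (fderivWithin ℝ f (Ioo 0 σL ×ˢ Ici 0) (σ, 0)) (Ioo 0 σL ×ˢ Ici 0)
        (σ, 0) := fun hf => (hf.differentiableOn (by norm_num) _ hmem).hasFDerivWithinAt
  have hφσ : fderivWithin ℝ Φ (Ioo 0 σL ×ˢ Ici 0) (σ, 0) (1, 0) = 0 := by
    have h1 : HasDerivWithinAt (fun y : ℝ => (y, (0 : ℝ))) ((1 : ℝ), (0 : ℝ)) (Ioo 0 σL) σ :=
      ((hasDerivAt_id σ).prodMk (hasDerivAt_const σ 0)).hasDerivWithinAt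
    have hΦ0 := hfd (f := Φ) h.contDiffOn_one_phi
    have h2 : HasDerivWithinAt (fun y => φ y 0)
        (fderivWithin ℝ Φ (Ioo 0 σL ×ˢ Ici 0) (σ, 0) (1, 0)) (Ioo 0 σL) σ :=
      HasFDerivWithinAt.comp_hasDerivWithinAt (f := fun y : ℝ => (y, (0 : ℝ)))
        (t := Ioo 0 σL ×ˢ Ici 0) σ hΦ0 h1 fun y hy => ⟨hy, self_mem_Ici⟩
    have h3 : HasDerivWithinAt (fun y => φ y 0) 0 (Ioo 0 σL) σ :=
      (hasDerivWithinAt_const σ _ (0 : ℝ)).congr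
        (fun y hy => (h.init_phi_psi (Ioo_subset_Icc_self hy)).1)
        (h.init_phi_psi (Ioo_subset_Icc_self hσ)).1
    exact (isOpen_Ioo.uniqueDiffOn σ hσ).eq_deriv _ h2 h3
  have hψτ : fderivWithin ℝ Ψ (Ioo 0 σL ×ˢ Ici 0) (σ, 0) (0, 1) = 0 := by
    have l1 := hc h.contDiffOn_one_psi (0, 1)
    have l2 := (((hc h.contDiffOn_one_phi (1, 0)).const_mul σ).neg).sub hφc
    rw [hφσ, (h.init_phi_psi (Ioo_subset_Icc_self hσ)).1] at l2
    simp only [mul_zero, neg_zero, sub_zero] at l2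
    refine tendsto_nhds_unique l1 (l2.congr' ?_)
    filter_upwards [self_mem_nhdsWithin] with t ht
    have hq : (σ, t) ∈ Ioo 0 σL ×ˢ Ioi (0 : ℝ) := ⟨hσ, ht⟩
    rw [fderivWithin_Ioo_prod_Ici hq, fderivWithin_Ioo_prod_Ici hq]
    linarith [(h.hodograph hq).1]
  have h1 : HasDerivWithinAt (fun t : ℝ => (σ, t)) ((0 : ℝ), (1 : ℝ)) (Ici 0) 0 :=
    ((hasDerivAt_const 0 σ).prodMk (hasDerivAt_id 0)).hasDerivWithinAt
  have h2 : HasDerivWithinAt (fun t => ψ σ t) _ (Ici 0) 0 :=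
    (hfd h.contDiffOn_one_psi).comp_hasDerivWithinAt (0 : ℝ) h1 fun t ht => ⟨hσ, ht⟩
  rwa [hψτ] at h2

theorem isIBVPSolution (h : IsNonbreakingWave σL R R' X u η φ ψ) :
    IsIBVPSolution σL (ψ σL) ψ where
  continuousOn := h.continuousOn_psi
  contDiffOn_one := h.contDiffOn_one_psi
  contDiffOn_two := h.contDiffOn_two_psi
  pde _ hσ _ hτ := h.wave_equation hσ hτ
  init _ hσ := (h.init_phi_psi hσ).2
  init_velocity _ hσ := h.init_velocity hσ
  boundary _ _ := rfl

theorem shore_time_mem (h : IsNonbreakingWave σL R R' X u η φ ψ) {t : ℝ} (ht : 0 ≤ t) :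
    (0 : ℝ) ∈ Icc 0 σL ∧ 0 ≤ t + R' t := by
  have := h.bijOn.mapsTo (h.shore_mem ht)
  rw [h.carrierGreenspan_shore ht] at this
  exact this

theorem phi_shore (h : IsNonbreakingWave σL R R' X u η φ ψ) {t : ℝ} (ht : 0 ≤ t) :
    φ 0 (t + R' t) = -R' t := by
  have := h.phi_eq (-R t) t (h.shore_mem ht)
  rw [h.shore_eta t ht, h.shore_u t ht] at this
  simpa using this

theorem psi_shore (h : IsNonbreakingWave σL R R' X u η φ ψ) {t : ℝ} (ht : 0 ≤ t) :
    ψ 0 (t + R' t) = R t + R' t ^ 2 / 2 := by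
  have := h.psi_eq (-R t) t (h.shore_mem ht)
  rw [h.shore_eta t ht, h.shore_u t ht] at this
  simpa using this

theorem bijOn_shore_time (h : IsNonbreakingWave σL R R' X u η φ ψ) :
    BijOn (fun t => t + R' t) (Ici 0) (Ici 0) := by
  have hcont : ContinuousOn (fun t => t + R' t) (Ici 0) :=
    continuousOn_id.add h.continuousOn_runup_deriv
  refine ⟨fun t ht => (h.shore_time_mem ht).2, fun t₁ ht₁ t₂ ht₂ he => ?_, fun τ hτ => ?_⟩
  · have h1 := h.bijOn.injOn (h.shore_mem ht₁) (h.shore_mem ht₂) (by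
      rw [h.carrierGreenspan_shore ht₁, h.carrierGreenspan_shore ht₂]
      exact Prod.ext rfl he)
    exact congrArg Prod.snd h1
  · have hτ : (0 : ℝ) ≤ τ := hτ
    have h0 : 0 + R' 0 = 0 := by
      have h1 := h.shore_u 0 le_rfl
      rw [h.init_runup, neg_zero, h.init_u 0 ⟨le_rfl, by
        rw [h.right_zero]; exact (h.shore_time_mem le_rfl).1.2⟩] at h1
      linarith
    obtain ⟨t, ht, hle⟩ : ∃ t, 0 ≤ t ∧ τ ≤ t + R' t := by
      -- Otherwise all shoreline times t + R'(t) stay in [0,τ], where φ(0,·) is bounded by some C.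
      -- Since R'(t) = −φ(0, t + R'(t)), this contradicts t + R'(t) < τ at t = τ + C + 1.
      by_contra! hlt
      have hφ : ContinuousOn (fun s => φ 0 s) (Icc 0 τ) := h.continuousOn_phi.comp
        (f := fun s : ℝ => ((0 : ℝ), s)) (by fun_prop)
        fun s hs => ⟨(h.shore_time_mem le_rfl).1, hs.1⟩
      obtain ⟨C, hC⟩ := isCompact_Icc.exists_bound_of_continuousOn hφ
      have hC0 : 0 ≤ C := (norm_nonneg _).trans (hC 0 (left_mem_Icc.2 hτ))
      have ht : 0 ≤ τ + C + 1 := by positivity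
      have h1 := hlt _ ht
      have h2 := hC _ ⟨(h.shore_time_mem ht).2, h1.le⟩
      rw [h.phi_shore ht, norm_neg, Real.norm_eq_abs] at h2
      linarith [neg_le_of_abs_le h2]
    have hivt := intermediate_value_Icc ht (hcont.mono Icc_subset_Ici_self)
    obtain ⟨s, hs, hsτ⟩ := hivt (show τ ∈ Icc (0 + R' 0) (t + R' t) by rw [h0]; exact ⟨hτ, hle⟩)
    exact ⟨s, hs.1, hsτ⟩

/-- The shoreline already covers the whole line σ = 0, so by injectivity no other point of the wet
region reaches it. -/
theorem sigma_pos (h : IsNonbreakingWave σL R R' X u η φ ψ) {x t : ℝ}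
    (hp : (x, t) ∈ wetRegion R X) (hx : -R t < x) :
    carrierGreenspan u η (x, t) ∈ Ioc 0 σL ×ˢ Ici (0 : ℝ) := by
  have hq := h.bijOn.mapsTo hp
  refine ⟨⟨hq.1.1.lt_of_ne' fun h0 => ?_, hq.1.2⟩, hq.2⟩
  obtain ⟨s, hs, hsτ⟩ := h.bijOn_shore_time.surjOn hq.2
  have := h.bijOn.injOn (h.shore_mem hs) hp
    ((h.carrierGreenspan_shore hs).trans (Prod.ext h0.symm hsτ))
  simp only [Prod.mk.injEq] at this
  rw [← this.1, ← this.2] at hx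
  exact lt_irrefl _ hx

end IsNonbreakingWave

/-! ### The series for the transformed velocity -/

section Coefficients

variable {σL M T : ℝ} {ψb ψb' ψb'' : ℝ → ℝ}

theorem abs_cosConv_le {k M T : ℝ} {f : ℝ → ℝ} (hT : 0 ≤ T) (hM : ∀ τ ∈ Icc 0 T, |f τ| ≤ M) :
    |cosConv k f T| ≤ M * T := by
  have := intervalIntegral.norm_integral_le_of_norm_le_const (a := 0) (b := T)
    (f := fun ξ => Real.cos (k * (T - ξ)) * f ξ) (C := M) fun ξ hξ => by
      rw [uIoc_of_le hT] at hξ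
      rw [norm_mul]
      exact (mul_le_of_le_one_left (norm_nonneg _) (Real.abs_cos_le_one _)).trans
        (hM ξ (Ioc_subset_Icc_self hξ))
  rwa [sub_zero, abs_of_nonneg hT] at this

theorem IsBoundaryDatum.cosConv_deriv_two (h : IsBoundaryDatum ψb ψb' ψb'')
    (hT : 0 ≤ T) (hM : ∀ τ ∈ Icc 0 T, |ψb'' τ| ≤ M) (k : ℝ) :
    cosConv k ψb'' T = ψb' T - k * sinConv k ψb' T := by
  have hu : uIcc 0 T = Icc 0 T := uIcc_of_le hT
  have harg : ∀ x, HasDerivAt (fun ξ => k * (T - ξ)) (-k) x := fun x => by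
    simpa using ((hasDerivAt_id x).const_sub T).const_mul k
  have h1 := intervalIntegral.integral_mul_deriv_eq_deriv_mul_of_hasDerivWithinAt
    (a := 0) (b := T) (u := fun ξ => Real.cos (k * (T - ξ))) (v := ψb')
    (fun x _ => (harg x).cos.hasDerivWithinAt)
    (fun x hx => by
      rw [hu] at hx ⊢
      exact (h.hasDeriv_two x hx.1).mono fun y hy => hy.1)
    (Continuous.intervalIntegrable (by fun_prop) _ _) (h.intervalIntegrable hT hM)
  rw [h.deriv_zero] at h1
  simp only [sub_self, mul_zero, Real.cos_zero, one_mul] at h1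
  rw [cosConv, h1, sinConv, ← intervalIntegral.integral_const_mul, sub_zero]
  congr 2; ext ξ; ring

theorem IsBoundaryDatum.integral_modeCoeff (h : IsBoundaryDatum ψb ψb' ψb'')
    (hσL : 0 < σL) (hT : 0 ≤ T) (hM : ∀ τ ∈ Icc 0 T, |ψb'' τ| ≤ M) (n : ℕ) :
    ∫ τ in (0 : ℝ)..T, modeCoeff σL ψb'' n τ =
      coeffB n / √(coeffA σL n) * sinConv √(coeffA σL n) ψb' T := by
  have hk := (Real.sqrt_pos.2 (coeffA_pos hσL n)).ne'
  set k := √(coeffA σL n) with hkdef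
  have hfc := continuous_extendIci h.continuousOn_deriv
  have hf : ∀ τ, 0 ≤ τ → ψb' τ = extendIci ψb' τ := fun τ hτ => (extendIci_of_nonneg ψb' hτ).symm
  have hd : ∀ τ ∈ uIcc 0 T, HasDerivAt (sinConv k (extendIci ψb')) (k * cosConv k (extendIci ψb') τ) τ :=
    fun τ _ => hasDerivAt_sinConv k hfc τ
  have hzc : Continuous (cosConv k (extendIci ψb')) :=
    continuous_iff_continuousAt.2 fun x => (hasDerivAt_cosConv k hfc x).continuousAt
  have h1 := intervalIntegral.integral_eq_sub_of_hasDerivAt hd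
    ((hzc.const_mul k).intervalIntegrable _ _)
  rw [sinConv_congr hf hT, show sinConv k (extendIci ψb') T =
    sinConv k (extendIci ψb') T - sinConv k (extendIci ψb') 0 by simp [sinConv], ← h1,
    ← intervalIntegral.integral_const_mul]
  refine intervalIntegral.integral_congr fun τ hτ => ?_
  rw [uIcc_of_le hT] at hτ
  rw [modeCoeff_eq_sinConv, ← hkdef, (h.sinConv_deriv hτ.1
    (fun t ht => hM t ⟨ht.1, ht.2.trans hτ.2⟩) k).1]
  congr 2
  refine intervalIntegral.integral_congr fun ξ hξ => ?_
  rw [uIcc_of_le hτ.1] at hξ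
  simp only [hf ξ hξ.1]

/-- Integrating in time gains a factor 1/√a_n that compensates j_n: √a_n times the sine convolution
of ψ_b' equals ψ_b' minus the cosine convolution of ψ_b'', hence is bounded by 2MT. So the φ-series
has the same majorant as the c_n. -/
theorem IsBoundaryDatum.besselZero_mul_abs_integral_modeCoeff_le (h : IsBoundaryDatum ψb ψb' ψb'')
    (hσL : 0 < σL) (hT : 0 ≤ T) (hM : ∀ τ ∈ Icc 0 T, |ψb'' τ| ≤ M) (n : ℕ) :
    besselZero n * |∫ τ in (0 : ℝ)..T, modeCoeff σL ψb'' n τ| ≤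
      |coeffB n| / √(coeffA σL n) * (4 * √σL * M * T) := by
  have hk := Real.sqrt_pos.2 (coeffA_pos hσL n)
  have hj : besselZero n = 2 * √σL * √(coeffA σL n) := by
    have := Real.sqrt_pos.2 hσL
    rw [sqrt_coeffA]
    field_simp
  rw [h.integral_modeCoeff hσL hT hM n, hj, abs_mul, abs_div, abs_of_pos hk]
  set k := √(coeffA σL n)
  have h1 := abs_cosConv_le (k := k) hT hM
  rw [h.cosConv_deriv_two hT hM] at h1
  have h2 : |ψb' T| ≤ M * T :=
    abs_le_mul_of_hasDerivWithinAt hT h.hasDeriv_two h.deriv_zero hM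
  have h3 : k * |sinConv k ψb' T| ≤ 2 * (M * T) := by
    rw [← abs_of_pos hk, ← abs_mul, abs_of_pos hk]
    have h4 := abs_sub_abs_le_abs_sub (k * sinConv k ψb' T) (ψb' T)
    rw [abs_sub_comm] at h4
    linarith
  calc 2 * √σL * k * (|coeffB n| / k * |sinConv k ψb' T|)
      = |coeffB n| / k * (2 * √σL * (k * |sinConv k ψb' T|)) := by ring
    _ ≤ |coeffB n| / k * (2 * √σL * (2 * (M * T))) := by gcongr
    _ = _ := by ring

theorem IsBoundaryDatum.abs_phiMode_le (h : IsBoundaryDatum ψb ψb' ψb'')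
    (hσL : 0 < σL) (hT : 0 ≤ T) (hM : ∀ τ ∈ Icc 0 T, |ψb'' τ| ≤ M) (n : ℕ) (σ : ℝ) :
    |phiMode σL ψb'' n σ T| ≤ |coeffB n| / √(coeffA σL n) * (4 * √σL * M * T) := by
  rw [phiMode, abs_mul, abs_mul, abs_of_pos (besselZero_pos n)]
  exact (mul_le_of_le_one_right (mul_nonneg (besselZero_pos n).le (abs_nonneg _))
    (abs_besselJ_one_le_one _)).trans (h.besselZero_mul_abs_integral_modeCoeff_le hσL hT hM n)

/-- Identifies the φ-mode with −∂_σ of d_n E₀(a_n σ), the n-th term of the time-integrated ψ-series.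
-/
theorem phiMode_eq (hσL : 0 < σL) {σ : ℝ} (hσ : 0 < σ) (f : ℝ → ℝ) (n : ℕ) (τ : ℝ) :
    1 / (2 * σL) * √(σL / σ) * phiMode σL f n σ τ =
      (∫ ξ in (0 : ℝ)..τ, modeCoeff σL f n ξ) * (besselE 1 (coeffA σL n * σ) * coeffA σL n) := by
  have hr : 0 < √(σ / σL) := Real.sqrt_pos.2 (div_pos hσ hσL)
  rw [phiMode, besselJ_one_mode hσL hσ.le, ← inv_div σ σL, Real.sqrt_inv]
  have : coeffA σL n = besselZero n ^ 2 / (4 * σL) := rfl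
  generalize besselE 1 (coeffA σL n * σ) = E
  rw [this]
  field_simp
  ring

theorem IsIBVPSolution.hasSum_integral_psiMode {ψ : ℝ → ℝ → ℝ} (hσL : 0 < σL)
    (h : IsIBVPSolution σL ψb ψ) (hb : IsBoundaryDatum ψb ψb' ψb'') (hT : 0 ≤ T)
    (hM : ∀ t ∈ Icc 0 T, |ψb'' t| ≤ M) {σ : ℝ} (hσ : σ ∈ Icc 0 σL) :
    HasSum (fun n => (∫ τ in (0 : ℝ)..T, modeCoeff σL ψb'' n τ) * besselE 0 (coeffA σL n * σ))
      ((∫ τ in (0 : ℝ)..T, ψ σ τ) - ∫ τ in (0 : ℝ)..T, ψb τ) := by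
  have key := hasSum_intervalIntegral_of_le (F := fun n τ => psiMode σL ψb'' n σ τ)
    ((summable_abs_coeffB_div_sqrt σL).mul_right (M * T)) hT (fun n => ?_) fun n τ hτ => ?_
  · simp only [psiMode, intervalIntegral.integral_mul_const, besselJ_zero_mode hσL hσ.1] at key
    refine (congrArg (HasSum _) ?_).mpr key
    rw [← intervalIntegral.integral_sub]
    · refine intervalIntegral.integral_congr fun τ hτ => ?_
      rw [uIcc_of_le hT] at hτ
      have := (h.hasSum_psiMode hσL hb hτ.1 (fun t ht => hM t ⟨ht.1, ht.2.trans hτ.2⟩) hσ).tsum_eq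
      simp only [psiMode, besselJ_zero_mode hσL hσ.1] at this
      exact this.symm
    · refine ContinuousOn.intervalIntegrable ?_
      rw [uIcc_of_le hT]
      exact h.continuousOn.comp (f := fun τ : ℝ => (σ, τ)) (by fun_prop) fun τ hτ => ⟨hσ, hτ.1⟩
    · refine ContinuousOn.intervalIntegrable ?_
      rw [uIcc_of_le hT]
      exact hb.continuousOn.mono Icc_subset_Ici_self
  · refine ContinuousOn.aestronglyMeasurable ?_ measurableSet_Ioc
    exact ((hb.continuousOn_modeCoeff hσL hM n).mono Ioc_subset_Icc_self).mul continuousOn_const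
  · rw [psiMode, norm_mul]
    exact (mul_le_of_le_one_right (abs_nonneg _) (abs_besselJ_zero_le_one _)).trans
      (abs_modeCoeff_le_of_le hM hτ n)

end Coefficients

namespace IsNonbreakingWave

variable {σL : ℝ} {R R' X : ℝ → ℝ} {u η φ ψ : ℝ → ℝ → ℝ}

/-- Differentiation under the integral, then ψ_σ = −φ_τ and φ(σ,0) = 0. -/
theorem hasDerivAt_integral_psi (h : IsNonbreakingWave σL R R' X u η φ ψ) {σ τ : ℝ}
    (hσ : σ ∈ Ioo 0 σL) (hτ : 0 ≤ τ) :
    HasDerivAt (fun y => ∫ t in (0 : ℝ)..τ, ψ y t) (-φ σ τ) σ := by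
  have hU := isOpen_Ioo_prod_Ioi σL
  set Ψ : ℝ × ℝ → ℝ := fun p => ψ p.1 p.2
  set D : ℝ × ℝ → ℝ := fun p => fderivWithin ℝ Ψ (Ioo 0 σL ×ˢ Ici 0) p (1, 0)
  have hD : ContinuousOn D (Ioo 0 σL ×ˢ Ici 0) :=
    (h.contDiffOn_one_psi.continuousOn_fderivWithin (uniqueDiffOn_Ioo_prod_Ici σL)
      le_rfl).clm_apply continuousOn_const
  have hDt : ∀ {y}, y ∈ Ioo 0 σL → ContinuousOn (fun t => D (y, t)) (Icc 0 τ) := fun {y} hy =>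
    hD.comp (by fun_prop) fun t ht => ⟨hy, ht.1⟩
  have hψt : ∀ {y}, y ∈ Ioo 0 σL → ContinuousOn (fun t => ψ y t) (Icc 0 τ) := fun {y} hy =>
    h.continuousOn_psi.comp (f := fun t : ℝ => (y, t)) (by fun_prop)
      fun t ht => ⟨Ioo_subset_Icc_self hy, ht.1⟩
  obtain ⟨α, hα, hασ⟩ := exists_between hσ.1
  obtain ⟨β, hσβ, hβ⟩ := exists_between hσ.2
  have hsub : Icc α β ⊆ Ioo 0 σL := fun y hy => ⟨hα.trans_le hy.1, hy.2.trans_lt hβ⟩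
  obtain ⟨C, hC⟩ := (isCompact_Icc.prod isCompact_Icc).exists_bound_of_continuousOn
    (hD.mono (prod_mono hsub (fun t ht => ht.1 : Icc 0 τ ⊆ Ici 0)))
  have key := (intervalIntegral.hasDerivAt_integral_of_dominated_loc_of_deriv_le (μ := volume)
    (a := 0) (b := τ) (F := ψ) (F' := fun y t => D (y, t)) (bound := fun _ => C)
    (Icc_mem_nhds hασ hσβ)
    (Filter.mem_of_superset (Icc_mem_nhds hασ hσβ) fun y hy => by
      rw [mem_ofPred_eq, uIoc_of_le hτ]
      exact ((hψt (hsub hy)).mono Ioc_subset_Icc_self).aestronglyMeasurable measurableSet_Ioc)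
    (ContinuousOn.intervalIntegrable (by rw [uIcc_of_le hτ]; exact hψt hσ))
    (by
      rw [uIoc_of_le hτ]
      exact ((hDt hσ).mono Ioc_subset_Icc_self).aestronglyMeasurable measurableSet_Ioc)
    (Eventually.of_forall fun t ht y hy => by
      rw [uIoc_of_le hτ] at ht
      exact hC (y, t) ⟨hy, Ioc_subset_Icc_self ht⟩)
    intervalIntegrable_const
    (Eventually.of_forall fun t ht y hy => by
      rw [uIoc_of_le hτ] at ht
      have hq : (y, t) ∈ Ioo 0 σL ×ˢ Ioi (0 : ℝ) := ⟨hsub hy, ht.1⟩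
      simp only [D]
      rw [fderivWithin_Ioo_prod_Ici hq]
      exact (h.contDiffOn_two_psi.hasFDerivAt_of_isOpen hU hq).hasDerivAt_fst)).2
  refine key.congr_deriv ?_
  have hφ : ContinuousOn (fun t => -φ σ t) (Icc 0 τ) := (h.continuousOn_phi.comp
    (f := fun t : ℝ => (σ, t)) (by fun_prop) fun t ht => ⟨Ioo_subset_Icc_self hσ, ht.1⟩).neg
  rw [intervalIntegral.integral_eq_sub_of_hasDerivAt_of_le hτ hφ (fun t ht => ?_)
    (ContinuousOn.intervalIntegrable (by rw [uIcc_of_le hτ]; exact hDt hσ)),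
    (h.init_phi_psi (Ioo_subset_Icc_self hσ)).1]
  · ring
  · have hq : (σ, t) ∈ Ioo 0 σL ×ˢ Ioi (0 : ℝ) := ⟨hσ, ht.1⟩
    refine ((h.contDiffOn_two_phi.hasFDerivAt_of_isOpen hU hq).hasDerivAt_snd.neg).congr_deriv ?_
    simp only [D]
    rw [fderivWithin_Ioo_prod_Ici hq]
    linarith [(h.hodograph hq).2]

/-- Termwise differentiation in σ of the expansion of the time integral of ψ − ψ_b. The prefactor
√(σ_L/σ) is unbounded at 0, so the majorant is taken on [α, σ_L] with 0 < α < σ. -/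
theorem hasSum_phiMode (h : IsNonbreakingWave σL R R' X u η φ ψ) (hσL : 0 < σL)
    {ψb' ψb'' : ℝ → ℝ} (hb : IsBoundaryDatum (ψ σL) ψb' ψb'') {τ M : ℝ} (hτ : 0 ≤ τ)
    (hM : ∀ t ∈ Icc 0 τ, |ψb'' t| ≤ M) {σ : ℝ} (hσ : σ ∈ Ioc 0 σL) :
    HasSum (fun n => 1 / (2 * σL) * √(σL / σ) * phiMode σL ψb'' n σ τ) (φ σ τ) := by
  set d : ℕ → ℝ := fun n => ∫ ξ in (0 : ℝ)..τ, modeCoeff σL ψb'' n ξ with hd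
  obtain ⟨α, hα, hασ⟩ := exists_between hσ.1
  set B : ℕ → ℝ := fun n => 1 / (2 * σL) * √(σL / α) *
    (|coeffB n| / √(coeffA σL n) * (4 * √σL * M * τ)) with hB
  have hBs : Summable B := ((summable_abs_coeffB_div_sqrt σL).mul_right _).mul_left _
  have hle : ∀ n, ∀ y ∈ Icc α σL, ‖d n * (besselE 1 (coeffA σL n * y) * coeffA σL n)‖ ≤ B n :=
    fun n y hy => by
      have hy0 : 0 < y := hα.trans_le hy.1
      rw [hd, ← phiMode_eq hσL hy0, norm_mul, Real.norm_of_nonneg (by positivity)]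
      have := hb.abs_phiMode_le hσL hτ hM n y
      have h1 := hy.1
      simp only [hB]
      gcongr
      exact this
  have hcont : ContinuousOn (fun y => ∑' n, d n * (besselE 1 (coeffA σL n * y) * coeffA σL n))
      (Icc α σL) := continuousOn_tsum (fun n => by
        have := continuous_besselE_mul_real 1 (coeffA σL n)
        exact Continuous.continuousOn (by fun_prop)) hBs hle
  have hφc : ContinuousOn (fun y => φ y τ) (Icc α σL) := h.continuousOn_phi.comp
    (f := fun y : ℝ => (y, τ)) (by fun_prop) fun y hy => ⟨⟨hα.le.trans hy.1, hy.2⟩, hτ⟩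
  have hαL : α < σL := hασ.trans_le hσ.2
  have hint : EqOn (fun y => ∑' n, d n * (besselE 1 (coeffA σL n * y) * coeffA σL n))
      (fun y => φ y τ) (Ioo α σL) := fun y hy => by
    have hsum : ∀ z ∈ Ioo α σL, HasSum (fun n => d n * besselE 0 (coeffA σL n * z))
        ((∫ t in (0 : ℝ)..τ, ψ z t) - ∫ t in (0 : ℝ)..τ, ψ σL t) := fun z hz =>
      h.isIBVPSolution.hasSum_integral_psiMode hσL hb hτ hM ⟨hα.le.trans hz.1.le, hz.2.le⟩
    have h1 := hasDerivAt_tsum_of_isPreconnected (t := Ioo α σL)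
      (g := fun n y => d n * besselE 0 (coeffA σL n * y))
      (g' := fun n y => -(d n * (besselE 1 (coeffA σL n * y) * coeffA σL n)))
      hBs isOpen_Ioo isPreconnected_Ioo
      (fun n z _ => ((hasDerivAt_besselE_mul_real 0 (coeffA σL n) z).const_mul (d n)).congr_deriv
        (by ring)) (fun n z hz => by
          rw [norm_neg]; exact hle n z (Ioo_subset_Icc_self hz)) hy (hsum y hy).summable hy
    have h2 := (h.hasDerivAt_integral_psi (σ := y) ⟨hα.trans hy.1, hy.2⟩ hτ).sub_const
      (∫ t in (0 : ℝ)..τ, ψ σL t)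
    have h3 := h1.unique (h2.congr_of_eventuallyEq (by
      filter_upwards [Ioo_mem_nhds hy.1 hy.2] with z hz using (hsum z hz).tsum_eq))
    rw [tsum_neg] at h3
    exact neg_injective h3
  -- The derivative argument covers the open interval; both sides are continuous on [α, σ_L], which
  -- includes σ = σ_L.
  have heq : ∑' n, d n * (besselE 1 (coeffA σL n * σ) * coeffA σL n) = φ σ τ := hint.of_subset_closure hcont hφc Ioo_subset_Icc_self (closure_Ioo hαL.ne).superset
    ⟨hασ.le, hσ.2⟩
  simp only [phiMode_eq hσL hσ.1]
  rw [← heq]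
  exact (hBs.of_norm_bounded fun n => hle n σ ⟨hασ.le, hσ.2⟩).hasSum

end IsNonbreakingWave

/-! ### Recovery of the wave from the run-up -/

theorem IsIBVPSolution.shorelineEquation {σL : ℝ} (hσL : 0 < σL) {ψb ψb' ψb'' : ℝ → ℝ}
    {ψ : ℝ → ℝ → ℝ} (h : IsIBVPSolution σL ψb ψ) (hb : IsBoundaryDatum ψb ψb' ψb'')
    (hbd : BoundedOnHalfLine ψb'') : ShorelineEquation σL ψb ψb'' (fun τ => ψ 0 τ) := by
  obtain ⟨M, hM⟩ := hbd
  intro τ hτ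
  have := h.hasSum_psiMode hσL hb hτ (fun t ht => hM t ht.1) (left_mem_Icc.2 hσL.le)
  simpa only [psiMode_zero] using this

namespace IsNonbreakingWave

variable {σL : ℝ} {R R' X : ℝ → ℝ} {u η φ ψ : ℝ → ℝ → ℝ}

/-- Since t ↦ t + R'(t) is onto [0,∞), the prescribed relation forces ψ_sh = ψ(0,·) there. -/
theorem shorelineEquation (h : IsNonbreakingWave σL R R' X u η φ ψ) (hσL : 0 < σL)
    {g f ψsh : ℝ → ℝ} (hb : IsBoundaryDatum (ψ σL) g f) (hbd : BoundedOnHalfLine f)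
    (hsh : ∀ t, 0 ≤ t → ψsh (t + R' t) = R t + R' t ^ 2 / 2) :
    ShorelineEquation σL (ψ σL) f ψsh := fun τ hτ => by
  obtain ⟨t, ht, rfl⟩ := h.bijOn_shore_time.surjOn hτ
  beta_reduce
  rw [hsh t ht, ← h.psi_shore ht]
  exact h.isIBVPSolution.shorelineEquation hσL hb hbd _ hτ

theorem psi_eq_series (h : IsNonbreakingWave σL R R' X u η φ ψ) (hσL : 0 < σL)
    {f : ℝ → ℝ} (hf : HasBoundedTrace σL ψ f) {σ τ : ℝ} (hσ : σ ∈ Icc 0 σL) (hτ : 0 ≤ τ) :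
    Summable (fun n => psiMode σL f n σ τ) ∧ ψ σ τ = psiSeries σL (ψ σL) f σ τ := by
  obtain ⟨⟨g, hb⟩, M, hM⟩ := hf
  have := h.isIBVPSolution.hasSum_psiMode hσL hb hτ (fun t ht => hM t ht.1) hσ
  refine ⟨this.summable, ?_⟩
  rw [psiSeries, this.tsum_eq, sub_add_cancel]

theorem phi_eq_series (h : IsNonbreakingWave σL R R' X u η φ ψ) (hσL : 0 < σL)
    {f : ℝ → ℝ} (hf : HasBoundedTrace σL ψ f) {σ τ : ℝ} (hσ : σ ∈ Ioc 0 σL) (hτ : 0 ≤ τ) :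
    Summable (fun n => phiMode σL f n σ τ) ∧ φ σ τ = phiSeries σL f σ τ := by
  obtain ⟨⟨g, hb⟩, M, hM⟩ := hf
  have h1 := h.hasSum_phiMode hσL hb hτ (fun t ht => hM t ht.1) hσ
  have h2 : Summable (fun n => phiMode σL f n σ τ) :=
    ((summable_abs_coeffB_div_sqrt σL).mul_right _).of_norm_bounded
      fun n => hb.abs_phiMode_le hσL hτ (fun t ht => hM t ht.1) n σ
  refine ⟨h2, ?_⟩
  rw [phiSeries, ← tsum_mul_left, h1.tsum_eq]

/-- The two equations say that the explicit inverse map sends (σ,τ) to (L,t), so bijectivity leaves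
one candidate. Arbitrary P and S agreeing with ψ and φ are allowed so that two waves can be compared
through the same pair of series. -/
theorem existsUnique_hodograph (h : IsNonbreakingWave σL R R' X u η φ ψ) {P S : ℝ → ℝ → ℝ}
    (hP : ∀ σ ∈ Ioc 0 σL, ∀ τ, 0 ≤ τ → ψ σ τ = P σ τ)
    (hS : ∀ σ ∈ Ioc 0 σL, ∀ τ, 0 ≤ τ → φ σ τ = S σ τ)
    {L t : ℝ} (ht : 0 ≤ t) (hL : -R t < L) (hLX : L ≤ X t) :
    (∃! p : ℝ × ℝ, p ∈ Ioc 0 σL ×ˢ Ici (0 : ℝ) ∧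
      p.1 = L + P p.1 p.2 - S p.1 p.2 ^ 2 / 2 ∧ p.2 = t - S p.1 p.2) ∧
    ∀ σ ∈ Ioc 0 σL, ∀ τ, 0 ≤ τ → σ = L + P σ τ - S σ τ ^ 2 / 2 → τ = t - S σ τ →
      u L t = S σ τ ∧ η L t = P σ τ - S σ τ ^ 2 / 2 := by
  have hp : (L, t) ∈ wetRegion R X := ⟨ht, hL.le, hLX⟩
  have huniq : ∀ σ ∈ Ioc 0 σL, ∀ τ, 0 ≤ τ → σ = L + P σ τ - S σ τ ^ 2 / 2 → τ = t - S σ τ →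
      carrierGreenspan u η (L, t) = (σ, τ) := fun σ hσ τ hτ e1 e2 => by
    rw [← hP σ hσ τ hτ, ← hS σ hσ τ hτ] at e1
    rw [← hS σ hσ τ hτ] at e2
    have := (h.carrierGreenspan_inv (q := (σ, τ)) ⟨⟨hσ.1.le, hσ.2⟩, hτ⟩).2
    rwa [show carrierGreenspanInv φ ψ (σ, τ) = (L, t) from
      Prod.ext (by simp only [carrierGreenspanInv]; linarith)
        (by simp only [carrierGreenspanInv]; linarith)] at this
  have hφ := h.phi_eq L t hp
  have hψ := h.psi_eq L t hp
  have hq := h.sigma_pos hp hL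
  refine ⟨⟨carrierGreenspan u η (L, t), ⟨hq, ?_, ?_⟩, ?_⟩, ?_⟩
  · rw [← hP _ hq.1 _ hq.2, ← hS _ hq.1 _ hq.2]
    simp only [carrierGreenspan, hφ, hψ]
    ring
  · rw [← hS _ hq.1 _ hq.2]
    simp only [carrierGreenspan, hφ]
  · rintro ⟨σ, τ⟩ ⟨⟨hσ, hτ⟩, e1, e2⟩
    exact (huniq σ hσ τ hτ e1 e2).symm
  · intro σ hσ τ hτ e1 e2
    have h1 := huniq σ hσ τ hτ e1 e2
    have h2 : L + η L t = σ := congrArg Prod.fst h1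
    have h3 : t - u L t = τ := congrArg Prod.snd h1
    rw [h2, h3] at hφ hψ
    rw [← hP σ hσ τ hτ, ← hS σ hσ τ hτ, hφ, hψ]
    exact ⟨rfl, by ring⟩

end IsNonbreakingWave

theorem psiSeries_congr {σL : ℝ} {a b f g : ℝ → ℝ} (hab : ∀ τ, 0 ≤ τ → a τ = b τ)
    (hfg : ∀ τ, 0 ≤ τ → f τ = g τ) (σ : ℝ) {τ : ℝ} (hτ : 0 ≤ τ) :
    psiSeries σL a f σ τ = psiSeries σL b g σ τ := by
  simp only [psiSeries, psiMode, modeCoeff_congr hfg _ hτ, hab τ hτ]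

theorem phiSeries_congr {σL : ℝ} {f g : ℝ → ℝ} (hfg : ∀ τ, 0 ≤ τ → f τ = g τ) (σ : ℝ) {τ : ℝ}
    (hτ : 0 ≤ τ) : phiSeries σL f σ τ = phiSeries σL g σ τ := by
  have : ∀ n, ∫ ξ in (0 : ℝ)..τ, modeCoeff σL f n ξ = ∫ ξ in (0 : ℝ)..τ, modeCoeff σL g n ξ :=
    fun n => intervalIntegral.integral_congr fun ξ hξ => by
      rw [uIcc_of_le hτ] at hξ
      exact modeCoeff_congr hfg n hξ.1
  simp only [phiSeries, phiMode, this]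

theorem IsBoundaryDatum.deriv_two_unique {a a' a'' b b' b'' : ℝ → ℝ} (ha : IsBoundaryDatum a a' a'')
    (hb : IsBoundaryDatum b b' b'') (hab : ∀ τ, 0 ≤ τ → a τ = b τ) {τ : ℝ} (hτ : 0 ≤ τ) :
    a'' τ = b'' τ := by
  have h1 : ∀ t, 0 ≤ t → a' t = b' t := fun t ht =>
    (uniqueDiffOn_Ici 0 t ht).eq_deriv _ (ha.hasDeriv_one t ht)
      ((hb.hasDeriv_one t ht).congr (fun s hs => hab s hs) (hab t ht))
  exact (uniqueDiffOn_Ici 0 τ hτ).eq_deriv _ (ha.hasDeriv_two τ hτ)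
    ((hb.hasDeriv_two τ hτ).congr (fun s hs => h1 s hs) (h1 τ hτ))

theorem IsNonbreakingWave.eq_of_runup_eq {σL : ℝ} (hσL : 0 < σL) {R R' X₁ X₂ : ℝ → ℝ}
    {u₁ η₁ φ₁ ψ₁ u₂ η₂ φ₂ ψ₂ : ℝ → ℝ → ℝ} {f₁ f₂ : ℝ → ℝ}
    (h₁ : IsNonbreakingWave σL R R' X₁ u₁ η₁ φ₁ ψ₁) (hf₁ : HasBoundedTrace σL ψ₁ f₁)
    (h₂ : IsNonbreakingWave σL R R' X₂ u₂ η₂ φ₂ ψ₂) (hf₂ : HasBoundedTrace σL ψ₂ f₂)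
    {L t : ℝ} (ht : 0 ≤ t) (hL : -R t < L) (hL₁ : L ≤ X₁ t) (hL₂ : L ≤ X₂ t) :
    u₁ L t = u₂ L t ∧ η₁ L t = η₂ L t := by
  obtain ⟨⟨g₁, hb₁⟩, hbd₁⟩ := id hf₁
  obtain ⟨⟨g₂, hb₂⟩, hbd₂⟩ := id hf₂
  -- The shoreline relation depends only on R and R', so the shoreline trace of the first wave
  -- serves for both; the inversion formula then gives equal boundary data.
  have hs₁ := h₁.shorelineEquation hσL hb₁ hbd₁ (ψsh := ψ₁ 0) fun t ht => h₁.psi_shore ht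
  have hs₂ := h₂.shorelineEquation hσL hb₂ hbd₂ (ψsh := ψ₁ 0) fun t ht => h₁.psi_shore ht
  obtain ⟨M₁, hM₁⟩ := hbd₁
  obtain ⟨M₂, hM₂⟩ := hbd₂
  have hψ : ∀ τ, 0 ≤ τ → ψ₁ σL τ = ψ₂ σL τ := fun τ hτ => by
    have e1 := (hb₁.inversion hσL hM₁ hs₁ one_pos hτ).2
    have e2 := (hb₂.inversion hσL hM₂ hs₂ one_pos hτ).2
    exact_mod_cast e1.trans e2.symm
  have hf : ∀ τ, 0 ≤ τ → f₁ τ = f₂ τ := fun τ hτ => hb₁.deriv_two_unique hb₂ hψ hτ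
  -- Both waves are expressed by the series of the first. A point (σ,τ) solving the equations for
  -- (L,t) then gives u and η of either wave by the same formula.
  have k₁ := h₁.existsUnique_hodograph (P := psiSeries σL (ψ₁ σL) f₁) (S := phiSeries σL f₁)
    (fun σ hσ τ hτ => (h₁.psi_eq_series hσL hf₁ ⟨hσ.1.le, hσ.2⟩ hτ).2)
    (fun σ hσ τ hτ => (h₁.phi_eq_series hσL hf₁ hσ hτ).2) ht hL hL₁
  have k₂ := h₂.existsUnique_hodograph (P := psiSeries σL (ψ₁ σL) f₁) (S := phiSeries σL f₁)
    (fun σ hσ τ hτ => (h₂.psi_eq_series hσL hf₂ ⟨hσ.1.le, hσ.2⟩ hτ).2.trans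
      (psiSeries_congr hψ hf σ hτ).symm)
    (fun σ hσ τ hτ => (h₂.phi_eq_series hσL hf₂ hσ hτ).2.trans
      (phiSeries_congr hf σ hτ).symm) ht hL hL₂
  obtain ⟨⟨σ, τ⟩, ⟨⟨hσ, hτ⟩, e1, e2⟩, -⟩ := k₁.1
  have r₁ := k₁.2 σ hσ τ hτ e1 e2
  have r₂ := k₂.2 σ hσ τ hτ e1 e2
  exact ⟨r₁.1.trans r₂.1.symm, r₁.2.trans r₂.2.symm⟩

end


/-! ### Assembly of parts A and B -/

theorem mainTheorem1 (σL : ℝ) (hσL : 0 < σL) :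
    -- the linearised problem
    (∀ ψb ψb' ψb'' : ℝ → ℝ, IsBoundaryDatum ψb ψb' ψb'' →
      -- finite time window: uniform convergence, interchange, shoreline equation
      (∀ T M : ℝ, 0 ≤ T → (∀ τ ∈ Icc 0 T, |ψb'' τ| ≤ M) →
        (∀ τ ∈ Icc 0 T, Summable (fun n => modeCoeff σL ψb'' n τ)) ∧
        TendstoUniformlyOn (fun (N : ℕ) (τ : ℝ) => ∑ n ∈ Finset.range N, modeCoeff σL ψb'' n τ)
          (fun τ => ∑' n, modeCoeff σL ψb'' n τ) atTop (Icc 0 T) ∧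
        (∀ s : ℂ, HasSum
          (fun n => ∫ τ in (0 : ℝ)..T, laplaceIntegrand (modeCoeff σL ψb'' n) s τ)
          (∫ τ in (0 : ℝ)..T, laplaceIntegrand (fun τ => ∑' n, modeCoeff σL ψb'' n τ) s τ)) ∧
        (∀ ψ : ℝ → ℝ → ℝ, IsIBVPSolution σL ψb ψ → ∀ τ ∈ Icc 0 T,
          (∀ σ ∈ Icc 0 σL, HasSum (fun n => psiMode σL ψb'' n σ τ) (ψ σ τ - ψb τ)) ∧
          HasSum (fun n => modeCoeff σL ψb'' n τ) (ψ 0 τ - ψb τ))) ∧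
      -- bounded second derivative on `[0,∞)`: Laplace transform and inversion
      (BoundedOnHalfLine ψb'' →
        (∀ ψ : ℝ → ℝ → ℝ, IsIBVPSolution σL ψb ψ →
          ShorelineEquation σL ψb ψb'' (fun τ => ψ 0 τ)) ∧
        (∀ ψsh : ℝ → ℝ, ShorelineEquation σL ψb ψb'' ψsh →
          (∀ s : ℂ, 0 < s.re →
            LaplaceConvergent ψb s ∧ LaplaceConvergent ψsh s ∧
            (∀ n, LaplaceConvergent (modeCoeff σL ψb'' n) s ∧
              laplace (modeCoeff σL ψb'' n) s =
                s ^ 2 * ((coeffB n : ℂ) / ((coeffA σL n : ℂ) + s ^ 2)) * laplace ψb s) ∧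
            HasSum (fun n => laplace (modeCoeff σL ψb'' n) s) (laplace ψsh s - laplace ψb s) ∧
            Summable (fun n => (coeffB n : ℂ) / ((coeffA σL n : ℂ) + s ^ 2)) ∧
            laplace ψsh s = laplace ψb s * transferFactor σL s ∧
            transferFactor σL s ≠ 0) ∧
          (∀ γ : ℝ, 0 < γ → ∀ τ : ℝ, 0 ≤ τ →
            Integrable (bromwichIntegrand γ
              (fun s => laplace ψsh s * (transferFactor σL s)⁻¹) τ) ∧
            (ψb τ : ℂ) =
              inverseLaplace γ (fun s => laplace ψsh s * (transferFactor σL s)⁻¹) τ)))) ∧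
    -- recovery of the buoy data from the run-up
    (∀ (R R' X : ℝ → ℝ) (u η φ ψ : ℝ → ℝ → ℝ), IsNonbreakingWave σL R R' X u η φ ψ →
      (∀ σ ∈ Ioo 0 σL, ∀ τ ∈ Ioi (0 : ℝ),
        deriv (fun t => ψ σ t) τ + σ * deriv (fun y => φ y τ) σ + φ σ τ = 0 ∧
        deriv (fun t => φ σ t) τ + deriv (fun y => ψ y τ) σ = 0) ∧
      IsIBVPSolution σL (ψ σL) ψ ∧
      BijOn (fun t => t + R' t) (Ici 0) (Ici 0) ∧
      (∀ t, 0 ≤ t → ψ 0 (t + R' t) = R t + R' t ^ 2 / 2) ∧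
      (∀ ψb'' : ℝ → ℝ, HasBoundedTrace σL ψ ψb'' →
        (∀ ψsh : ℝ → ℝ, (∀ t, 0 ≤ t → ψsh (t + R' t) = R t + R' t ^ 2 / 2) →
          ∀ γ : ℝ, 0 < γ → ∀ τ : ℝ, 0 ≤ τ →
            Integrable (bromwichIntegrand γ
              (fun s => laplace ψsh s * (transferFactor σL s)⁻¹) τ) ∧
            (ψ σL τ : ℂ) =
              inverseLaplace γ (fun s => laplace ψsh s * (transferFactor σL s)⁻¹) τ) ∧
        (∀ σ ∈ Icc 0 σL, ∀ τ, 0 ≤ τ →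
          Summable (fun n => psiMode σL ψb'' n σ τ) ∧
          ψ σ τ = psiSeries σL (ψ σL) ψb'' σ τ) ∧
        (∀ σ ∈ Ioc 0 σL, ∀ τ, 0 ≤ τ →
          Summable (fun n => phiMode σL ψb'' n σ τ) ∧
          φ σ τ = phiSeries σL ψb'' σ τ) ∧
        (∀ L t : ℝ, 0 ≤ t → -R t < L → L ≤ X t →
          (∃! p : ℝ × ℝ, p ∈ Ioc 0 σL ×ˢ Ici (0 : ℝ) ∧
            p.1 = L + psiSeries σL (ψ σL) ψb'' p.1 p.2 - phiSeries σL ψb'' p.1 p.2 ^ 2 / 2 ∧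
            p.2 = t - phiSeries σL ψb'' p.1 p.2) ∧
          (∀ σ ∈ Ioc 0 σL, ∀ τ, 0 ≤ τ →
            σ = L + psiSeries σL (ψ σL) ψb'' σ τ - phiSeries σL ψb'' σ τ ^ 2 / 2 →
            τ = t - phiSeries σL ψb'' σ τ →
            u L t = phiSeries σL ψb'' σ τ ∧
            η L t = psiSeries σL (ψ σL) ψb'' σ τ - phiSeries σL ψb'' σ τ ^ 2 / 2)))) ∧
    -- the run-up determines the buoy data
    (∀ (R R' X₁ X₂ : ℝ → ℝ) (u₁ η₁ φ₁ ψ₁ u₂ η₂ φ₂ ψ₂ : ℝ → ℝ → ℝ) (f₁ f₂ : ℝ → ℝ),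
      IsNonbreakingWave σL R R' X₁ u₁ η₁ φ₁ ψ₁ → HasBoundedTrace σL ψ₁ f₁ →
      IsNonbreakingWave σL R R' X₂ u₂ η₂ φ₂ ψ₂ → HasBoundedTrace σL ψ₂ f₂ →
      ∀ L t : ℝ, 0 ≤ t → -R t < L → L ≤ X₁ t → L ≤ X₂ t →
        u₁ L t = u₂ L t ∧ η₁ L t = η₂ L t) := by
  refine ⟨fun ψb ψb' ψb'' hb => ⟨fun T M hT hM => ⟨?_, ?_, ?_, ?_⟩, fun hbd => ⟨?_, ?_⟩⟩,
    fun R R' X u η φ ψ h => ⟨?_, h.isIBVPSolution, h.bijOn_shore_time,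
      fun t ht => h.psi_shore ht, fun f hf => ⟨?_, ?_, ?_, ?_⟩⟩, ?_⟩
  · intro τ hτ
    exact (summable_modeCoeff hτ.1 fun t ht => hM t ⟨ht.1, ht.2.trans hτ.2⟩).of_abs
  · exact tendstoUniformlyOn_sum_modeCoeff hM
  · exact hb.hasSum_integral_laplaceIntegrand hσL hT hM
  · intro ψ hψ τ hτ
    have key : ∀ σ ∈ Icc 0 σL, HasSum (fun n => psiMode σL ψb'' n σ τ) (ψ σ τ - ψb τ) :=
      fun σ hσ => hψ.hasSum_psiMode hσL hb hτ.1 (fun t ht => hM t ⟨ht.1, ht.2.trans hτ.2⟩) hσ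
    exact ⟨key, by simpa only [psiMode_zero] using key 0 (left_mem_Icc.2 hσL.le)⟩
  · exact fun ψ hψ => hψ.shorelineEquation hσL hb hbd
  · intro ψsh hsh
    obtain ⟨M, hM⟩ := hbd
    refine ⟨fun s hs => ?_, fun γ hγ τ hτ => hb.inversion hσL hM hsh hγ hτ⟩
    obtain ⟨h1, h2⟩ := hb.hasSum_laplace_modeCoeff hσL hM hsh hs
    obtain ⟨h3, h4⟩ := hb.laplace_shoreline hσL hM hsh hs
    exact ⟨hb.laplaceConvergent hM hs, h1, hb.laplace_modeCoeff hσL hM hs, h2,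
      (summable_coeffB_div_coeffA_add_sq hσL s).of_norm, h3, h4⟩
  · exact fun σ hσ τ hτ => h.hodograph_deriv hσ hτ
  · intro ψsh hsh γ hγ τ hτ
    obtain ⟨⟨g, hb⟩, hbd⟩ := hf
    have hs := h.shorelineEquation hσL hb hbd hsh
    obtain ⟨M, hM⟩ := hbd
    exact hb.inversion hσL hM hs hγ hτ
  · exact fun σ hσ τ hτ => h.psi_eq_series hσL hf hσ hτ
  · exact fun σ hσ τ hτ => h.phi_eq_series hσL hf hσ hτ
  · exact fun L t ht hL hLX => h.existsUnique_hodograph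
      (fun σ hσ τ hτ => (h.psi_eq_series hσL hf ⟨hσ.1.le, hσ.2⟩ hτ).2)
      (fun σ hσ τ hτ => (h.phi_eq_series hσL hf hσ hτ).2) ht hL hLX
  · exact fun R R' X₁ X₂ u₁ η₁ φ₁ ψ₁ u₂ η₂ φ₂ ψ₂ f₁ f₂ h₁ hf₁ h₂ hf₂ L t ht hL hL₁ hL₂ =>
      h₁.eq_of_runup_eq hσL hf₁ h₂ hf₂ ht hL hL₁ hL₂
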